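/- For a simple graph $G$ on $n$ vertices (numbered $1,\dots,n$) put $C_G=\sum_{jk\in E(G)}C_{jk}$ with $C_{jk}=\frac12(1+Z_jZ_k)$, acting on $n$ qubits, and for $p\ge 0$ and angles $\gamma,\beta\in\mathbb R^p$ let $$|\gamma,\beta\rangle_G=\prod_{q=0}^{p-1}\Bigl(\prod_{v\in V(G)}e^{-i\beta_qX_v}\prod_{jk\in E(G)}e^{-i\gamma_qC_{jk}}\Bigr)\,|+\rangle^{\otimes n}$$ (level $q=0$ acting first) be the level-$p$ QAOA state and $E(G,\gamma,\beta)=\langle\gamma,\beta|C_G|\gamma,\beta\rangle$ its energy. The average energy gap of two graphs on the same vertex set is $$\Delta(G_1,G_2,p)=\mathbb E\,\bigl|E(G_1,\gamma,\beta)-E(G_2,\gamma,\beta)\bigr|,\qquad(\gamma,\beta)\text{ uniform in }[0,2\pi]^{2p}.$$ The random-angle energy comparison with parameters (maximal level $L$, number $M$ of rounds, number $b$ of angle bits, number $N$ of shots, precision $D$) is the following procedure on a pair $(G_1,G_2)$. For each $p=0,1,\dots,L$ play $M$ independent rounds. In a round, draw $\gamma,\beta$ with $2p$ independent entries, uniform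 in $\{2\pi j/2^b:0\le j<2^b\}$; for each of $G=G_1,G_2$, with these same angles, prepare and measure $|\gamma,\beta\rangle_G$ in the computational basis $N$ times and let $\tilde E_G$ be the average of the values $C_G(z)$ (the number of edges of $G$ not cut by $z$) of the outcomes $z$. Answer "isomorphic" if $|\tilde E_{G_1}-\tilde E_{G_2}|\le 1/D$ in all rounds, and "not isomorphic" otherwise. A quantum algorithm is a program for a classical random access machine with logarithmic cost which can build quantum circuits from Hadamard gates, controlled-not gates and phase gates $\mathrm{diag}(1,e^{2\pi i/2^k})$ (cost $1+k$), have them run on $|0\cdots0\rangle$, and measure all qubits in the computational basis. **Theorem.** Suppose that there are real polynomials $P,Q$ such that for every $n$ and all non-isomorphic graphs $G_1,G_2$ on $n$ vertices we have $Q(n)>0$ and there is an integer $p$ with $0\le p\le P(n)$ and $\Delta(G_1,G_2,p)\ge 1/Q(n)$. Then there are polynomials $L,M,b,N,D$ with natural coefficients and a quantum algorithm such that 1. on every pair $(G_1,G_2)$ of graphs on $n$ vertices, the distribution of the answer of the algorithm is that of the random-angle energy comparison with parameters $L(n),M(n),b(n),N(n),D(n)$; 2. on every such pair the cost of the algorithm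 is at most a fixed polynomial in $n$, for all measurement results; 3. the algorithm decides graph isomorphism with bounded error: its answer is "isomorphic" with probability at least $2/3$ if $G_1\cong G_2$, and "not isomorphic" with probability at least $2/3$ otherwise. -/

import Mathlib

open MeasureTheory
open scoped Matrix

/-! ## The QAOA state, its energy, and the average energy gap -/

namespace QAOA

/-- Labels of the computational basis of `n` qubits. -/
abbrev Bits (n : ℕ) : Type := Fin n → Bool

/-- Pauli `X` on qubit `v`. -/
def pauliX {n : ℕ} (v : Fin n) : Matrix (Bits n) (Bits n) ℂ :=
  Matrix.of fun z y => if y = Function.update z v (!(z v)) then 1 else 0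

/-- Pauli `Z` on qubit `v`: the bit `0` has eigenvalue `1`, the bit `1` has eigenvalue `-1`. -/
def pauliZ {n : ℕ} (v : Fin n) : Matrix (Bits n) (Bits n) ℂ :=
  Matrix.diagonal fun z => if z v then -1 else 1

/-- The edge term `C_{jk} = (1 + Z_j Z_k) / 2`. -/
noncomputable def edgeTerm {n : ℕ} (e : Fin n × Fin n) : Matrix (Bits n) (Bits n) ℂ :=
  (1 / 2 : ℂ) • (1 + pauliZ e.1 * pauliZ e.2)

open Classical in
/-- The edges of `G`, each listed once, as the pair `(j, k)` with `j < k`. -/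
noncomputable def edgeList {n : ℕ} (G : SimpleGraph (Fin n)) : List (Fin n × Fin n) :=
  (List.finRange n ×ˢ List.finRange n).filter fun e => e.1 < e.2 ∧ G.Adj e.1 e.2

/-- The MAX-CUT Hamiltonian `C_G`, the sum of the edge terms. -/
noncomputable def hamiltonian {n : ℕ} (G : SimpleGraph (Fin n)) : Matrix (Bits n) (Bits n) ℂ :=
  ((edgeList G).map edgeTerm).sum

/-- One QAOA level: `∏_v exp(-iβ X_v) ∏_{jk} exp(-iγ C_{jk})`. -/
noncomputable def level {n : ℕ} (G : SimpleGraph (Fin n)) (γ β : ℝ) :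
    Matrix (Bits n) (Bits n) ℂ :=
  ((List.finRange n).map fun v => NormedSpace.exp ((-(Complex.I * β)) • pauliX v)).prod *
    ((edgeList G).map fun e => NormedSpace.exp ((-(Complex.I * γ)) • edgeTerm e)).prod

/-- The uniform superposition. -/
noncomputable def plusState (n : ℕ) : Bits n → ℂ := fun _ => 1 / (Real.sqrt (2 ^ n) : ℂ)

/-- The level-`p` QAOA state `|γ, β⟩`; level `0` acts first. -/
noncomputable def state {n p : ℕ} (G : SimpleGraph (Fin n)) (γ β : Fin p → ℝ) : Bits n → ℂ :=
  (List.finRange p).foldl (fun ψ q => level G (γ q) (β q) *ᵥ ψ) (plusState n)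

/-- The QAOA energy `⟨γ, β| C_G |γ, β⟩`. -/
noncomputable def energy {n p : ℕ} (G : SimpleGraph (Fin n)) (γ β : Fin p → ℝ) : ℝ :=
  (star (state G γ β) ⬝ᵥ (hamiltonian G *ᵥ state G γ β)).re

/-- The average energy gap `Δ(G₁, G₂, p)`: the mean of `|E(G₁, γ, β) - E(G₂, γ, β)|` for
`(γ, β)` uniform in `[0, 2π]^{2p}`. -/
noncomputable def gap {n : ℕ} (G₁ G₂ : SimpleGraph (Fin n)) (p : ℕ) : ℝ :=
  ⨍ θ : (Fin p → ℝ) × (Fin p → ℝ) in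
    (Set.Icc 0 (fun _ => 2 * Real.pi)) ×ˢ (Set.Icc 0 (fun _ => 2 * Real.pi)),
    |energy G₁ θ.1 θ.2 - energy G₂ θ.1 θ.2|

/-! ### Normalization of the QAOA state -/

theorem pauliX_isHermitian {n : ℕ} (v : Fin n) : (pauliX v).IsHermitian := by
  ext z y
  have h : z = Function.update y v (!(y v)) ↔ y = Function.update z v (!(z v)) := by
    constructor <;> (rintro h; subst h; simp)
  simp [pauliX, Matrix.conjTranspose_apply, h, apply_ite]

theorem edgeTerm_isHermitian {n : ℕ} (e : Fin n × Fin n) : (edgeTerm e).IsHermitian := by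
  have h : ∀ v : Fin n, star (fun z : Bits n => if z v then (-1 : ℂ) else 1)
      = fun z => if z v then (-1 : ℂ) else 1 := by
    intro v; ext z; by_cases hz : z v <;> simp [hz]
  unfold edgeTerm pauliZ
  rw [Matrix.diagonal_mul_diagonal, Matrix.IsHermitian, Matrix.conjTranspose_smul,
    Matrix.conjTranspose_add, Matrix.diagonal_conjTranspose]
  congr 1
  · simp
  · congr 1
    · simp
    · congr 1
      ext z
      by_cases h1 : z e.1 <;> by_cases h2 : z e.2 <;> simp [h1, h2]

theorem exp_mem_unitary {ι : Type*} [Fintype ι] [DecidableEq ι] {A : Matrix ι ι ℂ}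
    (hA : A.IsHermitian) (t : ℝ) :
    NormedSpace.exp ((-(Complex.I * t)) • A) ∈ Matrix.unitaryGroup ι ℂ := by
  rw [Matrix.mem_unitaryGroup_iff', Matrix.star_eq_conjTranspose, ← Matrix.exp_conjTranspose,
    Matrix.conjTranspose_smul, hA.eq]
  have h : star (-(Complex.I * (t : ℂ))) • A = -((-(Complex.I * (t : ℂ))) • A) := by
    simp
  have hc : Commute (-((-(Complex.I * (t : ℂ))) • A)) ((-(Complex.I * (t : ℂ))) • A) :=
    Commute.neg_left (Commute.refl _)
  rw [h, ← Matrix.exp_add_of_commute _ _ hc,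
    neg_add_cancel, NormedSpace.exp_zero]

theorem level_mem_unitary {n : ℕ} (G : SimpleGraph (Fin n)) (γ β : ℝ) :
    level G γ β ∈ Matrix.unitaryGroup (Bits n) ℂ := by
  refine mul_mem (list_prod_mem ?_) (list_prod_mem ?_)
  · intro x hx
    obtain ⟨v, -, rfl⟩ := List.mem_map.1 hx
    exact exp_mem_unitary (pauliX_isHermitian v) β
  · intro x hx
    obtain ⟨e, -, rfl⟩ := List.mem_map.1 hx
    exact exp_mem_unitary (edgeTerm_isHermitian e) γ

theorem star_dotProduct_self {ι : Type*} [Fintype ι] (ψ : ι → ℂ) :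
    star ψ ⬝ᵥ ψ = ((∑ z, ‖ψ z‖ ^ 2 : ℝ) : ℂ) := by
  simp only [dotProduct, Pi.star_apply, Complex.ofReal_sum]
  refine Finset.sum_congr rfl fun z _ => ?_
  rw [Complex.star_def, Complex.conj_mul']
  simp

theorem unitary_norm {ι : Type*} [Fintype ι] [DecidableEq ι] {U : Matrix ι ι ℂ}
    (hU : U ∈ Matrix.unitaryGroup ι ℂ) (ψ : ι → ℂ) :
    ∑ z, ‖(U *ᵥ ψ) z‖ ^ 2 = ∑ z, ‖ψ z‖ ^ 2 := by
  have h : star (U *ᵥ ψ) ⬝ᵥ (U *ᵥ ψ) = star ψ ⬝ᵥ ψ := by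
    rw [Matrix.star_mulVec, Matrix.dotProduct_mulVec, Matrix.vecMul_vecMul,
      ← Matrix.star_eq_conjTranspose, Matrix.mem_unitaryGroup_iff'.1 hU, Matrix.vecMul_one]
  rw [star_dotProduct_self, star_dotProduct_self] at h
  exact_mod_cast h

theorem state_norm {n p : ℕ} (G : SimpleGraph (Fin n)) (γ β : Fin p → ℝ) :
    ∑ z, ‖state G γ β z‖ ^ 2 = 1 := by
  have key : ∀ (l : List (Fin p)) (ψ : Bits n → ℂ), ∑ z, ‖ψ z‖ ^ 2 = 1 →
      ∑ z, ‖l.foldl (fun ψ q => level G (γ q) (β q) *ᵥ ψ) ψ z‖ ^ 2 = 1 := by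
    intro l
    induction l with
    | nil => intro ψ h; simpa using h
    | cons q l ih =>
      intro ψ h
      exact ih _ ((unitary_norm (level_mem_unitary G (γ q) (β q)) ψ).trans h)
  refine key _ _ ?_
  simp [plusState]

end QAOA

/-! ## Measurement in the computational basis -/

/-- The Born rule: measuring the unit vector `ψ` gives `z` with probability `‖ψ z‖ ^ 2`. -/
noncomputable def bornRule {ι : Type} [Fintype ι] (ψ : ι → ℂ) (h : ∑ z, ‖ψ z‖ ^ 2 = 1) : PMF ι :=
  PMF.ofFintype (fun z => ENNReal.ofReal (‖ψ z‖ ^ 2)) (by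
    rw [← ENNReal.ofReal_sum_of_nonneg (fun z _ => by positivity), h, ENNReal.ofReal_one])

/-- `k` independent samples of `μ`. -/
noncomputable def iidSamples {α : Type} (μ : PMF α) : ℕ → PMF (List α)
  | 0 => PMF.pure []
  | k + 1 => μ.bind fun a => (iidSamples μ k).bind fun l => PMF.pure (a :: l)

/-! ## The random-angle QAOA energy comparison -/

namespace QAOA

/-- The classical value `C_G(z)`: the number of edges of `G` that `z` does not cut. -/
noncomputable def uncut {n : ℕ} (G : SimpleGraph (Fin n)) (z : Bits n) : ℕ :=
  (edgeList G).countP fun e => z e.1 = z e.2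

/-- The energy estimator: prepare and measure the QAOA state `shots` times, and return the average
of the values `C_G(z)` of the outcomes `z`. -/
noncomputable def estimate {n p : ℕ} (G : SimpleGraph (Fin n)) (γ β : Fin p → ℝ) (shots : ℕ) :
    PMF ℚ :=
  (iidSamples (bornRule (state G γ β) (state_norm G γ β)) shots).map fun l =>
    ((l.map (uncut G)).sum : ℚ) / shots

/-- `p` independent angles, uniform among the multiples `2πj / 2^bits`, `0 ≤ j < 2^bits`. -/
noncomputable def randomAngles (p bits : ℕ) : PMF (Fin p → ℝ) :=
  (PMF.uniformOfFintype (Fin p → Fin (2 ^ bits))).map fun j q =>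
    2 * Real.pi * (j q : ℕ) / 2 ^ bits

/-- One round at level `p`: draw random angles, estimate the energies of both graphs at these same
angles, and report whether the estimates differ by at most `1 / precision`. -/
noncomputable def compareRound {n : ℕ} (G₁ G₂ : SimpleGraph (Fin n))
    (p bits shots precision : ℕ) : PMF Bool :=
  (randomAngles p bits).bind fun γ =>
  (randomAngles p bits).bind fun β =>
  (estimate G₁ γ β shots).bind fun e₁ =>
  (estimate G₂ γ β shots).bind fun e₂ =>
  PMF.pure (decide (|e₁ - e₂| ≤ 1 / (precision : ℚ)))

/-- Play independent rounds, one for each level `p` in the list, and return `true` if in none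
of them a difference was seen. -/
noncomputable def compareLevels {n : ℕ} (G₁ G₂ : SimpleGraph (Fin n)) (bits shots precision : ℕ) :
    List ℕ → PMF Bool
  | [] => PMF.pure true
  | p :: l =>
    (compareRound G₁ G₂ p bits shots precision).bind fun a =>
    (compareLevels G₁ G₂ bits shots precision l).bind fun b => PMF.pure (a && b)

/-- The random-angle energy comparison: `rounds` rounds at every level `p ≤ maxLevel`. The answer
`true` means "isomorphic". -/
noncomputable def energyComparison {n : ℕ} (G₁ G₂ : SimpleGraph (Fin n))
    (maxLevel rounds bits shots precision : ℕ) : PMF Bool :=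
  compareLevels G₁ G₂ bits shots precision
    ((List.range (maxLevel + 1)).flatMap fun p => List.replicate rounds p)

end QAOA

/-! ## Quantum polynomial time

The machine is a classical random access machine (logarithmic cost) that builds quantum
circuits gate by gate, has them run on `|0…0⟩`, and reads the result of a measurement of all qubits
in the computational basis. -/

namespace QMachine

/-- Elementary gates: Hadamard, controlled not (control, target), and the phase gate
`diag(1, e^{2πi / 2^k})`. -/
inductive Gate : Type
  | hadamard (i : ℕ)
  | cnot (i j : ℕ)
  | phase (k i : ℕ)

/-- The action of a gate on the states of `w` qubits. A gate that addresses a qubit outside of the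
register, and a controlled not with equal control and target, act as the identity. -/
noncomputable def Gate.act {w : ℕ} : Gate → ((Fin w → Bool) → ℂ) → ((Fin w → Bool) → ℂ)
  | .hadamard i, ψ => if h : i < w then fun z =>
      (ψ (Function.update z ⟨i, h⟩ false) +
        (if z ⟨i, h⟩ then -1 else 1) * ψ (Function.update z ⟨i, h⟩ true)) / (Real.sqrt 2 : ℂ)
      else ψ
  | .cnot i j, ψ => if h : i < w ∧ j < w ∧ i ≠ j then fun z =>
      ψ (Function.update z ⟨j, h.2.1⟩ (xor (z ⟨j, h.2.1⟩) (z ⟨i, h.1⟩)))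
      else ψ
  | .phase k i, ψ => if h : i < w then fun z =>
      if z ⟨i, h⟩ then Complex.exp (2 * Real.pi * Complex.I / 2 ^ k) * ψ z else ψ z
      else ψ

/-- The output state of a circuit (first gate of the list first) on the input `|0…0⟩`. -/
noncomputable def circuitOutput (w : ℕ) (c : List Gate) : (Fin w → Bool) → ℂ :=
  c.foldl (fun ψ g => g.act ψ) (fun z => if z = (fun _ => false) then 1 else 0)

theorem Gate.act_norm {w : ℕ} (g : Gate) (ψ : (Fin w → Bool) → ℂ) :
    ∑ z, ‖g.act ψ z‖ ^ 2 = ∑ z, ‖ψ z‖ ^ 2 := by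
  cases g with
  | hadamard i =>
    by_cases h : i < w
    swap
    · simp [Gate.act, h]
    set v : Fin w := ⟨i, h⟩
    have flip : ∀ f : (Fin w → Bool) → ℝ,
        ∑ z, f (Function.update z v (!(z v))) = ∑ z, f z := fun f =>
      Equiv.sum_comp (Function.Involutive.toPerm
        (fun z : Fin w → Bool => Function.update z v (!(z v))) (fun z => by simp)) f
    have two : (2 : ℝ) * ∑ z, ‖(Gate.hadamard i).act ψ z‖ ^ 2 = 2 * ∑ z, ‖ψ z‖ ^ 2 := by
      rw [two_mul, two_mul]
      nth_rewrite 2 [← flip (fun z => ‖(Gate.hadamard i).act ψ z‖ ^ 2)]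
      nth_rewrite 2 [← flip (fun z => ‖ψ z‖ ^ 2)]
      rw [← Finset.sum_add_distrib, ← Finset.sum_add_distrib]
      refine Finset.sum_congr rfl fun z _ => ?_
      have par : ∀ a b : ℂ, ‖(a + b) / (Real.sqrt 2 : ℂ)‖ ^ 2 + ‖(a - b) / (Real.sqrt 2 : ℂ)‖ ^ 2
          = ‖a‖ ^ 2 + ‖b‖ ^ 2 := by
        intro a b
        have := parallelogram_law_with_norm ℝ a b
        simp only [norm_div, Complex.norm_real, Real.norm_eq_abs, div_pow, sq_abs]
        rw [Real.sq_sqrt (by norm_num : (0 : ℝ) ≤ 2)]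
        nlinarith [this]
      have upd : Function.update z v (z v) = z := Function.update_eq_self v z
      cases hz : z v
      · have e0 : Function.update z v false = z := by rw [← hz]; exact upd
        have := par (ψ z) (ψ (Function.update z v true))
        simpa [Gate.act, h, v, hz, e0, sub_eq_add_neg] using this
      · have e1 : Function.update z v true = z := by rw [← hz]; exact upd
        have := par (ψ (Function.update z v false)) (ψ z)
        rw [add_comm, add_comm (‖ψ z‖ ^ 2)]
        simp only [v] at *
        simpa [Gate.act, h, hz, e1, sub_eq_add_neg] using this
    linarith
  | cnot i j =>
    by_cases h : i < w ∧ j < w ∧ i ≠ j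
    swap
    · simp only [Gate.act, dif_neg h]
    simp only [Gate.act, dif_pos h]
    have hij : (⟨i, h.1⟩ : Fin w) ≠ ⟨j, h.2.1⟩ := by simpa using h.2.2
    exact Equiv.sum_comp (Function.Involutive.toPerm
        (fun z : Fin w → Bool =>
          Function.update z ⟨j, h.2.1⟩ (xor (z ⟨j, h.2.1⟩) (z ⟨i, h.1⟩)))
        (fun z => by simp [Function.update_of_ne hij])) (fun z => ‖ψ z‖ ^ 2)
  | phase k i =>
    by_cases h : i < w
    swap
    · simp [Gate.act, h]
    refine Finset.sum_congr rfl fun z _ => ?_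
    have e : ‖Complex.exp (2 * Real.pi * Complex.I / 2 ^ k)‖ = 1 := by
      have : (2 * Real.pi * Complex.I / 2 ^ k : ℂ)
          = ((2 * Real.pi / 2 ^ k : ℝ) : ℂ) * Complex.I := by
        push_cast; ring
      rw [this, Complex.norm_exp_ofReal_mul_I]
    simp only [Gate.act, dif_pos h]
    split_ifs
    · rw [norm_mul, e, one_mul]
    · rfl

theorem circuitOutput_norm (w : ℕ) (c : List Gate) :
    ∑ z, ‖circuitOutput w c z‖ ^ 2 = 1 := by
  have key : ∀ (l : List Gate) (ψ : (Fin w → Bool) → ℂ), ∑ z, ‖ψ z‖ ^ 2 = 1 →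
      ∑ z, ‖l.foldl (fun ψ g => g.act ψ) ψ z‖ ^ 2 = 1 := by
    intro l
    induction l with
    | nil => intro ψ h; simpa using h
    | cons g l ih => intro ψ h; exact ih _ ((g.act_norm ψ).trans h)
  refine key _ _ ?_
  simp [apply_ite]

/-- A configuration: classical memory (countably many arrays of natural numbers), the quantum
circuit built so far, and the cost of the computation up to now. -/
structure Config : Type where
  mem : ℕ → ℕ → ℕ
  circuit : List Gate
  time : ℕ

/-- Arithmetic expressions; `get a i` is entry number `i` of array `a`, `sub` is truncated
subtraction, and `lt` has the value `1` for true and `0` for false. -/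
inductive Term : Type
  | const (k : ℕ)
  | get (a : ℕ) (i : Term)
  | add (s t : Term)
  | sub (s t : Term)
  | mul (s t : Term)
  | lt (s t : Term)

/-- The value of an expression. -/
def Term.val (m : ℕ → ℕ → ℕ) : Term → ℕ
  | .const k => k
  | .get a i => m a (i.val m)
  | .add s t => s.val m + t.val m
  | .sub s t => s.val m - t.val m
  | .mul s t => s.val m * t.val m
  | .lt s t => if s.val m < t.val m then 1 else 0

/-- The cost of evaluating an expression: each operation costs one plus the number of
binary digits of its operands and of its result. -/
def Term.cost (m : ℕ → ℕ → ℕ) : Term → ℕ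
  | .const k => 1 + Nat.size k
  | .get a i => i.cost m + 1 + Nat.size (i.val m) + Nat.size (m a (i.val m))
  | .add s t => s.cost m + t.cost m + 1 + Nat.size (s.val m) + Nat.size (t.val m)
      + Nat.size (s.val m + t.val m)
  | .sub s t => s.cost m + t.cost m + 1 + Nat.size (s.val m) + Nat.size (t.val m)
      + Nat.size (s.val m - t.val m)
  | .mul s t => s.cost m + t.cost m + 1 + Nat.size (s.val m) + Nat.size (t.val m)
      + Nat.size (s.val m * t.val m)
  | .lt s t => s.cost m + t.cost m + 2 + Nat.size (s.val m) + Nat.size (t.val m)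

/-- Programs. The gate commands append a gate to the circuit under construction; `run t` runs that
circuit on `t` qubits, all in state `|0⟩`, and measures them. -/
inductive Program : Type
  | assign (a : ℕ) (i t : Term)
  | hadamard (i : Term)
  | cnot (i j : Term)
  | phase (k i : Term)
  | run (t : Term)
  | seq (c d : Program)
  | ite (t : Term) (c d : Program)
  | loop (t : Term) (c : Program)

/-- The array that receives the measurement results. -/
abbrev resultArray : ℕ := 3

/-- Measurement results as an array: bit of qubit `i` at entry `i`, and `0` elsewhere. -/
def bitsToArray {w : ℕ} (z : Fin w → Bool) (i : ℕ) : ℕ :=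
  if h : i < w then (z ⟨i, h⟩).toNat else 0

/-- The distribution of the final configuration. All commands are charged for the evaluation of
their arguments, plus: the lengths of the address and of the value for an assignment, one for a
gate and `k` more for the phase `2π / 2^k`, the number of qubits for a run, and one for each
execution of the body of a loop. The number of executions of a loop body is fixed when the loop is
entered. -/
noncomputable def Program.eval : Program → Config → PMF Config
  | .assign a i t, s => PMF.pure
      { s with
        mem := Function.update s.mem a
          (Function.update (s.mem a) (i.val s.mem) (t.val s.mem))
        time := s.time + i.cost s.mem + t.cost s.mem + 1
          + Nat.size (i.val s.mem) + Nat.size (t.val s.mem) }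
  | .hadamard i, s => PMF.pure
      { s with
        circuit := s.circuit ++ [Gate.hadamard (i.val s.mem)]
        time := s.time + i.cost s.mem + 1 }
  | .cnot i j, s => PMF.pure
      { s with
        circuit := s.circuit ++ [Gate.cnot (i.val s.mem) (j.val s.mem)]
        time := s.time + i.cost s.mem + j.cost s.mem + 1 }
  | .phase k i, s => PMF.pure
      { s with
        circuit := s.circuit ++ [Gate.phase (k.val s.mem) (i.val s.mem)]
        time := s.time + k.cost s.mem + i.cost s.mem + 1 + k.val s.mem }
  | .run t, s =>
      (bornRule (circuitOutput (t.val s.mem) s.circuit) (circuitOutput_norm _ _)).map fun z =>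
      { mem := Function.update s.mem resultArray (bitsToArray z)
        circuit := []
        time := s.time + t.cost s.mem + 1 + t.val s.mem }
  | .seq c d, s => (c.eval s).bind d.eval
  | .ite t c d, s =>
      if t.val s.mem ≠ 0 then c.eval { s with time := s.time + t.cost s.mem + 1 }
      else d.eval { s with time := s.time + t.cost s.mem + 1 }
  | .loop t c, s =>
      (fun μ : PMF Config => μ.bind fun s' => c.eval { s' with time := s'.time + 1 })^[t.val s.mem]
        (PMF.pure { s with time := s.time + t.cost s.mem + 1 })

open Classical in
/-- The adjacency matrix of a graph as an array, row after row. -/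
noncomputable def adjArray {n : ℕ} (G : SimpleGraph (Fin n)) (i : ℕ) : ℕ :=
  if ∃ u v : Fin n, i = u * n + v ∧ G.Adj u v then 1 else 0

/-- The initial configuration for a pair of graphs on `n` vertices: `n` is entry `0` of array `0`,
the adjacency matrices are arrays `1` and `2`, and everything else is blank. -/
noncomputable def inputConfig {n : ℕ} (G₁ G₂ : SimpleGraph (Fin n)) : Config where
  mem := fun a i => match a with
    | 0 => if i = 0 then n else 0
    | 1 => adjArray G₁ i
    | 2 => adjArray G₂ i
    | _ => 0
  circuit := []
  time := 0

/-- The array whose entry `0` is the answer: `1` for yes, anything else for no. -/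
abbrev answerArray : ℕ := 4

/-- The distribution of the answer of a program on a pair of graphs. -/
noncomputable def Program.answer (c : Program) {n : ℕ} (G₁ G₂ : SimpleGraph (Fin n)) : PMF Bool :=
  (c.eval (inputConfig G₁ G₂)).map fun s => decide (s.mem answerArray 0 = 1)

/-- The program runs in polynomial time on pairs of `n`-vertex graphs: the cost is at most
a polynomial in `n`, whatever the measurement results are. -/
def Program.PolyTime (c : Program) : Prop :=
  ∃ T : Polynomial ℕ, ∀ (n : ℕ) (G₁ G₂ : SimpleGraph (Fin n)),
    ∀ s ∈ (c.eval (inputConfig G₁ G₂)).support, s.time ≤ T.eval n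

/-- The program decides graph isomorphism with error probability at most `1/3`. -/
def Program.DecidesIsomorphism (c : Program) : Prop :=
  ∀ (n : ℕ) (G₁ G₂ : SimpleGraph (Fin n)),
    (Nonempty (G₁ ≃g G₂) → 2 / 3 ≤ c.answer G₁ G₂ true) ∧
    (¬ Nonempty (G₁ ≃g G₂) → 2 / 3 ≤ c.answer G₁ G₂ false)

end QMachine

/-!
Isomorphic graphs have the same energy at all angles, since relabelling the vertices permutes the
amplitudes of the QAOA state (`QAOA.energy_eq_of_iso`). For non-isomorphic graphs the hypothesis
gives a level `p` at which the energies differ on average by at least `1 / q`, where `q` is a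
polynomial in `n`. The energies are bounded by `n ^ 2`, so a random choice of the angles shows a
difference of order `1 / q` with a probability of order `1 / (q * n ^ 2)`, and polynomially many
rounds suffice to meet such angles (`QAOA.energyComparison_decides`). Two approximations enter.

* The angles are taken from a grid. The energy is Lipschitz in each angle
  (`QAOA.abs_energy_sub_le`), so a grid with polynomially many bits changes the average of the gap
  by little (`QAOA.gap_le_grid_average`).
* The energies are estimated from a finite number of shots. Chebyshev's inequality
  (`sampleMean_deviation_le`) makes the probability of a wrong estimate so small that a union
  bound over all rounds applies.

The algorithm is the program `QMachine.comparisonProgram`. Its circuits are exact: a grid angle is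
`2π j / 2 ^ b`, and up to a global phase, which measurements do not see, the factors of a QAOA level
are products of Hadamard gates, controlled nots and phase gates given by the bits of `j`:
`exp(-iγ C_{uv})` multiplies the states that cut `uv` by `exp(iγ)`, and `exp(-iβ X_v)` multiplies the
eigenvectors of `X_v` with eigenvalue `-1` by `exp(2iβ)`
(`QMachine.bornRule_circuitOutput_qaoaGates`). That the answer of the program has the
distribution of the energy comparison is shown in a small program logic, whose basic assertion
`QMachine.Program.Realizes` is a coupling between the final configuration and an abstract sample;
`QMachine.answer_comparisonProgram` is the outcome. Polynomial cost follows from a syntactic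
condition on programs, `QMachine.Program.Tame`: loops whose lengths are bounded by polynomials in
`n`, and assignments that increase the largest memory entry at most by a constant.
-/

/-! ### Expectations over discrete distributions -/

open scoped ENNReal

/-- The expectation of an `ℝ≥0∞`-valued function under a discrete distribution. -/
noncomputable def PMF.expect {α : Type*} (μ : PMF α) (f : α → ℝ≥0∞) : ℝ≥0∞ := ∑' a, μ a * f a

namespace PMF

variable {α β : Type*}

theorem expect_pure (a : α) (f : α → ℝ≥0∞) : (PMF.pure a).expect f = f a := by
  classical
  unfold expect
  rw [tsum_eq_single a]
  · simp
  · intro b hb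
    simp [PMF.pure_apply, hb]

theorem expect_bind (μ : PMF α) (κ : α → PMF β) (f : β → ℝ≥0∞) :
    (μ.bind κ).expect f = μ.expect fun a => (κ a).expect f := by
  unfold expect
  simp only [PMF.bind_apply, ← ENNReal.tsum_mul_right, ← ENNReal.tsum_mul_left]
  rw [ENNReal.tsum_comm]
  simp only [mul_assoc]

theorem expect_map (μ : PMF α) (g : α → β) (f : β → ℝ≥0∞) :
    (μ.map g).expect f = μ.expect fun a => f (g a) := by
  unfold PMF.map
  rw [expect_bind]
  simp [expect_pure]

theorem expect_mono (μ : PMF α) {f g : α → ℝ≥0∞} (h : ∀ a, f a ≤ g a) :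
    μ.expect f ≤ μ.expect g :=
  ENNReal.tsum_le_tsum fun a => mul_le_mul_right (h a) _

theorem expect_const (μ : PMF α) (c : ℝ≥0∞) : (μ.expect fun _ => c) = c := by
  unfold expect
  rw [ENNReal.tsum_mul_right, μ.tsum_coe, one_mul]

theorem expect_add (μ : PMF α) (f g : α → ℝ≥0∞) :
    (μ.expect fun a => f a + g a) = μ.expect f + μ.expect g := by
  unfold expect
  rw [← ENNReal.tsum_add]
  simp only [mul_add]

theorem expect_mul_left (μ : PMF α) (c : ℝ≥0∞) (f : α → ℝ≥0∞) :
    (μ.expect fun a => c * f a) = c * μ.expect f := by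
  unfold expect
  rw [← ENNReal.tsum_mul_left]
  exact tsum_congr fun a => by ring

theorem bind_apply_eq_expect (μ : PMF α) (κ : α → PMF β) (b : β) :
    μ.bind κ b = μ.expect fun a => κ a b := rfl

theorem expect_fintype [Fintype α] (μ : PMF α) (f : α → ℝ≥0∞) :
    μ.expect f = ∑ a, μ a * f a := tsum_fintype _

theorem expect_ofReal_fintype [Fintype α] (μ : PMF α) (f : α → ℝ) (hf : ∀ a, 0 ≤ f a) :
    (μ.expect fun a => ENNReal.ofReal (f a)) = ENNReal.ofReal (∑ a, (μ a).toReal * f a) := by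
  rw [expect_fintype, ENNReal.ofReal_sum_of_nonneg
    (fun a _ => mul_nonneg ENNReal.toReal_nonneg (hf a))]
  refine Finset.sum_congr rfl fun a _ => ?_
  rw [ENNReal.ofReal_mul ENNReal.toReal_nonneg, ENNReal.ofReal_toReal (μ.apply_ne_top a)]

theorem sum_toReal [Fintype α] (μ : PMF α) : ∑ a, (μ a).toReal = 1 := by
  rw [← ENNReal.toReal_sum (fun a _ => μ.apply_ne_top a), ← tsum_fintype (L := .unconditional _), μ.tsum_coe,
    ENNReal.toReal_one]

theorem expect_bool (μ : PMF Bool) (f : Bool → ℝ≥0∞) :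
    μ.expect f = μ true * f true + μ false * f false := by
  rw [expect_fintype, Fintype.sum_bool]

theorem apply_true_add_apply_false (μ : PMF Bool) : μ true + μ false = 1 := by
  have := μ.tsum_coe
  rwa [tsum_fintype, Fintype.sum_bool] at this

end PMF

/-! ### Concentration of sample means -/

/-- Second moments of sums of independent centred variables: shifting by an arbitrary constant `c`
makes the induction on the number of samples go through one sample at a time. -/
theorem expect_iidSamples_sq {ι : Type} [Fintype ι] (μ : PMF ι) (X : ι → ℝ)
    (h0 : ∑ z, (μ z).toReal * X z = 0) (k : ℕ) (c : ℝ) :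
    ((iidSamples μ k).expect fun l => ENNReal.ofReal ((c + (l.map X).sum) ^ 2)) =
      ENNReal.ofReal (c ^ 2 + k * ∑ z, (μ z).toReal * X z ^ 2) := by
  have hpos : 0 ≤ ∑ z, (μ z).toReal * X z ^ 2 :=
    Finset.sum_nonneg fun z _ => mul_nonneg ENNReal.toReal_nonneg (sq_nonneg _)
  induction k generalizing c with
  | zero => simp [iidSamples, PMF.expect_pure]
  | succ k ih =>
    simp only [iidSamples, PMF.expect_bind, PMF.expect_pure, List.map_cons, List.sum_cons,
      ← add_assoc, ih]
    rw [PMF.expect_ofReal_fintype _ _ (fun z => by positivity)]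
    congr 1
    have e : ∀ z, (μ z).toReal * ((c + X z) ^ 2 + k * ∑ z, (μ z).toReal * X z ^ 2) =
        (c ^ 2 + k * ∑ z, (μ z).toReal * X z ^ 2) * (μ z).toReal
          + 2 * c * ((μ z).toReal * X z) + (μ z).toReal * X z ^ 2 := fun z => by ring
    simp only [e, Finset.sum_add_distrib, ← Finset.mul_sum, h0, PMF.sum_toReal]
    push_cast
    ring

/-- Chebyshev's inequality for the mean of `k` samples of a variable with values in `[0, B]`. -/
theorem sampleMean_deviation_le {ι : Type} [Fintype ι] (μ : PMF ι) (X : ι → ℕ) (B : ℕ)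
    (hB : ∀ z, X z ≤ B) (E : ℝ) (hE : E = ∑ z, (μ z).toReal * X z) (k : ℕ) (hk : 0 < k)
    (t : ℝ) (ht : 0 < t) :
    (((iidSamples μ k).map fun l => ((l.map X).sum : ℚ) / k).expect fun e : ℚ =>
      if t < |(e : ℝ) - E| then 1 else 0) ≤ ENNReal.ofReal ((B : ℝ) ^ 2 / (k * t ^ 2)) := by
  have hk' : (0 : ℝ) < k := by exact_mod_cast hk
  set Y : ι → ℝ := fun z => X z - E with hY
  have hc : ∑ z, (μ z).toReal * Y z = 0 := by
    simp only [hY, mul_sub, Finset.sum_sub_distrib, ← Finset.sum_mul, PMF.sum_toReal, hE]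
    ring
  have hE0 : 0 ≤ E := hE ▸ Finset.sum_nonneg fun z _ => by positivity
  have hEB : E ≤ B := by
    rw [hE]
    calc ∑ z, (μ z).toReal * (X z : ℝ) ≤ ∑ z, (μ z).toReal * (B : ℝ) :=
          Finset.sum_le_sum fun z _ =>
            mul_le_mul_of_nonneg_left (by exact_mod_cast hB z) ENNReal.toReal_nonneg
      _ = B := by rw [← Finset.sum_mul, PMF.sum_toReal, one_mul]
  have hvar : ∑ z, (μ z).toReal * Y z ^ 2 ≤ (B : ℝ) ^ 2 := by
    calc ∑ z, (μ z).toReal * Y z ^ 2 ≤ ∑ z, (μ z).toReal * (B : ℝ) ^ 2 := by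
          refine Finset.sum_le_sum fun z _ =>
            mul_le_mul_of_nonneg_left ?_ ENNReal.toReal_nonneg
          have h1 : (X z : ℝ) ≤ B := by exact_mod_cast hB z
          have h2 : (0 : ℝ) ≤ X z := by positivity
          refine sq_le_sq' ?_ ?_ <;> simp only [hY] <;> linarith
      _ = (B : ℝ) ^ 2 := by rw [← Finset.sum_mul, PMF.sum_toReal, one_mul]
  have hsum : ∀ l : List ι, (l.map Y).sum = ((l.map X).sum : ℕ) - l.length * E := by
    intro l
    induction l with
    | nil => simp
    | cons z l ih =>
      rw [List.map_cons, List.sum_cons, ih, List.map_cons, List.sum_cons, List.length_cons]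
      simp only [hY]
      push_cast
      ring
  have hlen : ∀ (k : ℕ), ∀ l ∈ (iidSamples μ k).support, l.length = k := by
    intro k
    induction k with
    | zero => intro l hl; simp [iidSamples] at hl; simp [hl]
    | succ k ih =>
      intro l hl
      simp only [iidSamples, PMF.mem_support_bind_iff, PMF.mem_support_pure_iff] at hl
      obtain ⟨a, -, l', hl', rfl⟩ := hl
      simp [ih l' hl']
  rw [PMF.expect_map]
  have key := expect_iidSamples_sq μ Y hc k 0
  simp only [zero_add, ne_eq, OfNat.ofNat_ne_zero, not_false_eq_true, zero_pow] at key
  -- Markov's inequality for the square of the deviation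
  calc _ ≤ (iidSamples μ k).expect (fun l => ENNReal.ofReal (1 / (k * t) ^ 2) *
          ENNReal.ofReal ((l.map Y).sum ^ 2)) := by
        refine ENNReal.tsum_le_tsum fun l => ?_
        by_cases hl : l ∈ (iidSamples μ k).support
        swap
        · simp [(PMF.apply_eq_zero_iff _ _).2 hl]
        refine mul_le_mul_right ?_ _
        beta_reduce
        split_ifs with h
        swap
        · exact zero_le
        rw [← ENNReal.ofReal_mul (by positivity), ← ENNReal.ofReal_one]
        refine ENNReal.ofReal_le_ofReal ?_
        have e : ((((l.map X).sum : ℚ) / k : ℚ) : ℝ) - E = (l.map Y).sum / k := by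
          rw [hsum, hlen k l hl]
          generalize (l.map X).sum = S
          push_cast
          field_simp
        rw [e, abs_div, abs_of_pos hk', lt_div_iff₀ hk'] at h
        rw [div_mul_eq_mul_div, one_mul, le_div_iff₀ (by positivity), one_mul, ← sq_abs (l.map Y).sum]
        exact pow_le_pow_left₀ (by positivity) (by rw [mul_comm]; exact h.le) 2
    _ ≤ _ := by
        rw [PMF.expect_mul_left, key, ← ENNReal.ofReal_mul (by positivity)]
        refine ENNReal.ofReal_le_ofReal ?_
        rw [mul_pow, div_mul_eq_mul_div, one_mul, div_le_div_iff₀ (by positivity) (by positivity)]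
        nlinarith [mul_le_mul_of_nonneg_left hvar (show (0:ℝ) ≤ k * (k * t ^ 2) by positivity)]

/-! ### The action of a QAOA level -/

/-- The exponential of an involution, from the algebra map `(a, b) ↦ a(1 + X)/2 + b(1 - X)/2` out of
`ℂ × ℂ`. -/
theorem Matrix.exp_smul_of_mul_self_eq_one {ι : Type*} [Fintype ι] [DecidableEq ι]
    {X : Matrix ι ι ℂ} (hX : X * X = 1) (t : ℂ) :
    NormedSpace.exp (t • X) = Complex.cosh t • (1 : Matrix ι ι ℂ) + Complex.sinh t • X := by
  let φ : ℂ × ℂ →+* Matrix ι ι ℂ :=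
    { toFun := fun a => ((a.1 + a.2) / 2) • (1 : Matrix ι ι ℂ) + ((a.1 - a.2) / 2) • X
      map_one' := by simp
      map_zero' := by simp
      map_add' := fun a b => by
        simp only [Prod.fst_add, Prod.snd_add]
        module
      map_mul' := fun a b => by
        simp only [Prod.fst_mul, Prod.snd_mul, add_mul, mul_add, smul_mul_smul_comm, hX, one_mul,
          mul_one]
        module }
  have hφ : Continuous φ := by
    change Continuous fun a : ℂ × ℂ =>
      ((a.1 + a.2) / 2) • (1 : Matrix ι ι ℂ) + ((a.1 - a.2) / 2) • X
    fun_prop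
  let _ : NormedRing (Matrix ι ι ℂ) := Matrix.linftyOpNormedRing
  let _ : NormedAlgebra ℂ (Matrix ι ι ℂ) := Matrix.linftyOpNormedAlgebra
  have h := NormedSpace.map_exp φ hφ (t, -t)
  have e1 : φ (t, -t) = t • X := by
    change ((t + -t) / 2) • (1 : Matrix ι ι ℂ) + ((t - -t) / 2) • X = _
    simp
  have e2 : φ (NormedSpace.exp (t, -t)) =
      Complex.cosh t • (1 : Matrix ι ι ℂ) + Complex.sinh t • X := by
    change (((NormedSpace.exp (t, -t)).1 + (NormedSpace.exp (t, -t)).2) / 2) •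
      (1 : Matrix ι ι ℂ) + (((NormedSpace.exp (t, -t)).1 - (NormedSpace.exp (t, -t)).2) / 2) • X = _
    rw [Prod.fst_exp, Prod.snd_exp, ← Complex.exp_eq_exp_ℂ, Complex.cosh, Complex.sinh]
  rw [← e1]
  exact h.symm.trans e2

namespace QAOA

/-- Flip the bit of qubit `v`. -/
def flipBit {n : ℕ} (v : Fin n) (z : Bits n) : Bits n := Function.update z v (!(z v))

/-- The action of `exp(-iβ X_v)` on a state. -/
noncomputable def mixStep {n : ℕ} (β : ℝ) (v : Fin n) (ψ : Bits n → ℂ) : Bits n → ℂ :=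
  fun z => Real.cos β * ψ z - Complex.I * Real.sin β * ψ (flipBit v z)

/-- The action of the diagonal factor `exp(-iγ C_G)` on a state. -/
noncomputable def costStep {n : ℕ} (G : SimpleGraph (Fin n)) (γ : ℝ) (ψ : Bits n → ℂ) :
    Bits n → ℂ :=
  fun z => Complex.exp (-(Complex.I * γ)) ^ uncut G z * ψ z

theorem flipBit_flipBit {n : ℕ} (v : Fin n) (z : Bits n) : flipBit v (flipBit v z) = z := by
  simp [flipBit]

theorem flipBit_comm {n : ℕ} (u v : Fin n) (z : Bits n) :
    flipBit u (flipBit v z) = flipBit v (flipBit u z) := by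
  rcases eq_or_ne u v with rfl | h
  · rfl
  · simp [flipBit, Function.update_of_ne h, Function.update_of_ne h.symm,
      Function.update_comm h]

theorem pauliX_mulVec {n : ℕ} (v : Fin n) (ψ : Bits n → ℂ) :
    pauliX v *ᵥ ψ = fun z => ψ (flipBit v z) := by
  ext z
  simp [Matrix.mulVec, dotProduct, pauliX, flipBit]

theorem pauliX_mul_self {n : ℕ} (v : Fin n) : pauliX v * pauliX v = 1 := by
  refine Matrix.toLin'.injective (LinearMap.ext fun ψ => ?_)
  rw [Matrix.toLin'_apply, Matrix.toLin'_apply, ← Matrix.mulVec_mulVec, pauliX_mulVec,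
    pauliX_mulVec, Matrix.one_mulVec]
  simp only [flipBit_flipBit]

theorem exp_pauliX_mulVec {n : ℕ} (β : ℝ) (v : Fin n) (ψ : Bits n → ℂ) :
    NormedSpace.exp ((-(Complex.I * β)) • pauliX v) *ᵥ ψ = mixStep β v ψ := by
  rw [Matrix.exp_smul_of_mul_self_eq_one (pauliX_mul_self v), Matrix.add_mulVec,
    Matrix.smul_mulVec, Matrix.smul_mulVec, Matrix.one_mulVec, pauliX_mulVec]
  ext z
  rw [Complex.cosh_neg, Complex.sinh_neg, mul_comm Complex.I, Complex.cosh_mul_I,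
    Complex.sinh_mul_I]
  simp [mixStep]
  ring

theorem edgeTerm_eq_diagonal {n : ℕ} (e : Fin n × Fin n) :
    edgeTerm e = Matrix.diagonal fun z : Bits n => if z e.1 = z e.2 then (1 : ℂ) else 0 := by
  unfold edgeTerm pauliZ
  rw [Matrix.diagonal_mul_diagonal, ← Matrix.diagonal_one, Matrix.diagonal_add,
    ← Matrix.diagonal_smul]
  congr 1
  ext z
  cases h1 : z e.1 <;> cases h2 : z e.2 <;> simp [h1, h2] <;> norm_num

theorem exp_edgeTerm {n : ℕ} (γ : ℝ) (e : Fin n × Fin n) :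
    NormedSpace.exp ((-(Complex.I * γ)) • edgeTerm e) =
      Matrix.diagonal fun z : Bits n =>
        if z e.1 = z e.2 then Complex.exp (-(Complex.I * γ)) else 1 := by
  rw [edgeTerm_eq_diagonal, ← Matrix.diagonal_smul, Matrix.exp_diagonal]
  congr 1
  ext z
  rw [Pi.coe_exp, ← Complex.exp_eq_exp_ℂ]
  by_cases h : z e.1 = z e.2 <;> simp [h]

theorem prod_exp_edgeTerm {n : ℕ} (γ : ℝ) (l : List (Fin n × Fin n)) :
    (l.map fun e => NormedSpace.exp ((-(Complex.I * γ)) • edgeTerm e)).prod =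
      Matrix.diagonal fun z : Bits n =>
        Complex.exp (-(Complex.I * γ)) ^ l.countP fun e => z e.1 = z e.2 := by
  induction l with
  | nil => simp
  | cons e l ih =>
    rw [List.map_cons, List.prod_cons, ih, exp_edgeTerm, Matrix.diagonal_mul_diagonal]
    congr 1
    ext z
    by_cases h : z e.1 = z e.2 <;> simp [h, pow_succ']

theorem list_prod_mulVec {n : ℕ} {α : Type*} (l : List α) (A : α → Matrix (Bits n) (Bits n) ℂ)
    (ψ : Bits n → ℂ) : (l.map A).prod *ᵥ ψ = l.foldr (fun a φ => A a *ᵥ φ) ψ := by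
  induction l with
  | nil => simp
  | cons a l ih => rw [List.map_cons, List.prod_cons, ← Matrix.mulVec_mulVec, ih, List.foldr_cons]

theorem level_mulVec {n : ℕ} (G : SimpleGraph (Fin n)) (γ β : ℝ) (ψ : Bits n → ℂ) :
    level G γ β *ᵥ ψ = (List.finRange n).foldr (mixStep β) (costStep G γ ψ) := by
  have h : (fun (v : Fin n) φ => NormedSpace.exp ((-(Complex.I * β)) • pauliX v) *ᵥ φ) =
      mixStep β := by
    ext v φ : 2
    exact exp_pauliX_mulVec β v φ
  rw [level, ← Matrix.mulVec_mulVec, list_prod_mulVec, h, prod_exp_edgeTerm]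
  congr 1
  ext z
  rw [Matrix.mulVec_diagonal]
  rfl

theorem mixStep_comm {n : ℕ} (β : ℝ) (u v : Fin n) (ψ : Bits n → ℂ) :
    mixStep β u (mixStep β v ψ) = mixStep β v (mixStep β u ψ) := by
  ext z
  simp only [mixStep, flipBit_comm u v]
  ring

instance {n : ℕ} (β : ℝ) : LeftCommutative (mixStep (n := n) β) := ⟨mixStep_comm β⟩

/-- The energy is the mean of the number of uncut edges under the Born rule. -/
theorem energy_eq_sum {n p : ℕ} (G : SimpleGraph (Fin n)) (γ β : Fin p → ℝ) :
    energy G γ β = ∑ z, ‖state G γ β z‖ ^ 2 * uncut G z := by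
  have h : ∀ l : List (Fin n × Fin n), (l.map edgeTerm).sum =
      Matrix.diagonal fun z : Bits n => ((l.countP fun e => z e.1 = z e.2 : ℕ) : ℂ) := by
    intro l
    induction l with
    | nil => simp
    | cons e l ih =>
      rw [List.map_cons, List.sum_cons, ih, edgeTerm_eq_diagonal, Matrix.diagonal_add]
      congr 1
      ext z
      by_cases h : z e.1 = z e.2 <;> simp [h, add_comm]
  rw [energy, hamiltonian, h, dotProduct, Complex.re_sum]
  refine Finset.sum_congr rfl fun z _ => ?_
  rw [Matrix.mulVec_diagonal, Pi.star_apply, Complex.star_def, mul_left_comm, Complex.conj_mul']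
  norm_cast
  rw [mul_comm]
  rfl

theorem uncut_le {n : ℕ} (G : SimpleGraph (Fin n)) (z : Bits n) : uncut G z ≤ n ^ 2 := by
  refine (List.countP_le_length).trans ?_
  refine (List.length_filter_le _ _).trans ?_
  rw [List.length_product, List.length_finRange, sq]

/-! ### Isomorphic graphs have equal energies -/

theorem uncut_eq_card {n : ℕ} (G : SimpleGraph (Fin n)) (z : Bits n) [DecidableRel G.Adj] :
    uncut G z =
      (Finset.univ.filter fun e : Fin n × Fin n => e.1 < e.2 ∧ G.Adj e.1 e.2 ∧ z e.1 = z e.2).card := by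
  classical
  rw [uncut, edgeList, List.countP_filter, List.countP_eq_length_filter, ← List.toFinset_card_of_nodup]
  · congr 1
    ext e
    have : e ∈ List.finRange n ×ˢ List.finRange n :=
      List.mem_product.2 ⟨List.mem_finRange _, List.mem_finRange _⟩
    simp [this]
    tauto
  · exact (List.Nodup.product (List.nodup_finRange n) (List.nodup_finRange n)).filter _

/-- Every edge is listed once by `edgeList`, in an order that depends on the labels of the vertices;
counting ordered pairs makes the number invariant under relabelling. -/
theorem two_mul_uncut {n : ℕ} (G : SimpleGraph (Fin n)) (z : Bits n) [DecidableRel G.Adj] :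
    2 * uncut G z =
      (Finset.univ.filter fun e : Fin n × Fin n => G.Adj e.1 e.2 ∧ z e.1 = z e.2).card := by
  have hs : (Finset.univ.filter fun e : Fin n × Fin n =>
        e.1 < e.2 ∧ G.Adj e.1 e.2 ∧ z e.1 = z e.2).card =
      (Finset.univ.filter fun e : Fin n × Fin n =>
        e.2 < e.1 ∧ G.Adj e.1 e.2 ∧ z e.1 = z e.2).card := by
    refine Finset.card_equiv (Equiv.prodComm _ _) fun e => ?_
    simp [G.adj_comm e.1 e.2, eq_comm]
  rw [two_mul, uncut_eq_card]
  nth_rewrite 2 [hs]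
  rw [← Finset.card_union_of_disjoint]
  · congr 1
    ext e
    simp only [Finset.mem_union, Finset.mem_filter, Finset.mem_univ, true_and]
    constructor
    · tauto
    · intro h
      rcases lt_or_gt_of_ne h.1.ne with h' | h' <;> tauto
  · rw [Finset.disjoint_left]
    intro e h1 h2
    simp only [Finset.mem_filter, Finset.mem_univ, true_and] at h1 h2
    exact absurd h1.1 h2.1.asymm

theorem uncut_comp {n : ℕ} {G₁ G₂ : SimpleGraph (Fin n)} (e : G₁ ≃g G₂) (z : Bits n) :
    uncut G₁ (z ∘ e) = uncut G₂ z := by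
  classical
  refine Nat.eq_of_mul_eq_mul_left two_pos ?_
  rw [two_mul_uncut, two_mul_uncut]
  refine Finset.card_equiv (e.toEquiv.prodCongr e.toEquiv) fun a => ?_
  simp [e.map_rel_iff]

theorem flipBit_comp {n : ℕ} (e : Fin n ≃ Fin n) (v : Fin n) (z : Bits n) :
    flipBit v (z ∘ e) = flipBit (e v) z ∘ e := by
  ext u
  rcases eq_or_ne u v with rfl | h
  · simp [flipBit]
  · simp [flipBit, Function.update_of_ne h, Function.update_of_ne (e.injective.ne h)]

/-- Relabelling the vertices permutes the amplitudes. The factors of the mixing operator come in a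
different order after relabelling, which is harmless because they commute. -/
theorem state_comp {n p : ℕ} {G₁ G₂ : SimpleGraph (Fin n)} (e : G₁ ≃g G₂) (γ β : Fin p → ℝ)
    (z : Bits n) : state G₁ γ β (z ∘ e) = state G₂ γ β z := by
  have mix : ∀ (b : ℝ) (l : List (Fin n)) (φ₁ φ₂ : Bits n → ℂ), (∀ z, φ₁ (z ∘ e) = φ₂ z) →
      ∀ z, l.foldr (mixStep b) φ₁ (z ∘ e) = (l.map e).foldr (mixStep b) φ₂ z := by
    intro b l φ₁ φ₂ h
    induction l with
    | nil => exact h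
    | cons v l ih =>
      intro z
      have := flipBit_comp e.toEquiv v z
      simp only [RelIso.coe_fn_toEquiv] at this
      simp only [List.foldr_cons, List.map_cons, mixStep, ih, this]
  have perm : ((List.finRange n).map e).Perm (List.finRange n) := by
    refine (List.perm_ext_iff_of_nodup ((List.nodup_finRange n).map e.injective)
      (List.nodup_finRange n)).2 fun v => ?_
    simpa using e.surjective v
  have key : ∀ (l : List (Fin p)) (φ₁ φ₂ : Bits n → ℂ), (∀ z, φ₁ (z ∘ e) = φ₂ z) →
      ∀ z, l.foldl (fun ψ q => level G₁ (γ q) (β q) *ᵥ ψ) φ₁ (z ∘ e) =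
        l.foldl (fun ψ q => level G₂ (γ q) (β q) *ᵥ ψ) φ₂ z := by
    intro l
    induction l with
    | nil => intro φ₁ φ₂ h; exact h
    | cons q l ih =>
      intro φ₁ φ₂ h
      refine ih _ _ fun z => ?_
      beta_reduce
      rw [level_mulVec, level_mulVec, mix _ _ _ (costStep G₂ (γ q) φ₂), perm.foldr_eq]
      intro z
      simp only [costStep, h, uncut_comp]
  exact key _ _ _ (fun z => rfl) z

theorem energy_eq_of_iso {n p : ℕ} {G₁ G₂ : SimpleGraph (Fin n)} (e : G₁ ≃g G₂)
    (γ β : Fin p → ℝ) : energy G₁ γ β = energy G₂ γ β := by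
  rw [energy_eq_sum, energy_eq_sum]
  refine (Equiv.sum_comp (e.toEquiv.arrowCongr (Equiv.refl Bool)).symm _).symm.trans ?_
  refine Finset.sum_congr rfl fun z _ => ?_
  have : (e.toEquiv.arrowCongr (Equiv.refl Bool)).symm z = z ∘ e := by
    ext v
    simp
  rw [this, state_comp, uncut_comp]

end QAOA

/-! ### The energy is Lipschitz in the angles -/

namespace QAOA

/-- The Euclidean norm of a state. -/
noncomputable def l2norm {n : ℕ} (ψ : Bits n → ℂ) : ℝ :=
  ‖(WithLp.toLp 2 ψ : EuclideanSpace ℂ (Bits n))‖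

theorem l2norm_eq_sqrt {n : ℕ} (ψ : Bits n → ℂ) : l2norm ψ = √(∑ z, ‖ψ z‖ ^ 2) :=
  EuclideanSpace.norm_eq _

theorem l2norm_nonneg {n : ℕ} (ψ : Bits n → ℂ) : 0 ≤ l2norm ψ := norm_nonneg _

theorem l2norm_sq {n : ℕ} (ψ : Bits n → ℂ) : l2norm ψ ^ 2 = ∑ z, ‖ψ z‖ ^ 2 := by
  rw [l2norm_eq_sqrt, Real.sq_sqrt (Finset.sum_nonneg fun z _ => by positivity)]

theorem l2norm_add_le {n : ℕ} (φ ψ : Bits n → ℂ) : l2norm (φ + ψ) ≤ l2norm φ + l2norm ψ :=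
  norm_add_le (WithLp.toLp 2 φ : EuclideanSpace ℂ (Bits n)) (WithLp.toLp 2 ψ)

theorem l2norm_le_of_forall {n : ℕ} {φ ψ : Bits n → ℂ} {c : ℝ} (hc : 0 ≤ c)
    (h : ∀ z, ‖φ z‖ ≤ c * ‖ψ z‖) : l2norm φ ≤ c * l2norm ψ := by
  refine le_of_sq_le_sq ?_ (mul_nonneg hc (l2norm_nonneg _))
  rw [mul_pow, l2norm_sq, l2norm_sq, Finset.mul_sum]
  refine Finset.sum_le_sum fun z _ => ?_
  rw [← mul_pow]
  exact pow_le_pow_left₀ (norm_nonneg _) (h z) 2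

theorem l2norm_mulVec {n : ℕ} {U : Matrix (Bits n) (Bits n) ℂ}
    (hU : U ∈ Matrix.unitaryGroup (Bits n) ℂ) (ψ : Bits n → ℂ) : l2norm (U *ᵥ ψ) = l2norm ψ := by
  rw [l2norm_eq_sqrt, l2norm_eq_sqrt, unitary_norm hU]

theorem l2norm_mixStep {n : ℕ} (β : ℝ) (v : Fin n) (ψ : Bits n → ℂ) :
    l2norm (mixStep β v ψ) = l2norm ψ := by
  rw [← exp_pauliX_mulVec, l2norm_mulVec (exp_mem_unitary (pauliX_isHermitian v) β)]

theorem norm_exp_neg_I_mul (γ : ℝ) : ‖Complex.exp (-(Complex.I * γ))‖ = 1 := by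
  have := Complex.norm_exp_ofReal_mul_I (-γ)
  rwa [Complex.ofReal_neg, neg_mul, mul_comm] at this

theorem l2norm_costStep {n : ℕ} (G : SimpleGraph (Fin n)) (γ : ℝ) (ψ : Bits n → ℂ) :
    l2norm (costStep G γ ψ) = l2norm ψ := by
  simp only [l2norm_eq_sqrt, costStep, norm_mul, norm_pow, norm_exp_neg_I_mul, one_pow, one_mul]

theorem l2norm_mixStep_sub_le {n : ℕ} (β β' : ℝ) (v : Fin n) (φ ψ : Bits n → ℂ) :
    l2norm (mixStep β v φ - mixStep β' v ψ) ≤ l2norm (φ - ψ) + 2 * |β - β'| * l2norm ψ := by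
  have e : mixStep β v φ - mixStep β' v ψ = mixStep β v (φ - ψ) +
      ((fun z => ((Real.cos β - Real.cos β' : ℝ) : ℂ) * ψ z) +
        fun z => -(Complex.I * (Real.sin β - Real.sin β' : ℝ)) * (pauliX v *ᵥ ψ) z) := by
    ext z
    rw [pauliX_mulVec]
    simp only [mixStep, Pi.sub_apply, Pi.add_apply]
    push_cast
    ring
  have hX : l2norm (pauliX v *ᵥ ψ) = l2norm ψ := by
    refine l2norm_mulVec ?_ ψ
    rw [Matrix.mem_unitaryGroup_iff, Matrix.star_eq_conjTranspose, (pauliX_isHermitian v).eq,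
      pauliX_mul_self]
  rw [e]
  refine (l2norm_add_le _ _).trans ?_
  rw [l2norm_mixStep]
  refine add_le_add le_rfl ((l2norm_add_le _ _).trans ?_)
  rw [show 2 * |β - β'| * l2norm ψ = |β - β'| * l2norm ψ + |β - β'| * l2norm (pauliX v *ᵥ ψ) by
    rw [hX]; ring]
  refine add_le_add (l2norm_le_of_forall (abs_nonneg _) fun z => ?_)
    (l2norm_le_of_forall (abs_nonneg _) fun z => ?_)
  · rw [norm_mul, Complex.norm_real]
    exact mul_le_mul_of_nonneg_right (Real.abs_cos_sub_cos_le β β') (norm_nonneg _)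
  · rw [norm_mul, norm_neg, norm_mul, Complex.norm_I, one_mul, Complex.norm_real]
    exact mul_le_mul_of_nonneg_right (Real.abs_sin_sub_sin_le β β') (norm_nonneg _)

theorem norm_exp_pow_sub_le (γ γ' : ℝ) (k : ℕ) :
    ‖Complex.exp (-(Complex.I * γ)) ^ k - Complex.exp (-(Complex.I * γ')) ^ k‖ ≤ k * |γ - γ'| := by
  have e : Complex.exp (-(Complex.I * γ)) ^ k - Complex.exp (-(Complex.I * γ')) ^ k =
      Complex.exp (-(Complex.I * γ')) ^ k * (Complex.exp (Complex.I * (k * (γ' - γ) : ℝ)) - 1) := by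
    rw [mul_sub, mul_one, ← Complex.exp_nat_mul, ← Complex.exp_nat_mul, ← Complex.exp_add]
    congr 2
    push_cast
    ring
  rw [e, norm_mul, norm_pow, norm_exp_neg_I_mul, one_pow, one_mul]
  refine Real.norm_exp_I_mul_ofReal_sub_one_le.trans ?_
  rw [Real.norm_eq_abs, abs_mul, Nat.abs_cast, abs_sub_comm]

theorem l2norm_costStep_sub_le {n : ℕ} (G : SimpleGraph (Fin n)) (γ γ' : ℝ) (φ ψ : Bits n → ℂ) :
    l2norm (costStep G γ φ - costStep G γ' ψ) ≤ l2norm (φ - ψ) + n ^ 2 * |γ - γ'| * l2norm ψ := by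
  have e : costStep G γ φ - costStep G γ' ψ = costStep G γ (φ - ψ) +
      (costStep G γ ψ - costStep G γ' ψ) := by
    ext z
    simp only [costStep, Pi.sub_apply, Pi.add_apply]
    ring
  rw [e]
  refine (l2norm_add_le _ _).trans ?_
  rw [l2norm_costStep]
  refine add_le_add le_rfl (l2norm_le_of_forall (by positivity) fun z => ?_)
  simp only [costStep, Pi.sub_apply]
  rw [← sub_mul, norm_mul]
  refine mul_le_mul_of_nonneg_right ((norm_exp_pow_sub_le _ _ _).trans ?_) (norm_nonneg _)
  refine mul_le_mul_of_nonneg_right ?_ (abs_nonneg _)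
  exact_mod_cast uncut_le G z

/-- The cost factor moves by at most `n ^ 2 * h`, and each of the `n` mixing factors by at most `2 * h`
(one `h` for the cosine and one for the sine). -/
theorem l2norm_level_sub_le {n : ℕ} (G : SimpleGraph (Fin n)) (γ γ' β β' h : ℝ)
    (hγ : |γ - γ'| ≤ h) (hβ : |β - β'| ≤ h) (φ ψ : Bits n → ℂ) (hψ : l2norm ψ = 1) :
    l2norm (level G γ β *ᵥ φ - level G γ' β' *ᵥ ψ) ≤ l2norm (φ - ψ) + (n ^ 2 + 2 * n) * h := by
  have key : ∀ (l : List (Fin n)) (φ ψ : Bits n → ℂ), l2norm ψ = 1 →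
      l2norm (l.foldr (mixStep β') ψ) = 1 ∧
      l2norm (l.foldr (mixStep β) φ - l.foldr (mixStep β') ψ) ≤
        l2norm (φ - ψ) + l.length * (2 * h) := by
    intro l φ ψ hψ
    induction l with
    | nil => simp [hψ]
    | cons v l ih =>
      refine ⟨by rw [List.foldr_cons, l2norm_mixStep, ih.1], ?_⟩
      rw [List.foldr_cons, List.foldr_cons, List.length_cons]
      refine (l2norm_mixStep_sub_le _ _ _ _ _).trans ?_
      rw [ih.1]
      push_cast
      linarith [ih.2]
  rw [level_mulVec, level_mulVec]
  refine (key _ _ _ (by rw [l2norm_costStep, hψ])).2.trans ?_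
  have h1 := l2norm_costStep_sub_le G γ γ' φ ψ
  have h2 := mul_le_mul_of_nonneg_left hγ (show (0 : ℝ) ≤ n ^ 2 by positivity)
  rw [hψ] at h1
  rw [List.length_finRange]
  linarith

theorem l2norm_state {n p : ℕ} (G : SimpleGraph (Fin n)) (γ β : Fin p → ℝ) :
    l2norm (state G γ β) = 1 := by
  rw [l2norm_eq_sqrt, state_norm, Real.sqrt_one]

theorem l2norm_plusState (n : ℕ) : l2norm (plusState n) = 1 := by
  have := l2norm_state (p := 0) (⊥ : SimpleGraph (Fin n)) (fun _ => 0) (fun _ => 0)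
  simpa [state] using this

theorem l2norm_state_sub_le {n p : ℕ} (G : SimpleGraph (Fin n)) (γ γ' β β' : Fin p → ℝ) (h : ℝ)
    (hγ : ∀ q, |γ q - γ' q| ≤ h) (hβ : ∀ q, |β q - β' q| ≤ h) :
    l2norm (state G γ β - state G γ' β') ≤ p * ((n ^ 2 + 2 * n) * h) := by
  have key : ∀ (l : List (Fin p)) (φ ψ : Bits n → ℂ), l2norm ψ = 1 →
      l2norm (l.foldl (fun ψ q => level G (γ q) (β q) *ᵥ ψ) φ -
        l.foldl (fun ψ q => level G (γ' q) (β' q) *ᵥ ψ) ψ) ≤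
        l2norm (φ - ψ) + l.length * ((n ^ 2 + 2 * n) * h) := by
    intro l
    induction l with
    | nil => intro φ ψ _; simp
    | cons q l ih =>
      intro φ ψ hψ
      refine (ih _ _ (by rw [l2norm_mulVec (level_mem_unitary _ _ _), hψ])).trans ?_
      have := l2norm_level_sub_le G _ _ _ _ h (hγ q) (hβ q) φ ψ hψ
      rw [List.length_cons]
      push_cast
      linarith
  have h0 : l2norm (plusState n - plusState n) = 0 := by
    rw [sub_self, l2norm_eq_sqrt]
    simp
  have := key (List.finRange p) (plusState n) (plusState n) (l2norm_plusState n)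
  rwa [h0, zero_add, List.length_finRange] at this

/-- The energy is a quadratic form in the state with norm at most `n ^ 2`, and unitarity keeps the
errors of the levels from growing, so they add up. -/
theorem abs_energy_sub_le {n p : ℕ} (G : SimpleGraph (Fin n)) (γ γ' β β' : Fin p → ℝ) (h : ℝ)
    (hγ : ∀ q, |γ q - γ' q| ≤ h) (hβ : ∀ q, |β q - β' q| ≤ h) :
    |energy G γ β - energy G γ' β'| ≤ 2 * n ^ 2 * (p * ((n ^ 2 + 2 * n) * h)) := by
  refine le_trans ?_ (mul_le_mul_of_nonneg_left (l2norm_state_sub_le G γ γ' β β' h hγ hβ)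
    (by positivity))
  set φ := state G γ β
  set ψ := state G γ' β'
  have hφ : l2norm φ = 1 := l2norm_state _ _ _
  have hψ : l2norm ψ = 1 := l2norm_state _ _ _
  have cs : ∀ χ : Bits n → ℂ, l2norm χ = 1 →
      ∑ z, ‖φ z - ψ z‖ * ‖χ z‖ ≤ l2norm (φ - ψ) := by
    intro χ hχ
    have := Real.sum_mul_le_sqrt_mul_sqrt Finset.univ (fun z => ‖φ z - ψ z‖) (fun z => ‖χ z‖)
    rw [← l2norm_eq_sqrt χ, hχ, mul_one] at this
    rwa [l2norm_eq_sqrt]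
  rw [energy_eq_sum, energy_eq_sum, ← Finset.sum_sub_distrib]
  calc |∑ z, (‖φ z‖ ^ 2 * (uncut G z : ℝ) - ‖ψ z‖ ^ 2 * uncut G z)|
      ≤ ∑ z, n ^ 2 * (‖φ z - ψ z‖ * ‖φ z‖ + ‖φ z - ψ z‖ * ‖ψ z‖) := by
        refine (Finset.abs_sum_le_sum_abs _ _).trans (Finset.sum_le_sum fun z _ => ?_)
        rw [← sub_mul, abs_mul, Nat.abs_cast, mul_comm, sq_sub_sq, abs_mul, ← mul_add,
          abs_of_nonneg (add_nonneg (norm_nonneg (φ z)) (norm_nonneg (ψ z)))]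
        have h1 : (uncut G z : ℝ) ≤ n ^ 2 := by exact_mod_cast uncut_le G z
        have h2 := abs_norm_sub_norm_le (φ z) (ψ z)
        rw [mul_comm ‖φ z - ψ z‖]
        gcongr
    _ ≤ _ := by
        rw [← Finset.mul_sum, Finset.sum_add_distrib]
        have := add_le_add (cs φ hφ) (cs ψ hψ)
        nlinarith [mul_le_mul_of_nonneg_left this (show (0 : ℝ) ≤ n ^ 2 by positivity)]

theorem energy_nonneg {n p : ℕ} (G : SimpleGraph (Fin n)) (γ β : Fin p → ℝ) :
    0 ≤ energy G γ β := by
  rw [energy_eq_sum]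
  positivity

theorem energy_le {n p : ℕ} (G : SimpleGraph (Fin n)) (γ β : Fin p → ℝ) :
    energy G γ β ≤ n ^ 2 := by
  rw [energy_eq_sum]
  calc ∑ z, ‖state G γ β z‖ ^ 2 * (uncut G z : ℝ) ≤ ∑ z, ‖state G γ β z‖ ^ 2 * (n : ℝ) ^ 2 :=
        Finset.sum_le_sum fun z _ => mul_le_mul_of_nonneg_left
          (by exact_mod_cast uncut_le G z) (by positivity)
    _ = n ^ 2 := by rw [← Finset.sum_mul, state_norm, one_mul]

/-! ### The average gap on a grid of angles -/

/-- The angles `2πj / m`. -/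
noncomputable def gridAngles {p m : ℕ} (j : Fin p → Fin m) : Fin p → ℝ :=
  fun q => 2 * Real.pi * (j q : ℕ) / m

theorem exists_gridAngles_le {p m : ℕ} (hm : 0 < m) (θ : Fin p → ℝ)
    (hθ : θ ∈ Set.Icc (0 : Fin p → ℝ) fun _ => 2 * Real.pi) :
    ∃ j : Fin p → Fin m,
      θ ∈ Set.Icc (gridAngles j) (fun q => gridAngles j q + 2 * Real.pi / m) := by
  have hm' : (0 : ℝ) < m := by exact_mod_cast hm
  have hπ : 0 < 2 * Real.pi := Real.two_pi_pos
  -- the endpoint `2π` of the interval belongs to the last cell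
  refine ⟨fun q => ⟨min ⌊θ q * m / (2 * Real.pi)⌋₊ (m - 1), by omega⟩,
    fun q => ?_, fun q => ?_⟩
  · have h0 : 0 ≤ θ q * m / (2 * Real.pi) :=
      div_nonneg (mul_nonneg (hθ.1 q) hm'.le) hπ.le
    have h1 : ((min ⌊θ q * m / (2 * Real.pi)⌋₊ (m - 1) : ℕ) : ℝ) ≤ θ q * m / (2 * Real.pi) :=
      (Nat.cast_le.2 (min_le_left _ _)).trans (Nat.floor_le h0)
    rw [le_div_iff₀ hπ] at h1
    simp only [gridAngles]
    rw [div_le_iff₀ hm']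
    linarith
  · have h1 : θ q * m / (2 * Real.pi) ≤ (min ⌊θ q * m / (2 * Real.pi)⌋₊ (m - 1) : ℕ) + 1 := by
      rcases min_cases ⌊θ q * m / (2 * Real.pi)⌋₊ (m - 1) with h | h
      · rw [h.1]
        exact (Nat.lt_floor_add_one _).le
      · rw [h.1, Nat.cast_sub hm, div_le_iff₀ hπ]
        have := mul_le_mul_of_nonneg_right (hθ.2 q) hm'.le
        push_cast
        linarith
    rw [div_le_iff₀ hπ] at h1
    simp only [gridAngles]
    rw [← add_div, le_div_iff₀ hm']
    linarith

/-- The mean of a function over the torus exceeds its mean over a grid by at most its oscillation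
over the cells of the grid. -/
theorem setAverage_le_grid_average {p m : ℕ} (hm : 0 < m)
    (F : (Fin p → ℝ) × (Fin p → ℝ) → ℝ) (hF : ∀ θ, 0 ≤ F θ) (ε : ℝ) (hε : 0 ≤ ε)
    (hosc : ∀ (θ : (Fin p → ℝ) × (Fin p → ℝ)) (j k : Fin p → Fin m),
      (∀ q, |θ.1 q - gridAngles j q| ≤ 2 * Real.pi / m) →
      (∀ q, |θ.2 q - gridAngles k q| ≤ 2 * Real.pi / m) →
      F θ ≤ F (gridAngles j, gridAngles k) + ε) :
    ⨍ θ in (Set.Icc (0 : Fin p → ℝ) (fun _ => 2 * Real.pi)) ×ˢ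
        (Set.Icc (0 : Fin p → ℝ) (fun _ => 2 * Real.pi)), F θ ≤
      (∑ j : Fin p → Fin m, ∑ k : Fin p → Fin m, F (gridAngles j, gridAngles k)) / (m ^ p) ^ 2
        + ε := by
  have hm' : (0 : ℝ) < m := by exact_mod_cast hm
  have hπ : 0 < 2 * Real.pi := Real.two_pi_pos
  set h : ℝ := 2 * Real.pi / m with hh
  have hpos : 0 < h := div_pos hπ hm'
  set box := (Set.Icc (0 : Fin p → ℝ) (fun _ => 2 * Real.pi)) ×ˢ
        (Set.Icc (0 : Fin p → ℝ) (fun _ => 2 * Real.pi))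
  let cell : (Fin p → Fin m) × (Fin p → Fin m) → Set ((Fin p → ℝ) × (Fin p → ℝ)) := fun a =>
    (Set.Icc (gridAngles a.1) (fun q => gridAngles a.1 q + h)) ×ˢ
      (Set.Icc (gridAngles a.2) (fun q => gridAngles a.2 q + h))
  have hcell : ∀ a, volume (cell a) = ENNReal.ofReal ((h ^ p) ^ 2) := by
    intro a
    rw [Measure.volume_eq_prod, Measure.prod_prod, Real.volume_Icc_pi, Real.volume_Icc_pi]
    simp only [add_sub_cancel_left, Finset.prod_const, Finset.card_univ, Fintype.card_fin]
    rw [ENNReal.ofReal_pow (by positivity), ENNReal.ofReal_pow (by positivity), sq]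
  have hbox : volume.real box = ((2 * Real.pi) ^ p) ^ 2 := by
    rw [Measure.real, Measure.volume_eq_prod, Measure.prod_prod, Real.volume_Icc_pi]
    simp only [Pi.zero_apply, sub_zero, Finset.prod_const, Finset.card_univ, Fintype.card_fin]
    rw [← ENNReal.ofReal_pow hπ.le, ← sq, ENNReal.toReal_pow,
      ENNReal.toReal_ofReal (by positivity)]
  have hcover : box ⊆ ⋃ a, cell a := by
    intro θ hθ
    obtain ⟨j, hj⟩ := exists_gridAngles_le hm θ.1 hθ.1
    obtain ⟨k, hk⟩ := exists_gridAngles_le hm θ.2 hθ.2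
    exact Set.mem_iUnion.2 ⟨(j, k), hj, hk⟩
  have hint : ∫ θ in box, F θ ≤
      ∑ a : (Fin p → Fin m) × (Fin p → Fin m),
        (F (gridAngles a.1, gridAngles a.2) + ε) * (h ^ p) ^ 2 := by
    have hnn : ∀ a : (Fin p → Fin m) × (Fin p → Fin m),
        0 ≤ (F (gridAngles a.1, gridAngles a.2) + ε) * (h ^ p) ^ 2 := fun a =>
      mul_nonneg (add_nonneg (hF _) hε) (by positivity)
    rw [← ENNReal.ofReal_le_ofReal_iff (Finset.sum_nonneg fun a _ => hnn a),
      ENNReal.ofReal_sum_of_nonneg fun a _ => hnn a]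
    calc ENNReal.ofReal (∫ θ in box, F θ) ≤ ‖∫ θ in box, F θ‖ₑ := Real.ofReal_le_enorm _
      _ ≤ ∫⁻ θ in box, ‖F θ‖ₑ := enorm_integral_le_lintegral_enorm _
      _ ≤ ∫⁻ θ in ⋃ a, cell a, ‖F θ‖ₑ := lintegral_mono_set hcover
      _ ≤ ∑' a, ∫⁻ θ in cell a, ‖F θ‖ₑ := lintegral_iUnion_le _ _
      _ = ∑ a, ∫⁻ θ in cell a, ‖F θ‖ₑ := tsum_fintype _
      _ ≤ _ := by
        refine Finset.sum_le_sum fun a _ => ?_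
        calc ∫⁻ θ in cell a, ‖F θ‖ₑ
            ≤ ∫⁻ _ in cell a, ENNReal.ofReal (F (gridAngles a.1, gridAngles a.2) + ε) := by
              refine setLIntegral_mono' (measurableSet_Icc.prod measurableSet_Icc) fun θ hθ => ?_
              rw [Real.enorm_of_nonneg (hF θ)]
              refine ENNReal.ofReal_le_ofReal (hosc θ a.1 a.2 (fun q => ?_) fun q => ?_)
              · have h1 := hθ.1.1 q
                have h2 := hθ.1.2 q
                simp only at h2
                rw [abs_le]
                constructor <;> linarith
              · have h1 := hθ.2.1 q
                have h2 := hθ.2.2 q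
                simp only at h2
                rw [abs_le]
                constructor <;> linarith
          _ = _ := by
              rw [setLIntegral_const, hcell, ENNReal.ofReal_mul (add_nonneg (hF _) hε)]
  have hcard : (Fintype.card ((Fin p → Fin m) × (Fin p → Fin m)) : ℝ) = (m ^ p) ^ 2 := by
    simp [sq]
  have hvol : ((2 * Real.pi) ^ p) ^ 2 = ((m : ℝ) ^ p) ^ 2 * (h ^ p) ^ 2 := by
    rw [← mul_pow, ← mul_pow, hh, mul_div_cancel₀ _ hm'.ne']
  rw [setAverage_eq, hbox, smul_eq_mul, inv_mul_le_iff₀ (by positivity)]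
  refine hint.trans (le_of_eq ?_)
  rw [← Finset.sum_mul, Finset.sum_add_distrib, Finset.sum_const, Finset.card_univ, nsmul_eq_mul,
    hcard, Fintype.sum_prod_type, hvol]
  field_simp

theorem gap_le_grid_average {n p m : ℕ} (hm : 0 < m) (G₁ G₂ : SimpleGraph (Fin n)) :
    gap G₁ G₂ p ≤
      (∑ j : Fin p → Fin m, ∑ k : Fin p → Fin m,
        |energy G₁ (gridAngles j) (gridAngles k) - energy G₂ (gridAngles j) (gridAngles k)|) /
          (m ^ p) ^ 2
        + 4 * n ^ 2 * (p * ((n ^ 2 + 2 * n) * (2 * Real.pi / m))) := by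
  refine setAverage_le_grid_average hm
    (fun θ => |energy G₁ θ.1 θ.2 - energy G₂ θ.1 θ.2|) (fun θ => abs_nonneg _) _
    (by have := Real.two_pi_pos.le; positivity) fun θ j k hj hk => ?_
  have h1 := abs_energy_sub_le G₁ θ.1 (gridAngles j) θ.2 (gridAngles k) _ hj hk
  have h2 := abs_energy_sub_le G₂ θ.1 (gridAngles j) θ.2 (gridAngles k) _ hj hk
  rw [abs_le] at h1 h2
  have h3 := neg_abs_le (energy G₁ (gridAngles j) (gridAngles k) -
    energy G₂ (gridAngles j) (gridAngles k))
  have h4 := le_abs_self (energy G₁ (gridAngles j) (gridAngles k) -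
    energy G₂ (gridAngles j) (gridAngles k))
  simp only
  rw [abs_le]
  constructor <;> linarith [h1.1, h1.2, h2.1, h2.2]

end QAOA

/-! ### Error probability of the energy comparison -/

namespace QAOA

/-- A round of the comparison at given angles. -/
noncomputable def compareAt {n p : ℕ} (G₁ G₂ : SimpleGraph (Fin n)) (γ β : Fin p → ℝ)
    (shots precision : ℕ) : PMF Bool :=
  (estimate G₁ γ β shots).bind fun e₁ =>
  (estimate G₂ γ β shots).bind fun e₂ =>
  PMF.pure (decide (|e₁ - e₂| ≤ 1 / (precision : ℚ)))

theorem compareRound_eq {n : ℕ} (G₁ G₂ : SimpleGraph (Fin n)) (p bits shots precision : ℕ) :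
    compareRound G₁ G₂ p bits shots precision =
      (randomAngles p bits).bind fun γ => (randomAngles p bits).bind fun β =>
        compareAt G₁ G₂ γ β shots precision := rfl

theorem estimate_deviation_le {n p : ℕ} (G : SimpleGraph (Fin n)) (γ β : Fin p → ℝ)
    {shots D : ℕ} (hN : 0 < shots) (hD : 0 < D) :
    (estimate G γ β shots).expect
        (fun e : ℚ => if 1 / (2 * D : ℝ) < |(e : ℝ) - energy G γ β| then 1 else 0) ≤
      ENNReal.ofReal (4 * D ^ 2 * n ^ 4 / shots) := by
  have hD' : (0 : ℝ) < D := by exact_mod_cast hD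
  have hN' : (0 : ℝ) < shots := by exact_mod_cast hN
  have h := sampleMean_deviation_le (bornRule (state G γ β) (state_norm G γ β)) (uncut G) (n ^ 2)
    (uncut_le G) (energy G γ β) (by
      rw [energy_eq_sum]
      refine Finset.sum_congr rfl fun z _ => ?_
      rw [bornRule, PMF.ofFintype_apply, ENNReal.toReal_ofReal (by positivity)])
    shots hN (1 / (2 * D)) (by positivity)
  refine h.trans (ENNReal.ofReal_le_ofReal (le_of_eq ?_))
  push_cast
  field_simp
  norm_num

/-- An outcome that is impossible when both estimates are within half the precision is unlikely. -/
theorem compareAt_le {n p : ℕ} (G₁ G₂ : SimpleGraph (Fin n)) (γ β : Fin p → ℝ)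
    {shots D : ℕ} (hN : 0 < shots) (hD : 0 < D) (b : Bool)
    (hb : ∀ e₁ e₂ : ℚ, |(e₁ : ℝ) - energy G₁ γ β| ≤ 1 / (2 * D) →
      |(e₂ : ℝ) - energy G₂ γ β| ≤ 1 / (2 * D) → decide (|e₁ - e₂| ≤ 1 / (D : ℚ)) ≠ b) :
    compareAt G₁ G₂ γ β shots D b ≤ ENNReal.ofReal (8 * D ^ 2 * n ^ 4 / shots) := by
  set I₁ : ℚ → ℝ≥0∞ := fun e => if 1 / (2 * D : ℝ) < |(e : ℝ) - energy G₁ γ β| then 1 else 0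
  set I₂ : ℚ → ℝ≥0∞ := fun e => if 1 / (2 * D : ℝ) < |(e : ℝ) - energy G₂ γ β| then 1 else 0
  have h : compareAt G₁ G₂ γ β shots D b ≤ (estimate G₁ γ β shots).expect fun e₁ =>
      (estimate G₂ γ β shots).expect fun e₂ => I₁ e₁ + I₂ e₂ := by
    refine PMF.expect_mono _ fun e₁ => PMF.expect_mono _ fun e₂ => ?_
    rw [PMF.pure_apply]
    split_ifs with hd
    swap
    · exact zero_le
    by_cases h1 : 1 / (2 * D : ℝ) < |(e₁ : ℝ) - energy G₁ γ β|
    · have : I₁ e₁ = 1 := if_pos h1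
      rw [this]
      exact le_self_add
    by_cases h2 : 1 / (2 * D : ℝ) < |(e₂ : ℝ) - energy G₂ γ β|
    · have : I₂ e₂ = 1 := if_pos h2
      rw [this]
      exact le_add_self
    exact absurd hd.symm (hb e₁ e₂ (not_lt.1 h1) (not_lt.1 h2))
  refine h.trans ?_
  simp only [PMF.expect_add, PMF.expect_const]
  refine (add_le_add (estimate_deviation_le G₁ γ β hN hD)
    (estimate_deviation_le G₂ γ β hN hD)).trans ?_
  rw [← ENNReal.ofReal_add (by positivity) (by positivity)]
  exact ENNReal.ofReal_le_ofReal (le_of_eq (by ring))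

theorem compareAt_false_le {n p : ℕ} (G₁ G₂ : SimpleGraph (Fin n)) (γ β : Fin p → ℝ)
    {shots D : ℕ} (hN : 0 < shots) (hD : 0 < D) (hE : energy G₁ γ β = energy G₂ γ β) :
    compareAt G₁ G₂ γ β shots D false ≤ ENNReal.ofReal (8 * D ^ 2 * n ^ 4 / shots) := by
  refine compareAt_le G₁ G₂ γ β hN hD false fun e₁ e₂ h1 h2 => ?_
  have e : (1 : ℝ) / D = 1 / (2 * D) + 1 / (2 * D) := by
    have hD' : (0 : ℝ) < D := by exact_mod_cast hD
    field_simp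
    norm_num
  have h : |(e₁ : ℝ) - e₂| ≤ 1 / D := by
    rw [abs_le] at *
    constructor <;> linarith [h1.1, h1.2, h2.1, h2.2]
  have h' : |e₁ - e₂| ≤ 1 / (D : ℚ) := by
    rw [← Rat.cast_le (K := ℝ)]
    push_cast
    exact h
  simp [decide_eq_true h', -one_div]

theorem compareAt_true_le {n p : ℕ} (G₁ G₂ : SimpleGraph (Fin n)) (γ β : Fin p → ℝ)
    {shots D : ℕ} (hN : 0 < shots) (hD : 0 < D)
    (hE : 2 / (D : ℝ) < |energy G₁ γ β - energy G₂ γ β|) :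
    compareAt G₁ G₂ γ β shots D true ≤ ENNReal.ofReal (8 * D ^ 2 * n ^ 4 / shots) := by
  refine compareAt_le G₁ G₂ γ β hN hD true fun e₁ e₂ h1 h2 => ?_
  have e : (1 : ℝ) / D = 1 / (2 * D) + 1 / (2 * D) := by
    have hD' : (0 : ℝ) < D := by exact_mod_cast hD
    field_simp
    norm_num
  have e' : (2 : ℝ) / D = 1 / D + 1 / D := by ring
  have h : ¬ |(e₁ : ℝ) - e₂| ≤ 1 / D := by
    intro h3
    rw [abs_le] at h1 h2 h3
    rcases lt_abs.1 hE with h4 | h4 <;> linarith [h1.1, h1.2, h2.1, h2.2, h3.1, h3.2]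
  have h' : ¬ |e₁ - e₂| ≤ 1 / (D : ℚ) := by
    intro h3
    rw [← Rat.cast_le (K := ℝ)] at h3
    push_cast at h3
    exact h h3
  simp [decide_eq_false h', -one_div]

theorem compareRound_false_le {n : ℕ} {G₁ G₂ : SimpleGraph (Fin n)} (e : G₁ ≃g G₂)
    (p bits : ℕ) {shots D : ℕ} (hN : 0 < shots) (hD : 0 < D) :
    compareRound G₁ G₂ p bits shots D false ≤ ENNReal.ofReal (8 * D ^ 2 * n ^ 4 / shots) := by
  rw [compareRound_eq, PMF.bind_apply_eq_expect, ← PMF.expect_const (randomAngles p bits)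
    (ENNReal.ofReal _)]
  refine PMF.expect_mono _ fun γ => ?_
  rw [PMF.bind_apply_eq_expect, ← PMF.expect_const (randomAngles p bits) (ENNReal.ofReal _)]
  exact PMF.expect_mono _ fun β => compareAt_false_le G₁ G₂ γ β hN hD (energy_eq_of_iso e γ β)

theorem expect_randomAngles (p bits : ℕ) (f : (Fin p → ℝ) → ℝ≥0∞) :
    (randomAngles p bits).expect f =
      ENNReal.ofReal (1 / ((2 ^ bits : ℕ) : ℝ) ^ p) *
        ∑ j : Fin p → Fin (2 ^ bits), f (gridAngles j) := by
  rw [randomAngles, PMF.expect_map, PMF.expect_fintype, Finset.mul_sum]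
  refine Finset.sum_congr rfl fun j _ => ?_
  have hpos : (0 : ℝ) < ((2 ^ bits : ℕ) : ℝ) ^ p := by positivity
  congr 1
  · rw [PMF.uniformOfFintype_apply, one_div, ENNReal.ofReal_inv_of_pos hpos,
      ← Nat.cast_pow, ENNReal.ofReal_natCast]
    simp
  · congr 1
    ext q
    simp [gridAngles]

/-- If the energies differ on average over the grid then a round sees it with a probability that is
proportional to the difference. The bound holds pointwise: the energies differ by at most `n ^ 2`,
and where they differ by more than `2 / D` the round errs with probability at most `1 / 2`. -/
theorem compareRound_true_le {n : ℕ} (hn : 0 < n) (G₁ G₂ : SimpleGraph (Fin n))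
    (p bits : ℕ) {shots D : ℕ} (hN : 0 < shots) (hD : 0 < D)
    (herr : 8 * (D : ℝ) ^ 2 * n ^ 4 / shots ≤ 1 / 2) (a : ℝ)
    (ha : a ≤ (∑ j : Fin p → Fin (2 ^ bits), ∑ k : Fin p → Fin (2 ^ bits),
      |energy G₁ (gridAngles j) (gridAngles k) - energy G₂ (gridAngles j) (gridAngles k)|) /
        (((2 ^ bits : ℕ) : ℝ) ^ p) ^ 2) :
    compareRound G₁ G₂ p bits shots D true ≤
      ENNReal.ofReal (1 - (a - 2 / D) / (2 * n ^ 2)) := by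
  have hn' : (0 : ℝ) < n := by exact_mod_cast hn
  have hD' : (0 : ℝ) < D := by exact_mod_cast hD
  set m : ℕ := 2 ^ bits with hm
  have hm' : (0 : ℝ) < m := by simp only [hm]; positivity
  set Δ : (Fin p → Fin m) → (Fin p → Fin m) → ℝ := fun j k =>
    |energy G₁ (gridAngles j) (gridAngles k) - energy G₂ (gridAngles j) (gridAngles k)|
  have hΔ : ∀ j k, Δ j k ≤ n ^ 2 := by
    intro j k
    have h1 := energy_nonneg G₁ (gridAngles j) (gridAngles k)
    have h2 := energy_nonneg G₂ (gridAngles j) (gridAngles k)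
    have h3 := energy_le G₁ (gridAngles j) (gridAngles k)
    have h4 := energy_le G₂ (gridAngles j) (gridAngles k)
    simp only [Δ]
    rw [abs_le]
    constructor <;> linarith
  have hbound : ∀ j k, 0 ≤ 1 - (Δ j k - 2 / D) / (2 * n ^ 2) := by
    intro j k
    rw [sub_nonneg, div_le_one (by positivity)]
    have := hΔ j k
    have : 0 ≤ 2 / (D : ℝ) := by positivity
    nlinarith [sq_nonneg (n : ℝ)]
  have hpt : ∀ j k, compareAt G₁ G₂ (gridAngles j) (gridAngles k) shots D true ≤
      ENNReal.ofReal (1 - (Δ j k - 2 / D) / (2 * n ^ 2)) := by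
    intro j k
    by_cases h : 2 / (D : ℝ) < Δ j k
    · refine (compareAt_true_le G₁ G₂ _ _ hN hD h).trans (ENNReal.ofReal_le_ofReal ?_)
      refine herr.trans ?_
      rw [le_sub_comm, div_le_iff₀ (by positivity)]
      have := hΔ j k
      have : 0 ≤ 2 / (D : ℝ) := by positivity
      linarith
    · refine (PMF.coe_le_one _ _).trans ?_
      rw [← ENNReal.ofReal_one]
      refine ENNReal.ofReal_le_ofReal ?_
      rw [le_sub_self_iff]
      exact div_nonpos_of_nonpos_of_nonneg (by linarith) (by positivity)
  rw [compareRound_eq, PMF.bind_apply_eq_expect, expect_randomAngles]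
  simp only [PMF.bind_apply_eq_expect, expect_randomAngles]
  rw [← hm]
  calc _ ≤ ENNReal.ofReal (1 / (m : ℝ) ^ p) * ∑ j : Fin p → Fin m,
          ENNReal.ofReal (1 / (m : ℝ) ^ p) * ∑ k : Fin p → Fin m,
            ENNReal.ofReal (1 - (Δ j k - 2 / D) / (2 * n ^ 2)) := by
        gcongr with j _ k _
        exact hpt j k
    _ = ENNReal.ofReal (1 / (m : ℝ) ^ p * ∑ j : Fin p → Fin m,
          1 / (m : ℝ) ^ p * ∑ k : Fin p → Fin m, (1 - (Δ j k - 2 / D) / (2 * n ^ 2))) := by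
        rw [ENNReal.ofReal_mul (by positivity), ENNReal.ofReal_sum_of_nonneg
          (fun j _ => mul_nonneg (by positivity) (Finset.sum_nonneg fun k _ => hbound j k))]
        congr 1
        refine Finset.sum_congr rfl fun j _ => ?_
        rw [ENNReal.ofReal_mul (by positivity),
          ENNReal.ofReal_sum_of_nonneg fun k _ => hbound j k]
    _ ≤ _ := by
        refine ENNReal.ofReal_le_ofReal ?_
        have hcard : (Fintype.card (Fin p → Fin m) : ℝ) = (m : ℝ) ^ p := by simp
        have e : (1 / (m : ℝ) ^ p * ∑ j : Fin p → Fin m,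
            1 / (m : ℝ) ^ p * ∑ k : Fin p → Fin m, (1 - (Δ j k - 2 / D) / (2 * n ^ 2))) =
            1 - ((∑ j, ∑ k, Δ j k) / ((m : ℝ) ^ p) ^ 2 - 2 / D) / (2 * n ^ 2) := by
          simp only [Finset.sum_sub_distrib, ← Finset.sum_div, Finset.sum_const,
            Finset.card_univ, nsmul_eq_mul, hcard, ← Finset.mul_sum, mul_one]
          field_simp
        rw [e]
        gcongr

theorem compareLevels_true {n : ℕ} (G₁ G₂ : SimpleGraph (Fin n)) (b N D : ℕ) (l : List ℕ) :
    compareLevels G₁ G₂ b N D l true = (l.map fun p => compareRound G₁ G₂ p b N D true).prod := by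
  induction l with
  | nil => simp [compareLevels]
  | cons p l ih =>
    rw [compareLevels, PMF.bind_apply_eq_expect, PMF.expect_bool]
    simp only [PMF.bind_apply_eq_expect, PMF.expect_bool, PMF.pure_apply]
    simp [ih]

theorem compareLevels_false_le {n : ℕ} (G₁ G₂ : SimpleGraph (Fin n)) (b N D : ℕ) (l : List ℕ)
    (ε : ℝ≥0∞) (hε : ∀ p, compareRound G₁ G₂ p b N D false ≤ ε) :
    compareLevels G₁ G₂ b N D l false ≤ l.length * ε := by
  induction l with
  | nil => simp [compareLevels]
  | cons p l ih =>
    have h1 := PMF.apply_true_add_apply_false (compareLevels G₁ G₂ b N D l)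
    have h2 := PMF.coe_le_one (compareRound G₁ G₂ p b N D) true
    rw [compareLevels, PMF.bind_apply_eq_expect, PMF.expect_bool]
    simp only [PMF.bind_apply_eq_expect, PMF.expect_bool, PMF.pure_apply]
    simp only [Bool.and_self, Bool.and_false, Bool.false_and, if_true, mul_one,
      h1, Bool.false_eq_true, if_false, mul_zero, zero_add, List.length_cons, Nat.cast_add,
      Nat.cast_one, add_mul, one_mul]
    exact add_le_add ((mul_le_of_le_one_left (zero_le) h2).trans ih) (hε p)

/-- With these parameters the energy comparison errs with probability at most `1 / 3`. The number `b`
of bits makes the grid average of the gap at least `1 / (2 * q)`. With `2 / D = 1 / (4 * q)`, a round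
at the level where the gap is large then sees it with probability at least `1 / (8 * q * n ^ 2)`, and
`M` such rounds all miss it with probability at most `exp (-2) ≤ 1 / 3`. For isomorphic graphs, `N`
shots make the error of a round at most `1 / 3` divided by the number `(l + 1) * M` of rounds. -/
theorem energyComparison_decides {n : ℕ} (l q : ℕ) (hq : 0 < q) (G₁ G₂ : SimpleGraph (Fin n))
    (hgap : ¬ Nonempty (G₁ ≃g G₂) → ∃ p ≤ l, 1 / (q : ℝ) ≤ gap G₁ G₂ p)
    (M b D N : ℕ) (hM : M = 16 * q * n ^ 2 + 1)
    (hb : b = 64 * q * l * n ^ 2 * (n ^ 2 + 2 * n) + 1) (hD : D = 8 * q)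
    (hN : N = 24 * D ^ 2 * n ^ 4 * ((l + 1) * M) + 1) :
    (Nonempty (G₁ ≃g G₂) → 2 / 3 ≤ energyComparison G₁ G₂ l M b N D true) ∧
    (¬ Nonempty (G₁ ≃g G₂) → 2 / 3 ≤ energyComparison G₁ G₂ l M b N D false) := by
  have hD0 : 0 < D := by omega
  have hN0 : 0 < N := by omega
  have hM0 : 0 < M := by omega
  have hNr : (N : ℝ) = 24 * D ^ 2 * n ^ 4 * ((l + 1) * M) + 1 := by rw [hN]; push_cast; ring
  have hN' : (0 : ℝ) < N := by exact_mod_cast hN0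
  have htwo : (2 / 3 : ℝ≥0∞) + 1 / 3 = 1 := by
    rw [ENNReal.div_add_div_same, show (2 : ℝ≥0∞) + 1 = 3 by norm_num]
    exact ENNReal.div_self (by norm_num) (by norm_num)
  have third : ENNReal.ofReal (1 / 3) = 1 / 3 := by
    rw [ENNReal.ofReal_div_of_pos (by norm_num)]
    simp
  -- it suffices to bound the probability of the wrong answer
  have conv : ∀ (μ : PMF Bool) (c : Bool), μ (!c) ≤ ENNReal.ofReal (1 / 3) → 2 / 3 ≤ μ c := by
    intro μ c h
    have h1 : μ c + μ (!c) = 1 := by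
      rw [← PMF.apply_true_add_apply_false μ]
      cases c
      · exact add_comm _ _
      · rfl
    have h2 : 2 / 3 + 1 / 3 ≤ μ c + 1 / 3 :=
      calc 2 / 3 + 1 / 3 = μ c + μ (!c) := htwo.trans h1.symm
        _ ≤ μ c + 1 / 3 := by rw [← third]; gcongr
    exact (ENNReal.add_le_add_iff_right (by simp)).1 h2
  refine ⟨fun ⟨e⟩ => conv _ true ?_, fun hne => conv _ false ?_⟩
  · refine (compareLevels_false_le G₁ G₂ b N D _ (ENNReal.ofReal (8 * D ^ 2 * n ^ 4 / N))
      fun p => compareRound_false_le e p b hN0 hD0).trans ?_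
    have hlen : ((List.range (l + 1)).flatMap fun p => List.replicate M p).length =
        (l + 1) * M := by
      simp [List.length_flatMap]
    rw [hlen, ← ENNReal.ofReal_natCast, ← ENNReal.ofReal_mul (by positivity)]
    refine ENNReal.ofReal_le_ofReal ?_
    rw [← mul_div_assoc, div_le_iff₀ hN', hNr]
    push_cast
    nlinarith
  · obtain ⟨p, hpl, hp⟩ := hgap hne
    have hn : 0 < n := by
      by_contra h0
      obtain rfl : n = 0 := by omega
      exact hne ⟨⟨Equiv.refl _, fun {a} => a.elim0⟩⟩
    have hn' : (0 : ℝ) < n := by exact_mod_cast hn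
    have hq' : (0 : ℝ) < q := by exact_mod_cast hq
    have hpl' : (p : ℝ) ≤ l := by exact_mod_cast hpl
    have hosc : 4 * (n : ℝ) ^ 2 * (p * ((n ^ 2 + 2 * n) * (2 * Real.pi / (2 ^ b : ℕ)))) ≤
        1 / (2 * q) := by
      have hbig : (64 * q * l * n ^ 2 * (n ^ 2 + 2 * n) : ℝ) ≤ ((2 ^ b : ℕ) : ℝ) := by
        have : 64 * q * l * n ^ 2 * (n ^ 2 + 2 * n) ≤ 2 ^ b := by
          have := Nat.lt_two_pow_self (n := b)
          omega
        exact_mod_cast this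
      have hB : (0 : ℝ) < ((2 ^ b : ℕ) : ℝ) := by positivity
      rw [show 4 * (n : ℝ) ^ 2 * (p * ((n ^ 2 + 2 * n) * (2 * Real.pi / (2 ^ b : ℕ)))) =
        (8 * Real.pi * n ^ 2 * p * (n ^ 2 + 2 * n)) / (2 ^ b : ℕ) by ring,
        div_le_div_iff₀ hB (by positivity), one_mul]
      refine le_trans ?_ hbig
      calc 8 * Real.pi * (n : ℝ) ^ 2 * p * (n ^ 2 + 2 * n) * (2 * q)
          ≤ 8 * 4 * (n : ℝ) ^ 2 * l * (n ^ 2 + 2 * n) * (2 * q) := by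
            have := Real.pi_le_four
            gcongr
        _ = _ := by ring
    have hgrid := gap_le_grid_average (p := p) (m := 2 ^ b) (by positivity) G₁ G₂
    have hhalf : 1 / (q : ℝ) = 1 / (2 * q) + 1 / (2 * q) := by field_simp; norm_num
    have hr := compareRound_true_le hn G₁ G₂ p b hN0 hD0 (by
      rw [div_le_iff₀ hN', hNr]
      have h1 : (1 : ℝ) ≤ (l + 1) * M := by
        have : 1 ≤ (l + 1) * M := Nat.mul_pos (by omega) hM0
        exact_mod_cast this
      nlinarith [mul_le_mul_of_nonneg_left h1
        (show (0 : ℝ) ≤ 24 * (D : ℝ) ^ 2 * n ^ 4 by positivity),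
        show (0 : ℝ) ≤ 24 * (D : ℝ) ^ 2 * n ^ 4 by positivity]) (1 / (2 * q)) (by linarith)
    set x : ℝ := (1 / (2 * (q : ℝ)) - 2 / D) / (2 * n ^ 2) with hx
    have hxe : x = 1 / (8 * q * n ^ 2) := by
      rw [hx, hD]
      push_cast
      field_simp
      norm_num
    have hx1 : 0 ≤ 1 - x := by
      rw [hxe, sub_nonneg, div_le_one (by positivity)]
      have h1 : (1 : ℝ) ≤ q := by exact_mod_cast hq
      have h2 : (1 : ℝ) ≤ n := by exact_mod_cast hn
      have h3 : (1 : ℝ) ≤ n ^ 2 := one_le_pow₀ h2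
      nlinarith
    have hMx : 2 ≤ M * x := by
      rw [hxe, hM]
      push_cast
      rw [mul_one_div, le_div_iff₀ (by positivity)]
      linarith
    rw [Bool.not_false]
    calc energyComparison G₁ G₂ l M b N D true
        = ∏ p ∈ Finset.range (l + 1), compareRound G₁ G₂ p b N D true ^ M := by
          rw [energyComparison, compareLevels_true]
          generalize l + 1 = k
          induction k with
          | zero => simp
          | succ k ih => simp [List.range_succ, Finset.prod_range_succ, ih]
      _ ≤ compareRound G₁ G₂ p b N D true ^ M := by
          rw [← Finset.mul_prod_erase _ _ (Finset.mem_range.2 (Nat.lt_succ_of_le hpl))]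
          exact mul_le_of_le_one_right zero_le
            (Finset.prod_le_one' fun i _ => pow_le_one' (PMF.coe_le_one _ _) _)
      _ ≤ ENNReal.ofReal (1 - x) ^ M := by gcongr
      _ = ENNReal.ofReal ((1 - x) ^ M) := (ENNReal.ofReal_pow hx1 _).symm
      _ ≤ ENNReal.ofReal (1 / 3) := by
          refine ENNReal.ofReal_le_ofReal ?_
          calc (1 - x) ^ M ≤ Real.exp (-x) ^ M :=
                pow_le_pow_left₀ hx1 (Real.one_sub_le_exp_neg x) M
            _ = Real.exp (-(M * x)) := by rw [← Real.exp_nat_mul]; ring_nf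
            _ ≤ Real.exp (-2) := Real.exp_le_exp.2 (by linarith)
            _ ≤ 1 / 3 := by
                rw [Real.exp_neg, inv_eq_one_div]
                exact one_div_le_one_div_of_le (by norm_num)
                  (by linarith [Real.add_one_le_exp (2 : ℝ)])

end QAOA

/-! ### The QAOA circuit -/

namespace QMachine

/-- Run a list of gates on a state. -/
noncomputable def runGates {w : ℕ} (c : List Gate) (ψ : (Fin w → Bool) → ℂ) :
    (Fin w → Bool) → ℂ :=
  c.foldl (fun ψ g => g.act ψ) ψ

theorem runGates_append {w : ℕ} (c d : List Gate) (ψ : (Fin w → Bool) → ℂ) :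
    runGates (c ++ d) ψ = runGates d (runGates c ψ) := List.foldl_append

theorem runGates_nil {w : ℕ} (ψ : (Fin w → Bool) → ℂ) : runGates [] ψ = ψ := rfl

theorem runGates_singleton {w : ℕ} (g : Gate) (ψ : (Fin w → Bool) → ℂ) :
    runGates [g] ψ = g.act ψ := rfl

/-- Phase gates on qubit `v` for the `b` bits of a binary fraction, the last bit being bit `0`;
bit `l` gives the gate with angle `2π / 2 ^ (b - l - s)`, so that `s = 1` doubles the angle. (The
first bit then contributes an integer multiple of `2π`: for `l = b - 1` the exponent is `0`.) -/
def phaseGates (x : ℕ → ℕ) (b s v : ℕ) : List Gate :=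
  (List.range b).flatMap fun l => if x l ≠ 0 then [Gate.phase (b - l - s) v] else []

/-- The circuit for `exp(-iγ C_{uv})`, up to the global phase `exp(iγ)`: the phase acts on the parity
of the two bits, which is `1` if the edge is cut. -/
def edgeGates (x : ℕ → ℕ) (b u v : ℕ) : List Gate :=
  [Gate.cnot u v] ++ (phaseGates x b 0 v ++ [Gate.cnot u v])

/-- The circuit for `exp(-iβ X_v)`, up to the global phase `exp(iβ)`, which shifts the eigenvalues
`exp(∓iβ)` to `1` and `exp(2iβ)`. -/
def mixGates (x : ℕ → ℕ) (b v : ℕ) : List Gate :=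
  [Gate.hadamard v] ++ (phaseGates x b 1 v ++ [Gate.hadamard v])

/-- The circuit for a QAOA level, for the graph with adjacency array `adj`. -/
def levelGates (adj : ℕ → ℕ) (n b : ℕ) (x y : ℕ → ℕ) : List Gate :=
  ((List.range n).flatMap fun u => (List.range n).flatMap fun v =>
    if u < v ∧ adj (u * n + v) ≠ 0 then edgeGates x b u v else []) ++
  (List.range n).flatMap fun v => mixGates y b v

/-- The circuit for the level-`p` QAOA state; the bits of the angles of level `q` are the entries
`q * b, …, q * b + b - 1` of the arrays `x` (for `γ`) and `y` (for `β`). -/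
def qaoaGates (adj : ℕ → ℕ) (n b p : ℕ) (x y : ℕ → ℕ) : List Gate :=
  ((List.range n).flatMap fun v => [Gate.hadamard v]) ++
  (List.range p).flatMap fun q =>
    levelGates adj n b (fun l => x (q * b + l)) (fun l => y (q * b + l))

/-- The angle `2π ∑ l, x_l 2 ^ l / 2 ^ b` encoded by the bits `x_l`, `l < b`. -/
noncomputable def bitsAngle (x : ℕ → ℕ) (b : ℕ) : ℝ :=
  2 * Real.pi * (∑ l ∈ Finset.range b, if x l ≠ 0 then 2 ^ l else 0 : ℕ) / 2 ^ b

theorem runGates_phases {w : ℕ} (x k : ℕ → ℕ) (v : Fin w) (ls : List ℕ)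
    (ψ : (Fin w → Bool) → ℂ) :
    runGates (ls.flatMap fun l => if x l ≠ 0 then [Gate.phase (k l) v] else []) ψ = fun z =>
      (if z v then Complex.exp
        (((ls.map fun l => if x l ≠ 0 then 2 * Real.pi / 2 ^ k l else 0).sum : ℝ) * Complex.I)
        else 1) * ψ z := by
  induction ls generalizing ψ with
  | nil => ext z; simp [runGates]
  | cons l ls ih =>
    rw [List.flatMap_cons, runGates_append, ih]
    ext z
    rw [List.map_cons, List.sum_cons]
    by_cases hx : x l ≠ 0
    · rw [if_pos hx, if_pos hx, runGates_singleton]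
      simp only [Gate.act, v.isLt, dif_pos, Fin.eta]
      by_cases hz : z v
      · simp only [hz, if_true]
        rw [← mul_assoc, ← Complex.exp_add]
        congr 2
        push_cast
        ring
      · simp [hz]
    · rw [if_neg hx, if_neg hx, runGates_nil, zero_add]

theorem runGates_phaseGates {w : ℕ} (x : ℕ → ℕ) (b s : ℕ) (hs : s ≤ 1) (v : Fin w)
    (ψ : (Fin w → Bool) → ℂ) :
    runGates (phaseGates x b s v) ψ = fun z =>
      (if z v then Complex.exp ((2 ^ s * bitsAngle x b : ℝ) * Complex.I) else 1) * ψ z := by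
  have h : ((List.range b).map fun l =>
      if x l ≠ 0 then 2 * Real.pi / 2 ^ (b - l - s) else 0).sum = 2 ^ s * bitsAngle x b := by
    rw [← List.sum_toFinset _ List.nodup_range, List.toFinset_range, bitsAngle]
    push_cast
    rw [Finset.mul_sum, Finset.sum_div, Finset.mul_sum]
    refine Finset.sum_congr rfl fun l hl => ?_
    split_ifs
    · have hb : (2 : ℝ) ^ b = 2 ^ (b - l - s) * (2 ^ l * 2 ^ s) := by
        rw [← pow_add, ← pow_add]
        congr 1
        have := Finset.mem_range.1 hl
        omega
      rw [hb]
      field_simp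
    · simp
  rw [phaseGates, runGates_phases, h]

theorem runGates_edgeGates {w : ℕ} (x : ℕ → ℕ) (b : ℕ) {u v : Fin w} (huv : u ≠ v)
    (ψ : (Fin w → Bool) → ℂ) :
    runGates (edgeGates x b u v) ψ = fun z =>
      Complex.exp (Complex.I * bitsAngle x b) *
        ((if z u = z v then Complex.exp (-(Complex.I * bitsAngle x b)) else 1) * ψ z) := by
  have huv' : ¬ (u : ℕ) = v := fun h => huv (Fin.ext h)
  rw [edgeGates, runGates_append, runGates_append, runGates_phaseGates x b 0 zero_le_one,
    runGates_singleton, runGates_singleton]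
  ext z
  simp only [Gate.act, u.isLt, v.isLt, huv', true_and, not_false_eq_true, dif_pos, Fin.eta, ne_eq,
    Function.update_self, Function.update_of_ne huv, Function.update_idem]
  have e : Complex.exp (Complex.I * bitsAngle x b) * Complex.exp (-(Complex.I * bitsAngle x b))
      = 1 := by
    rw [← Complex.exp_add, add_neg_cancel, Complex.exp_zero]
  have upd : Function.update z v (z v) = z := Function.update_eq_self v z
  cases hu : z u <;> cases hv : z v <;> rw [hv] at upd <;>
    simp [upd, ← mul_assoc, e, mul_comm _ Complex.I]

theorem runGates_mixGates {n : ℕ} (x : ℕ → ℕ) (b : ℕ) (v : Fin n) (ψ : QAOA.Bits n → ℂ) :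
    runGates (mixGates x b v) ψ =
      Complex.exp (Complex.I * bitsAngle x b) • QAOA.mixStep (bitsAngle x b) v ψ := by
  rw [mixGates, runGates_append, runGates_append, runGates_phaseGates x b 1 le_rfl,
    runGates_singleton, runGates_singleton]
  set β := bitsAngle x b
  have hs : (Real.sqrt 2 : ℂ) * Real.sqrt 2 = 2 := by
    rw [← Complex.ofReal_mul, Real.mul_self_sqrt (by norm_num)]
    norm_num
  have hr : (Real.sqrt 2 : ℂ)⁻¹ * (Real.sqrt 2 : ℂ)⁻¹ = 1 / 2 := by
    rw [← mul_inv, hs, one_div]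
  -- `exp(2iβ) = exp(iβ)²`, and `exp(iβ)` times `cos β`, `i sin β` are halves of `exp(2iβ) ± 1`
  have e2 : Complex.exp (((2 ^ 1 * β : ℝ) : ℂ) * Complex.I) =
      Complex.exp (Complex.I * β) * Complex.exp (Complex.I * β) := by
    rw [← Complex.exp_add]
    congr 1
    push_cast
    ring
  have ec : (Complex.exp (Complex.I * β) * Complex.exp (Complex.I * β) + 1) / 2 =
      Complex.exp (Complex.I * β) * Real.cos β := by
    rw [Complex.ofReal_cos, Complex.cos, mul_comm Complex.I, mul_div_assoc', mul_add,
      ← Complex.exp_add, ← Complex.exp_add, neg_mul, add_neg_cancel, Complex.exp_zero]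
  have es : (Complex.exp (Complex.I * β) * Complex.exp (Complex.I * β) - 1) / 2 =
      Complex.exp (Complex.I * β) * (Complex.I * Real.sin β) := by
    rw [Complex.ofReal_sin, Complex.sin, mul_comm Complex.I (β : ℂ)]
    have : Complex.exp (β * Complex.I) * Complex.exp (-β * Complex.I) = 1 := by
      rw [← Complex.exp_add, neg_mul, add_neg_cancel, Complex.exp_zero]
    linear_combination this / 2 + (Complex.exp (β * Complex.I) *
      (Complex.exp (-β * Complex.I) - Complex.exp (β * Complex.I)) / 2) * Complex.I_mul_I.symm
  rw [e2]
  ext z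
  simp only [Gate.act, v.isLt, dif_pos, Fin.eta, Function.update_self, Function.update_idem,
    Bool.false_eq_true, if_false, if_true, one_mul, QAOA.mixStep, Pi.smul_apply, smul_eq_mul,
    div_eq_mul_inv]
  have upd : Function.update z v (z v) = z := Function.update_eq_self v z
  cases hv : z v
  · rw [hv] at upd
    have hf : QAOA.flipBit v z = Function.update z v true := by simp [QAOA.flipBit, hv]
    rw [upd, hf]
    simp only [Bool.false_eq_true, if_false]
    linear_combination (ψ z + ψ (Function.update z v true) +
      Complex.exp (Complex.I * β) * Complex.exp (Complex.I * β) *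
        (ψ z - ψ (Function.update z v true))) * hr +
      ψ z * ec - ψ (Function.update z v true) * es
  · rw [hv] at upd
    have hf : QAOA.flipBit v z = Function.update z v false := by simp [QAOA.flipBit, hv]
    rw [upd, hf]
    simp only [if_true]
    linear_combination (ψ (Function.update z v false) + ψ z -
      Complex.exp (Complex.I * β) * Complex.exp (Complex.I * β) *
        (ψ (Function.update z v false) - ψ z)) * hr +
      ψ z * ec - ψ (Function.update z v false) * es

theorem runGates_flatMap_edgeGates {w : ℕ} (x : ℕ → ℕ) (b : ℕ) (l : List (Fin w × Fin w))
    (hl : ∀ e ∈ l, e.1 ≠ e.2) (ψ : (Fin w → Bool) → ℂ) :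
    runGates (l.flatMap fun e => edgeGates x b e.1 e.2) ψ =
      Complex.exp (Complex.I * bitsAngle x b) ^ l.length • fun z =>
        Complex.exp (-(Complex.I * bitsAngle x b)) ^ (l.countP fun e => z e.1 = z e.2) * ψ z := by
  induction l generalizing ψ with
  | nil => ext z; simp [runGates]
  | cons e l ih =>
    rw [List.flatMap_cons, runGates_append, ih (fun e he => hl e (List.mem_cons_of_mem _ he)),
      runGates_edgeGates x b (hl e List.mem_cons_self)]
    ext z
    simp only [Pi.smul_apply, smul_eq_mul, List.length_cons, List.countP_cons, decide_eq_true_eq]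
    split_ifs <;> ring

theorem mixStep_smul {n : ℕ} (β : ℝ) (v : Fin n) (c : ℂ) (ψ : QAOA.Bits n → ℂ) :
    QAOA.mixStep β v (c • ψ) = c • QAOA.mixStep β v ψ := by
  ext z
  simp only [QAOA.mixStep, Pi.smul_apply, smul_eq_mul]
  ring

theorem runGates_flatMap_mixGates {n : ℕ} (x : ℕ → ℕ) (b : ℕ) (l : List (Fin n))
    (ψ : QAOA.Bits n → ℂ) :
    runGates (l.flatMap fun v : Fin n => mixGates x b v) ψ =
      Complex.exp (Complex.I * bitsAngle x b) ^ l.length •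
        l.foldr (QAOA.mixStep (bitsAngle x b)) ψ := by
  have key : ∀ (l : List (Fin n)) (c : ℂ) (ψ : QAOA.Bits n → ℂ),
      runGates (l.flatMap fun v : Fin n => mixGates x b v) (c • ψ) =
      (c * Complex.exp (Complex.I * bitsAngle x b) ^ l.length) •
        l.foldl (fun φ v => QAOA.mixStep (bitsAngle x b) v φ) ψ := by
    intro l
    induction l with
    | nil => intro c ψ; simp [runGates]
    | cons v l ih =>
      intro c ψ
      rw [List.flatMap_cons, runGates_append, runGates_mixGates, mixStep_smul, smul_smul, ih,
        List.foldl_cons, List.length_cons]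
      congr 1
      ring
  have := key l 1 ψ
  rw [one_smul, one_mul] at this
  rw [this, ← List.reverse_perm l |>.foldr_eq, List.foldr_reverse]

theorem adjArray_ne_zero {n : ℕ} (G : SimpleGraph (Fin n)) (u v : Fin n) :
    adjArray G (u * n + v) ≠ 0 ↔ G.Adj u v := by
  have h : (∃ u' v' : Fin n, (u * n + v : ℕ) = u' * n + v' ∧ G.Adj u' v') ↔ G.Adj u v := by
    constructor
    · rintro ⟨u', v', h, hadj⟩
      have hn : 0 < n := u.pos
      have h1 : (u : ℕ) = u' := by
        have := congrArg (· / n) h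
        simpa [mul_comm _ n, Nat.mul_add_div hn, Nat.div_eq_of_lt] using this
      have h2 : (v : ℕ) = v' := by
        rw [h1] at h
        omega
      rwa [Fin.ext h1, Fin.ext h2]
    · intro hadj
      exact ⟨u, v, rfl, hadj⟩
  unfold adjArray
  by_cases hG : G.Adj u v
  · simp only [h, hG]
    simp
  · simp only [h, hG]
    simp

theorem flatMap_range_eq_finRange {α : Type*} (n : ℕ) (f : ℕ → List α) :
    (List.range n).flatMap f = (List.finRange n).flatMap fun v : Fin n => f v := by
  rw [← List.map_coe_finRange_eq_range, List.flatMap_map]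

/-- Running over all pairs of labels and testing for edges visits the edges in the order of
`edgeList`. -/
theorem flatMap_edgeList {α : Type*} {n : ℕ} (G : SimpleGraph (Fin n)) (f : ℕ → ℕ → List α) :
    ((List.range n).flatMap fun u => (List.range n).flatMap fun v =>
      if u < v ∧ adjArray G (u * n + v) ≠ 0 then f u v else []) =
    (QAOA.edgeList G).flatMap fun e => f e.1 e.2 := by
  classical
  have h : ∀ l : List (Fin n × Fin n),
      (l.filter fun e => e.1 < e.2 ∧ G.Adj e.1 e.2).flatMap (fun e => f e.1 e.2) =
      l.flatMap fun e => if e.1 < e.2 ∧ G.Adj e.1 e.2 then f e.1 e.2 else [] := by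
    intro l
    induction l with
    | nil => rfl
    | cons e l ih =>
      rw [List.filter_cons, List.flatMap_cons, ← ih]
      by_cases he : e.1 < e.2 ∧ G.Adj e.1 e.2
      · simp [he]
      · simp [he]
  rw [QAOA.edgeList]
  refine Eq.trans ?_ (h _).symm
  simp only [SProd.sprod, List.product, List.flatMap_assoc, List.flatMap_map,
    flatMap_range_eq_finRange, adjArray_ne_zero, Fin.val_fin_lt]

theorem runGates_levelGates {n : ℕ} (G : SimpleGraph (Fin n)) (b : ℕ) (x y : ℕ → ℕ)
    (ψ : QAOA.Bits n → ℂ) :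
    ∃ c : ℂ, ‖c‖ = 1 ∧ runGates (levelGates (adjArray G) n b x y) ψ =
      c • (QAOA.level G (bitsAngle x b) (bitsAngle y b) *ᵥ ψ) := by
  have hne : ∀ e ∈ QAOA.edgeList G, e.1 ≠ e.2 := by
    intro e he
    have := (List.mem_filter.1 he).2
    simp only [decide_eq_true_eq] at this
    exact this.1.ne
  have hn : ∀ θ : ℝ, ‖Complex.exp (Complex.I * θ)‖ = 1 := fun θ => by
    rw [mul_comm, Complex.norm_exp_ofReal_mul_I]
  refine ⟨Complex.exp (Complex.I * bitsAngle y b) ^ n *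
    Complex.exp (Complex.I * bitsAngle x b) ^ (QAOA.edgeList G).length, by simp [hn], ?_⟩
  have hmix : ∀ (l : List (Fin n)) (c : ℂ) (φ : QAOA.Bits n → ℂ),
      l.foldr (QAOA.mixStep (bitsAngle y b)) (c • φ) =
        c • l.foldr (QAOA.mixStep (bitsAngle y b)) φ := by
    intro l c φ
    induction l with
    | nil => rfl
    | cons v l ih => rw [List.foldr_cons, List.foldr_cons, ih, mixStep_smul]
  rw [levelGates, runGates_append, flatMap_edgeList, flatMap_range_eq_finRange,
    runGates_flatMap_mixGates, runGates_flatMap_edgeGates x b _ hne, hmix, smul_smul,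
    QAOA.level_mulVec, List.length_finRange]
  rfl

theorem runGates_hadamards (n : ℕ) :
    runGates ((List.range n).flatMap fun v => [Gate.hadamard v])
      (fun z : QAOA.Bits n => if z = (fun _ => false) then 1 else 0) = QAOA.plusState n := by
  have key : ∀ k ≤ n, runGates ((List.range k).flatMap fun v => [Gate.hadamard v])
      (fun z : QAOA.Bits n => if z = (fun _ => false) then (1 : ℂ) else 0) =
      fun z => if ∀ i : Fin n, k ≤ i → z i = false then (1 / (Real.sqrt 2 : ℂ)) ^ k else 0 := by
    intro k
    induction k with
    | zero =>
      intro _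
      ext z
      simp [runGates, funext_iff]
    | succ k ih =>
      intro hk
      have hk' : k < n := hk
      rw [List.range_succ, List.flatMap_append, runGates_append, ih hk'.le]
      ext z
      simp only [List.flatMap_cons, List.flatMap_nil, List.append_nil, runGates_singleton,
        Gate.act, hk', dif_pos]
      have h1 : ¬ ∀ i : Fin n, k ≤ i → Function.update z ⟨k, hk'⟩ true i = false := by
        intro h
        simpa using h ⟨k, hk'⟩ le_rfl
      have h0 : (∀ i : Fin n, k ≤ i → Function.update z ⟨k, hk'⟩ false i = false) ↔
          ∀ i : Fin n, k + 1 ≤ i → z i = false := by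
        constructor
        · intro h i hi
          have := h i (by omega)
          rwa [Function.update_of_ne (by intro h; rw [h] at hi; simp at hi)] at this
        · intro h i hi
          by_cases hik : i = ⟨k, hk'⟩
          · rw [hik, Function.update_self]
          · rw [Function.update_of_ne hik]
            refine h i ?_
            have : (i : ℕ) ≠ k := fun h => hik (Fin.ext h)
            omega
      rw [if_neg h1, mul_zero, add_zero, pow_succ]
      simp only [h0]
      split_ifs
      · rw [mul_one_div]
      · simp
  rw [key n le_rfl]
  ext z
  have h : ∀ i : Fin n, n ≤ i → z i = false := fun i hi => absurd i.isLt (by omega)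
  rw [if_pos h, QAOA.plusState, div_pow, one_pow, ← Complex.ofReal_pow]
  congr 2
  refine ((Real.sqrt_eq_iff_mul_self_eq_of_pos (by positivity)).2 ?_).symm
  rw [← mul_pow, Real.mul_self_sqrt (by norm_num)]

/-- The circuit prepares the QAOA state up to a global phase. -/
theorem circuitOutput_qaoaGates {n p : ℕ} (G : SimpleGraph (Fin n)) (b : ℕ) (x y : ℕ → ℕ) :
    ∃ c : ℂ, ‖c‖ = 1 ∧ circuitOutput n (qaoaGates (adjArray G) n b p x y) =
      c • QAOA.state G (fun q : Fin p => bitsAngle (fun l => x (q * b + l)) b)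
        (fun q : Fin p => bitsAngle (fun l => y (q * b + l)) b) := by
  have key : ∀ (l : List (Fin p)) (c : ℂ) (ψ : QAOA.Bits n → ℂ), ‖c‖ = 1 →
      ∃ c' : ℂ, ‖c'‖ = 1 ∧
      runGates (l.flatMap fun q : Fin p => levelGates (adjArray G) n b
        (fun l => x (q * b + l)) (fun l => y (q * b + l))) (c • ψ) =
      c' • l.foldl (fun ψ (q : Fin p) => QAOA.level G (bitsAngle (fun l => x (q * b + l)) b)
        (bitsAngle (fun l => y (q * b + l)) b) *ᵥ ψ) ψ := by
    intro l
    induction l with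
    | nil => exact fun c ψ hc => ⟨c, hc, rfl⟩
    | cons q l ih =>
      intro c ψ hc
      obtain ⟨d, hd, h⟩ := runGates_levelGates G b (fun l => x (q * b + l))
        (fun l => y (q * b + l)) (c • ψ)
      rw [Matrix.mulVec_smul, smul_smul] at h
      rw [List.flatMap_cons, runGates_append, h]
      exact ih _ _ (by rw [norm_mul, hc, hd, one_mul])
  obtain ⟨c, hc, h⟩ := key (List.finRange p) 1 (QAOA.plusState n) norm_one
  refine ⟨c, hc, ?_⟩
  rw [one_smul] at h
  change runGates _ _ = _
  rw [qaoaGates, runGates_append, runGates_hadamards, flatMap_range_eq_finRange, h]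
  rfl

theorem bornRule_circuitOutput_qaoaGates {n p : ℕ} (G : SimpleGraph (Fin n)) (b : ℕ)
    (x y : ℕ → ℕ) :
    bornRule (circuitOutput n (qaoaGates (adjArray G) n b p x y)) (circuitOutput_norm _ _) =
      bornRule (QAOA.state G (fun q : Fin p => bitsAngle (fun l => x (q * b + l)) b)
        (fun q : Fin p => bitsAngle (fun l => y (q * b + l)) b)) (QAOA.state_norm _ _ _) := by
  obtain ⟨c, hc, h⟩ := circuitOutput_qaoaGates (p := p) G b x y
  ext z
  simp only [bornRule, PMF.ofFintype_apply, h, Pi.smul_apply, norm_smul, hc, one_mul]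

end QMachine

/-! ### Couplings -/

/-- Two discrete distributions have a coupling that is supported in the relation `R`. -/
def PMF.Coupled {α β : Type*} (μ : PMF α) (ρ : PMF β) (R : α → β → Prop) : Prop :=
  ∃ π : PMF (α × β), π.map Prod.fst = μ ∧ π.map Prod.snd = ρ ∧ ∀ x ∈ π.support, R x.1 x.2

namespace PMF

variable {α β γ δ : Type*}

theorem bind_congr_support (μ : PMF α) {κ κ' : α → PMF β} (h : ∀ a ∈ μ.support, κ a = κ' a) :
    μ.bind κ = μ.bind κ' := by
  ext b
  simp only [PMF.bind_apply]
  refine tsum_congr fun a => ?_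
  by_cases ha : a ∈ μ.support
  · rw [h a ha]
  · rw [(PMF.apply_eq_zero_iff _ _).2 ha, zero_mul, zero_mul]

theorem map_congr_support (μ : PMF α) {f g : α → β} (h : ∀ a ∈ μ.support, f a = g a) :
    μ.map f = μ.map g := by
  unfold PMF.map
  exact bind_congr_support μ fun a ha => by simp [h a ha]

theorem uniformOfFintype_map_equiv [Fintype α] [Nonempty α] [Fintype β] [Nonempty β] (e : α ≃ β) :
    (PMF.uniformOfFintype α).map e = PMF.uniformOfFintype β := by
  classical
  ext b
  rw [PMF.map_apply, tsum_eq_single (e.symm b)]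
  · simp [Fintype.card_congr e]
  · intro a ha
    rw [if_neg]
    rintro rfl
    simp at ha

namespace Coupled

theorem pure {R : α → β → Prop} {a : α} {b : β} (h : R a b) :
    Coupled (PMF.pure a) (PMF.pure b) R := by
  refine ⟨PMF.pure (a, b), PMF.pure_map _ _, PMF.pure_map _ _, fun x hx => ?_⟩
  rw [PMF.mem_support_pure_iff] at hx
  rw [hx]
  exact h

theorem mono {μ : PMF α} {ρ : PMF β} {R R' : α → β → Prop} (h : Coupled μ ρ R)
    (hR : ∀ a, ∀ b ∈ ρ.support, R a b → R' a b) : Coupled μ ρ R' := by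
  obtain ⟨π, rfl, rfl, hπ⟩ := h
  exact ⟨π, rfl, rfl, fun x hx => hR _ _ ((PMF.mem_support_map_iff _ _ _).2 ⟨x, hx, rfl⟩) (hπ x hx)⟩

theorem bind {μ : PMF α} {ρ : PMF β} {κ : α → PMF γ} {ξ : β → PMF δ} {R : α → β → Prop}
    {R' : γ → δ → Prop} (h : Coupled μ ρ R) (hκ : ∀ a b, R a b → Coupled (κ a) (ξ b) R') :
    Coupled (μ.bind κ) (ρ.bind ξ) R' := by
  classical
  obtain ⟨π, rfl, rfl, hπ⟩ := h
  obtain ⟨x₀, hx₀⟩ := π.support_nonempty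
  have : Nonempty (PMF (γ × δ)) := ⟨(hκ _ _ (hπ x₀ hx₀)).choose⟩
  choose! η h1 h2 h3 using hκ
  refine ⟨π.bind fun x => η x.1 x.2, ?_, ?_, fun y hy => ?_⟩
  · rw [PMF.map_bind, PMF.bind_map]
    exact bind_congr_support _ fun x hx => h1 _ _ (hπ x hx)
  · rw [PMF.map_bind, PMF.bind_map]
    exact bind_congr_support _ fun x hx => h2 _ _ (hπ x hx)
  · obtain ⟨x, hx, hy⟩ := (PMF.mem_support_bind_iff _ _ _).1 hy
    exact h3 _ _ (hπ x hx) y hy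

theorem map_right (μ : PMF α) (g : α → β) : Coupled μ (μ.map g) fun a b => b = g a := by
  refine ⟨μ.map fun a => (a, g a), ?_, ?_, fun x hx => ?_⟩
  · rw [PMF.map_comp]
    exact PMF.map_id μ
  · rw [PMF.map_comp]
    rfl
  · obtain ⟨a, -, rfl⟩ := (PMF.mem_support_map_iff _ _ _).1 hx
    rfl

theorem map_left {μ : PMF α} {ρ : PMF β} {f : α → γ} {R : γ → β → Prop}
    (h : Coupled μ ρ fun a b => R (f a) b) : Coupled (μ.map f) ρ R := by
  obtain ⟨π, rfl, rfl, hπ⟩ := h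
  refine ⟨π.map fun x => (f x.1, x.2), ?_, ?_, fun x hx => ?_⟩
  · rw [PMF.map_comp, PMF.map_comp]
    rfl
  · rw [PMF.map_comp]
    rfl
  · obtain ⟨y, hy, rfl⟩ := (PMF.mem_support_map_iff _ _ _).1 hx
    exact hπ y hy

theorem of_support {ρ : PMF β} {Q : α → β → Prop} (a : α) (h : ∀ b ∈ ρ.support, Q a b) :
    Coupled (PMF.pure a) ρ Q := by
  refine ⟨ρ.map fun b => (a, b), ?_, ?_, fun x hx => ?_⟩
  · rw [PMF.map_comp]
    exact PMF.map_const ρ a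
  · rw [PMF.map_comp]
    exact PMF.map_id ρ
  · obtain ⟨b, hb, rfl⟩ := (PMF.mem_support_map_iff _ _ _).1 hx
    exact h b hb

theorem map_eq {μ : PMF α} {ρ : PMF β} {R : α → β → Prop} (h : Coupled μ ρ R) (f : β → α)
    (hf : ∀ a b, R a b → f b = a) : ρ.map f = μ := by
  obtain ⟨π, rfl, rfl, hπ⟩ := h
  rw [PMF.map_comp]
  exact map_congr_support _ fun x hx => hf _ _ (hπ x hx)

end Coupled

end PMF

/-! ### A program logic -/

namespace QMachine

/-- The program may write to array `a`. -/
def Program.Writes : Program → ℕ → Prop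
  | .assign b _ _, a => a = b
  | .run _, a => a = resultArray
  | .seq c d, a => c.Writes a ∨ d.Writes a
  | .ite _ c d, a => c.Writes a ∨ d.Writes a
  | .loop _ c, a => c.Writes a
  | _, _ => False

/-- Two memories agree on the arrays to which `c` does not write. -/
def Program.Frame (c : Program) (m m' : ℕ → ℕ → ℕ) : Prop := ∀ a, ¬ c.Writes a → m' a = m a

/-- A property that holds initially and is preserved by the body of a loop holds at its end. -/
theorem mem_support_loop {c : Program} {t : Term} {s s' : Config} (J : ℕ → Config → Prop)
    (h0 : J 0 { s with time := s.time + t.cost s.mem + 1 })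
    (hc : ∀ i < t.val s.mem, ∀ s₁, J i s₁ →
      ∀ s₂ ∈ (c.eval { s₁ with time := s₁.time + 1 }).support, J (i + 1) s₂)
    (hs : s' ∈ ((Program.loop t c).eval s).support) : J (t.val s.mem) s' := by
  rw [Program.eval] at hs
  generalize hk : t.val s.mem = k at hs hc
  clear hk
  induction k generalizing s' with
  | zero =>
    rw [Function.iterate_zero, id, PMF.mem_support_pure_iff] at hs
    rwa [hs]
  | succ k ih =>
    rw [Function.iterate_succ_apply', PMF.mem_support_bind_iff] at hs
    obtain ⟨s₁, hs₁, hs⟩ := hs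
    exact hc k (Nat.lt_succ_self k) s₁
      (ih hs₁ fun i hi => hc i (hi.trans (Nat.lt_succ_self k))) s' hs

theorem Program.frame (c : Program) (s : Config) :
    ∀ s' ∈ (c.eval s).support, c.Frame s.mem s'.mem := by
  induction c generalizing s with
  | assign b i t =>
    intro s' hs' a ha
    rw [Program.eval, PMF.mem_support_pure_iff] at hs'
    rw [hs']
    exact Function.update_of_ne ha _ _
  | hadamard i =>
    intro s' hs' a ha
    rw [Program.eval, PMF.mem_support_pure_iff] at hs'
    rw [hs']
  | cnot i j =>
    intro s' hs' a ha
    rw [Program.eval, PMF.mem_support_pure_iff] at hs'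
    rw [hs']
  | phase i j =>
    intro s' hs' a ha
    rw [Program.eval, PMF.mem_support_pure_iff] at hs'
    rw [hs']
  | run t =>
    intro s' hs' a ha
    rw [Program.eval, PMF.mem_support_map_iff] at hs'
    obtain ⟨z, -, rfl⟩ := hs'
    exact Function.update_of_ne ha _ _
  | seq c d hc hd =>
    intro s' hs' a ha
    rw [Program.eval, PMF.mem_support_bind_iff] at hs'
    obtain ⟨s₁, hs₁, hs'⟩ := hs'
    rw [hd s₁ s' hs' a fun h => ha (Or.inr h), hc s s₁ hs₁ a fun h => ha (Or.inl h)]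
  | ite t c d hc hd =>
    intro s' hs' a ha
    rw [Program.eval] at hs'
    split_ifs at hs'
    · exact hc _ s' hs' a fun h => ha (Or.inl h)
    · exact hd _ s' hs' a fun h => ha (Or.inr h)
  | loop t c hc =>
    intro s' hs' a ha
    exact mem_support_loop (fun _ s₁ => s₁.mem a = s.mem a) rfl
      (fun i _ s₁ h₁ s₂ h₂ => (hc _ s₂ h₂ a ha).trans h₁) hs'

/-- Started with memory `m` and circuit `g`, the program certainly establishes `Q`. -/
def Program.Ensures (c : Program) (m : ℕ → ℕ → ℕ) (g : List Gate)
    (Q : (ℕ → ℕ → ℕ) → List Gate → Prop) : Prop :=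
  ∀ τ, ∀ s' ∈ (c.eval ⟨m, g, τ⟩).support, Q s'.mem s'.circuit

/-- Started with memory `m` and circuit `g`, the program draws a sample from `μ`, in the sense of a
coupling: the sample and the final memory and circuit satisfy `R`. -/
def Program.Realizes {α : Type*} (c : Program) (m : ℕ → ℕ → ℕ) (g : List Gate) (μ : PMF α)
    (R : α → (ℕ → ℕ → ℕ) → List Gate → Prop) : Prop :=
  ∀ τ, μ.Coupled (c.eval ⟨m, g, τ⟩) fun a s' => R a s'.mem s'.circuit

section Rules

variable {c d : Program} {m : ℕ → ℕ → ℕ} {g : List Gate} {α β : Type*}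
  {Q Q' : (ℕ → ℕ → ℕ) → List Gate → Prop}

theorem Program.Ensures.mono (h : c.Ensures m g Q)
    (hQ : ∀ m' g', c.Frame m m' → Q m' g' → Q' m' g') : c.Ensures m g Q' :=
  fun τ s' hs' => hQ _ _ (c.frame _ s' hs') (h τ s' hs')

theorem Program.Ensures.seq (h : c.Ensures m g Q) (hd : ∀ m' g', Q m' g' → d.Ensures m' g' Q') :
    (Program.seq c d).Ensures m g Q' := by
  intro τ s' hs'
  rw [Program.eval, PMF.mem_support_bind_iff] at hs'
  obtain ⟨s₁, hs₁, hs'⟩ := hs'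
  exact hd _ _ (h τ s₁ hs₁) s₁.time s' hs'

theorem Program.Ensures.ite {t : Term} (hc : t.val m ≠ 0 → c.Ensures m g Q)
    (hd : t.val m = 0 → d.Ensures m g Q) : (Program.ite t c d).Ensures m g Q := by
  intro τ s' hs'
  rw [Program.eval] at hs'
  split_ifs at hs' with h
  · exact hc h _ s' hs'
  · exact hd (not_not.1 h) _ s' hs'

theorem Program.Ensures.assign {a : ℕ} {i t : Term}
    (h : Q (Function.update m a (Function.update (m a) (i.val m) (t.val m))) g) :
    (Program.assign a i t).Ensures m g Q := by
  intro τ s' hs'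
  rw [Program.eval, PMF.mem_support_pure_iff] at hs'
  rw [hs']
  exact h

theorem Program.Ensures.loop {t : Term} (J : ℕ → (ℕ → ℕ → ℕ) → List Gate → Prop) (h0 : J 0 m g)
    (hc : ∀ i < t.val m, ∀ m' g', J i m' g' → c.Ensures m' g' (J (i + 1))) :
    (Program.loop t c).Ensures m g (J (t.val m)) := by
  intro τ s' hs'
  exact mem_support_loop (fun i s₁ => J i s₁.mem s₁.circuit) h0
    (fun i hi s₁ h₁ s₂ h₂ => hc i hi _ _ h₁ _ s₂ h₂) hs'

theorem Program.Ensures.realizes (h : c.Ensures m g Q) (a : α) :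
    c.Realizes m g (PMF.pure a) fun a' m' g' => Q m' g' ∧ a' = a := by
  intro τ
  exact PMF.Coupled.of_support a fun s' hs' => ⟨h τ s' hs', rfl⟩

theorem Program.Realizes.mono {μ : PMF α} {R R' : α → (ℕ → ℕ → ℕ) → List Gate → Prop}
    (h : c.Realizes m g μ R) (hR : ∀ a m' g', c.Frame m m' → R a m' g' → R' a m' g') :
    c.Realizes m g μ R' :=
  fun τ => (h τ).mono fun a s' hs' => hR a _ _ (c.frame _ s' hs')

theorem Program.Realizes.seq {μ : PMF α} {κ : α → PMF β}
    {R : α → (ℕ → ℕ → ℕ) → List Gate → Prop} {R' : β → (ℕ → ℕ → ℕ) → List Gate → Prop}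
    (h : c.Realizes m g μ R) (hd : ∀ a m' g', R a m' g' → d.Realizes m' g' (κ a) R') :
    (Program.seq c d).Realizes m g (μ.bind κ) R' := by
  intro τ
  rw [Program.eval]
  exact (h τ).bind fun a s' hs' => hd a _ _ hs' s'.time

theorem Program.Realizes.seq_ensures {μ : PMF α} {R R' : α → (ℕ → ℕ → ℕ) → List Gate → Prop}
    (h : c.Realizes m g μ R) (hd : ∀ a m' g', R a m' g' → d.Ensures m' g' (R' a)) :
    (Program.seq c d).Realizes m g μ R' := by
  rw [← μ.bind_pure]
  refine h.seq fun a m' g' hR => ((hd a m' g' hR).realizes a).mono fun a' m'' g'' _ h => ?_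
  rw [h.2]
  exact h.1

theorem Program.Ensures.seq_realizes {μ : PMF α} {R : α → (ℕ → ℕ → ℕ) → List Gate → Prop}
    (h : c.Ensures m g Q) (hd : ∀ m' g', Q m' g' → d.Realizes m' g' μ R) :
    (Program.seq c d).Realizes m g μ R := by
  rw [← PMF.pure_bind () fun _ => μ]
  exact (h.realizes ()).seq fun a m' g' hQ => hd m' g' hQ.1

/-- The loop rule: if the `i`-th execution of the body takes a sample from `μ i` to one from
`μ (i + 1)` and maintains the invariant `J`, then the loop draws from the last `μ i`. -/
theorem Program.Realizes.loop {t : Term} {A : ℕ → Type*} (μ : ∀ i, PMF (A i))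
    (K : ∀ i, A i → PMF (A (i + 1))) (hμ : ∀ i, μ (i + 1) = (μ i).bind (K i))
    (J : ∀ i, A i → (ℕ → ℕ → ℕ) → List Gate → Prop) (a : A 0) (ha : μ 0 = PMF.pure a)
    (h0 : J 0 a m g)
    (hc : ∀ i < t.val m, ∀ a m' g', J i a m' g' → c.Realizes m' g' (K i a) (J (i + 1))) :
    (Program.loop t c).Realizes m g (μ (t.val m)) (J (t.val m)) := by
  intro τ
  rw [Program.eval]
  simp only
  generalize t.val m = k at hc
  induction k with
  | zero =>
    rw [ha]
    exact PMF.Coupled.pure h0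
  | succ k ih =>
    rw [Function.iterate_succ_apply', hμ]
    exact (ih fun i hi => hc i (hi.trans (Nat.lt_succ_self k))).bind fun a s' hs' =>
      hc k (Nat.lt_succ_self k) a _ _ hs' _

end Rules

/-! ### Counting loops -/

/-- The variable that is stored as entry `0` of array `x`. -/
def var (x : ℕ) : Term := .get x (.const 0)

/-- The command that does nothing. -/
def skip : Program := .loop (.const 0) (.hadamard (.const 0))

/-- Increase a variable by one. -/
def incr (x : ℕ) : Program := .assign x (.const 0) (.add (var x) (.const 1))

/-- Execute `c` for the values `0, 1, …, t - 1` of the variable `x`. -/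
def forLoop (x : ℕ) (t : Term) (c : Program) : Program :=
  .seq (.assign x (.const 0) (.const 0)) (.loop t (.seq c (incr x)))

/-- The memory after setting a variable. -/
def setVar (m : ℕ → ℕ → ℕ) (x v : ℕ) : ℕ → ℕ → ℕ :=
  Function.update m x (Function.update (m x) 0 v)

theorem setVar_self (m : ℕ → ℕ → ℕ) (x v : ℕ) : setVar m x v x 0 = v := by simp [setVar]

theorem setVar_of_ne (m : ℕ → ℕ → ℕ) {x a : ℕ} (v : ℕ) (h : a ≠ x) : setVar m x v a = m a :=
  Function.update_of_ne h _ _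

theorem ensures_skip {m : ℕ → ℕ → ℕ} {g : List Gate} {Q : (ℕ → ℕ → ℕ) → List Gate → Prop}
    (h : Q m g) : skip.Ensures m g Q :=
  Program.Ensures.loop (fun _ => Q) h fun i hi => absurd hi (Nat.not_lt_zero i)

theorem ensures_incr {m : ℕ → ℕ → ℕ} {g : List Gate} {Q : (ℕ → ℕ → ℕ) → List Gate → Prop} {x : ℕ}
    (h : Q (setVar m x (m x 0 + 1)) g) : (incr x).Ensures m g Q :=
  Program.Ensures.assign h

theorem ensures_forLoop {c : Program} {m : ℕ → ℕ → ℕ} {g : List Gate} {x k : ℕ} {t : Term}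
    (J : ℕ → (ℕ → ℕ → ℕ) → List Gate → Prop) (hk : t.val (setVar m x 0) = k)
    (h0 : J 0 (setVar m x 0) g)
    (hc : ∀ i < k, ∀ m' g', J i m' g' →
      c.Ensures m' g' fun m'' g'' => J (i + 1) (setVar m'' x (m'' x 0 + 1)) g'') :
    (forLoop x t c).Ensures m g (J k) := by
  subst hk
  refine Program.Ensures.seq (Q := fun m' g' => m' = setVar m x 0 ∧ g' = g)
    (Program.Ensures.assign ⟨rfl, rfl⟩) ?_
  rintro _ _ ⟨rfl, rfl⟩
  exact Program.Ensures.loop J h0 fun i hi m' g' h =>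
    (hc i hi m' g' h).seq fun m'' g'' h' => ensures_incr h'

theorem realizes_forLoop {c : Program} {m : ℕ → ℕ → ℕ} {g : List Gate} {x k : ℕ} {t : Term}
    {A : ℕ → Type*} (μ : ∀ i, PMF (A i)) (K : ∀ i, A i → PMF (A (i + 1)))
    (hμ : ∀ i, μ (i + 1) = (μ i).bind (K i))
    (J : ∀ i, A i → (ℕ → ℕ → ℕ) → List Gate → Prop) (hk : t.val (setVar m x 0) = k)
    (a : A 0) (ha : μ 0 = PMF.pure a) (h0 : J 0 a (setVar m x 0) g)
    (hc : ∀ i < k, ∀ a m' g', J i a m' g' →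
      c.Realizes m' g' (K i a) fun a' m'' g'' => J (i + 1) a' (setVar m'' x (m'' x 0 + 1)) g'') :
    (forLoop x t c).Realizes m g (μ k) (J k) := by
  subst hk
  refine Program.Ensures.seq_realizes (Q := fun m' g' => m' = setVar m x 0 ∧ g' = g)
    (Program.Ensures.assign ⟨rfl, rfl⟩) ?_
  rintro _ _ ⟨rfl, rfl⟩
  exact Program.Realizes.loop μ K hμ J a ha h0 fun i hi a m' g' h =>
    (hc i hi a m' g' h).seq_ensures fun a' m'' g'' h' => ensures_incr h'

/-- The program appends the gates `l` to the circuit. -/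
def Program.Emits (c : Program) (m : ℕ → ℕ → ℕ) (l : List Gate) : Prop :=
  ∀ g, c.Ensures m g fun _ g' => g' = g ++ l

theorem emits_hadamard (m : ℕ → ℕ → ℕ) (i : Term) :
    (Program.hadamard i).Emits m [Gate.hadamard (i.val m)] := by
  intro g τ s' hs'
  rw [Program.eval, PMF.mem_support_pure_iff] at hs'
  rw [hs']

theorem emits_cnot (m : ℕ → ℕ → ℕ) (i j : Term) :
    (Program.cnot i j).Emits m [Gate.cnot (i.val m) (j.val m)] := by
  intro g τ s' hs'
  rw [Program.eval, PMF.mem_support_pure_iff] at hs'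
  rw [hs']

theorem emits_phase (m : ℕ → ℕ → ℕ) (i j : Term) :
    (Program.phase i j).Emits m [Gate.phase (i.val m) (j.val m)] := by
  intro g τ s' hs'
  rw [Program.eval, PMF.mem_support_pure_iff] at hs'
  rw [hs']

theorem emits_skip (m : ℕ → ℕ → ℕ) : skip.Emits m [] :=
  fun g => ensures_skip (List.append_nil g).symm

theorem Program.Emits.seq {c d : Program} {m : ℕ → ℕ → ℕ} {l l' : List Gate} (hc : c.Emits m l)
    (hd : ∀ m', c.Frame m m' → d.Emits m' l') : (Program.seq c d).Emits m (l ++ l') := by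
  intro g
  refine ((hc g).mono (Q' := fun m' g' => c.Frame m m' ∧ g' = g ++ l)
    fun m' g' hf h => ⟨hf, h⟩).seq ?_
  rintro m' _ ⟨hf, rfl⟩
  refine (hd m' hf _).mono fun m'' g'' _ h => ?_
  rw [h, List.append_assoc]

theorem Program.Emits.ite {c d : Program} {m : ℕ → ℕ → ℕ} {l l' : List Gate} {t : Term}
    {p : Prop} [Decidable p] (hp : t.val m ≠ 0 ↔ p) (hc : c.Emits m l) (hd : d.Emits m l') :
    (Program.ite t c d).Emits m (if p then l else l') := by
  intro g
  refine Program.Ensures.ite (fun h => ?_) fun h => ?_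
  · rw [if_pos (hp.1 h)]
    exact hc g
  · rw [if_neg fun h' => hp.2 h' h]
    exact hd g

/-- A memory that arises from `m` during the execution of a counting loop over `c`, with the value
`i` of the counter. -/
def LoopFrame (c : Program) (x : ℕ) (m : ℕ → ℕ → ℕ) (i : ℕ) (m' : ℕ → ℕ → ℕ) : Prop :=
  (∀ a, ¬ c.Writes a → a ≠ x → m' a = m a) ∧ m' x 0 = i

theorem LoopFrame.zero (c : Program) (x : ℕ) (m : ℕ → ℕ → ℕ) :
    LoopFrame c x m 0 (setVar m x 0) :=
  ⟨fun _ _ ha => setVar_of_ne m 0 ha, setVar_self m x 0⟩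

theorem LoopFrame.succ {c : Program} {x : ℕ} {m m' m'' : ℕ → ℕ → ℕ} {i : ℕ}
    (hx : ¬ c.Writes x) (h : LoopFrame c x m i m') (hf : c.Frame m' m'') :
    LoopFrame c x m (i + 1) (setVar m'' x (m'' x 0 + 1)) := by
  refine ⟨fun a ha hax => ?_, ?_⟩
  · rw [setVar_of_ne _ _ hax, hf a ha, h.1 a ha hax]
  · rw [setVar_self, hf x hx, h.2]

theorem Program.Emits.forLoop {c : Program} {m : ℕ → ℕ → ℕ} {x k : ℕ} {t : Term}
    {f : ℕ → List Gate} (hx : ¬ c.Writes x) (hk : t.val (setVar m x 0) = k)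
    (hc : ∀ i < k, ∀ m', LoopFrame c x m i m' → c.Emits m' (f i)) :
    (forLoop x t c).Emits m ((List.range k).flatMap f) := by
  intro g
  refine (ensures_forLoop (fun i m' g' => LoopFrame c x m i m' ∧
    g' = g ++ (List.range i).flatMap f) hk ⟨LoopFrame.zero c x m, by simp⟩ ?_).mono
    fun _ _ _ h => h.2
  rintro i hi m' _ ⟨h, rfl⟩
  refine (hc i hi m' h _).mono ?_
  rintro m'' _ hf rfl
  refine ⟨h.succ hx hf, ?_⟩
  simp [List.range_succ, List.append_assoc]

/-- The program adds `k` to the variable `y` and leaves the circuit unchanged. -/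
def Program.Adds (c : Program) (y : ℕ) (m : ℕ → ℕ → ℕ) (k : ℕ) : Prop :=
  ∀ g, c.Ensures m g fun m' g' => g' = g ∧ m' y 0 = m y 0 + k

theorem adds_skip (y : ℕ) (m : ℕ → ℕ → ℕ) : skip.Adds y m 0 :=
  fun _ => ensures_skip ⟨rfl, rfl⟩

theorem adds_incr (y : ℕ) (m : ℕ → ℕ → ℕ) : (incr y).Adds y m 1 :=
  fun _ => ensures_incr ⟨rfl, setVar_self _ _ _⟩

theorem Program.Adds.ite {c d : Program} {y : ℕ} {m : ℕ → ℕ → ℕ} {k k' : ℕ} {t : Term}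
    {p : Prop} [Decidable p] (hp : t.val m ≠ 0 ↔ p) (hc : c.Adds y m k) (hd : d.Adds y m k') :
    (Program.ite t c d).Adds y m (if p then k else k') := by
  intro g
  refine Program.Ensures.ite (fun h => ?_) fun h => ?_
  · rw [if_pos (hp.1 h)]
    exact hc g
  · rw [if_neg fun h' => hp.2 h' h]
    exact hd g

theorem Program.Adds.forLoop {c : Program} {y : ℕ} {m : ℕ → ℕ → ℕ} {x k : ℕ} {t : Term}
    {f : ℕ → ℕ} (hxy : y ≠ x) (hx : ¬ c.Writes x) (hk : t.val (setVar m x 0) = k)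
    (hc : ∀ i < k, ∀ m', LoopFrame c x m i m' → c.Adds y m' (f i)) :
    (forLoop x t c).Adds y m (∑ i ∈ Finset.range k, f i) := by
  intro g
  refine (ensures_forLoop (fun i m' g' => LoopFrame c x m i m' ∧
    g' = g ∧ m' y 0 = m y 0 + ∑ j ∈ Finset.range i, f j) hk
    ⟨LoopFrame.zero c x m, rfl, by rw [setVar_of_ne _ _ hxy]; simp⟩ ?_).mono
    fun _ _ _ h => h.2
  rintro i hi m' _ ⟨h, rfl, hy⟩
  refine (hc i hi m' h _).mono ?_
  rintro m'' _ hf ⟨rfl, hy'⟩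
  refine ⟨h.succ hx hf, rfl, ?_⟩
  rw [setVar_of_ne _ _ hxy, hy', hy, Finset.sum_range_succ, add_assoc]

end QMachine

/-! ### Polynomial running time -/

namespace QMachine

open Polynomial in
theorem eval_le_eval (p : ℕ[X]) {a b : ℕ} (h : a ≤ b) : p.eval a ≤ p.eval b := by
  induction p using Polynomial.induction_on' with
  | add p q hp hq => simpa using add_le_add hp hq
  | monomial n c =>
    simp only [Polynomial.eval_monomial]
    exact Nat.mul_le_mul_left _ (Nat.pow_le_pow_left h n)

theorem size_le_self (k : ℕ) : Nat.size k ≤ k := Nat.size_le.2 Nat.lt_two_pow_self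

/-- All entries of the memory are at most `B`. -/
def MemBound (m : ℕ → ℕ → ℕ) (B : ℕ) : Prop := ∀ a i, m a i ≤ B

theorem Term.exists_bound (t : Term) : ∃ W : Polynomial ℕ, ∀ m B, MemBound m B →
    t.val m ≤ W.eval B ∧ t.cost m ≤ W.eval B := by
  induction t with
  | const k =>
    refine ⟨Polynomial.C (1 + k), fun m B _ => ?_⟩
    have := size_le_self k
    simp only [Term.val, Term.cost, Polynomial.eval_C]
    omega
  | get a i hi =>
    obtain ⟨W, hW⟩ := hi
    refine ⟨2 * W + 1 + Polynomial.X, fun m B hm => ?_⟩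
    obtain ⟨h1, h2⟩ := hW m B hm
    have h3 := hm a (i.val m)
    have h4 := size_le_self (i.val m)
    have h5 := size_le_self (m a (i.val m))
    simp only [Term.val, Term.cost, Polynomial.eval_add, Polynomial.eval_mul, Polynomial.eval_one,
      Polynomial.eval_X, Polynomial.eval_ofNat]
    omega
  | add s t hs ht =>
    obtain ⟨W, hW⟩ := hs
    obtain ⟨W', hW'⟩ := ht
    refine ⟨3 * W + 3 * W' + 1, fun m B hm => ?_⟩
    obtain ⟨h1, h2⟩ := hW m B hm
    obtain ⟨h3, h4⟩ := hW' m B hm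
    have h5 := size_le_self (s.val m)
    have h6 := size_le_self (t.val m)
    have h7 := size_le_self (s.val m + t.val m)
    simp only [Term.val, Term.cost, Polynomial.eval_add, Polynomial.eval_mul, Polynomial.eval_one,
      Polynomial.eval_ofNat]
    omega
  | sub s t hs ht =>
    obtain ⟨W, hW⟩ := hs
    obtain ⟨W', hW'⟩ := ht
    refine ⟨3 * W + 3 * W' + 1, fun m B hm => ?_⟩
    obtain ⟨h1, h2⟩ := hW m B hm
    obtain ⟨h3, h4⟩ := hW' m B hm
    have h5 := size_le_self (s.val m)
    have h6 := size_le_self (t.val m)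
    have h7 := size_le_self (s.val m - t.val m)
    simp only [Term.val, Term.cost, Polynomial.eval_add, Polynomial.eval_mul, Polynomial.eval_one,
      Polynomial.eval_ofNat]
    omega
  | mul s t hs ht =>
    obtain ⟨W, hW⟩ := hs
    obtain ⟨W', hW'⟩ := ht
    refine ⟨2 * W + 2 * W' + 1 + W * W', fun m B hm => ?_⟩
    obtain ⟨h1, h2⟩ := hW m B hm
    obtain ⟨h3, h4⟩ := hW' m B hm
    have h5 := size_le_self (s.val m)
    have h6 := size_le_self (t.val m)
    have h7 := size_le_self (s.val m * t.val m)
    have h8 := Nat.mul_le_mul h1 h3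
    simp only [Term.val, Term.cost, Polynomial.eval_add, Polynomial.eval_mul, Polynomial.eval_one,
      Polynomial.eval_ofNat]
    omega
  | lt s t hs ht =>
    obtain ⟨W, hW⟩ := hs
    obtain ⟨W', hW'⟩ := ht
    refine ⟨2 * W + 2 * W' + 2, fun m B hm => ?_⟩
    obtain ⟨h1, h2⟩ := hW m B hm
    obtain ⟨h3, h4⟩ := hW' m B hm
    have h5 := size_le_self (s.val m)
    have h6 := size_le_self (t.val m)
    simp only [Term.val, Term.cost, Polynomial.eval_add, Polynomial.eval_mul,
      Polynomial.eval_ofNat]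
    refine ⟨?_, by omega⟩
    split_ifs <;> omega

/-- A syntactic condition for polynomial running time: the input size is never overwritten, an
assignment increases the largest memory entry at most by a constant, and the number of executions
of every loop body is bounded by a polynomial in the input size. -/
def Program.Tame : Program → Prop
  | .assign a _ t => a ≠ 0 ∧ ∃ d, ∀ m B, MemBound m B → t.val m ≤ B + d
  | .seq c d => c.Tame ∧ d.Tame
  | .ite _ c d => c.Tame ∧ d.Tame
  | .loop t c => (∃ p : Polynomial ℕ, ∀ m, t.val m ≤ p.eval (m 0 0)) ∧ c.Tame
  | _ => True

/-- The effect of a tame program: the largest memory entry grows at most by a polynomial in the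
input size, and the cost is polynomial in the largest entry. Keeping the two bounds apart is what
makes the induction pass through loops. -/
theorem Program.Tame.exists_bound {c : Program} (hc : c.Tame) :
    ∃ G T : Polynomial ℕ, ∀ (B : ℕ) (s : Config), 1 ≤ B → MemBound s.mem B →
      ∀ s' ∈ (c.eval s).support, s'.mem 0 0 = s.mem 0 0 ∧
        MemBound s'.mem (B + G.eval (s.mem 0 0)) ∧ s'.time ≤ s.time + T.eval B := by
  induction c with
  | assign a i t =>
    obtain ⟨ha, d, hd⟩ := hc
    obtain ⟨W, hW⟩ := i.exists_bound
    obtain ⟨W', hW'⟩ := t.exists_bound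
    refine ⟨Polynomial.C d, 2 * W + 2 * W' + 1, fun B s _ hm s' hs' => ?_⟩
    rw [Program.eval, PMF.mem_support_pure_iff] at hs'
    obtain ⟨h1, h2⟩ := hW s.mem B hm
    obtain ⟨h3, h4⟩ := hW' s.mem B hm
    have h5 := size_le_self (i.val s.mem)
    have h6 := size_le_self (t.val s.mem)
    rw [hs']
    dsimp only
    refine ⟨by rw [Function.update_of_ne ha.symm], fun b j => ?_, ?_⟩
    · rw [Polynomial.eval_C]
      by_cases hb : b = a
      · subst hb
        rw [Function.update_self]
        by_cases hj : j = i.val s.mem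
        · subst hj
          rw [Function.update_self]
          exact hd _ _ hm
        · rw [Function.update_of_ne hj]
          exact (hm b j).trans (Nat.le_add_right _ _)
      · rw [Function.update_of_ne hb]
        exact (hm b j).trans (Nat.le_add_right _ _)
    · simp only [Polynomial.eval_add, Polynomial.eval_mul, Polynomial.eval_one,
        Polynomial.eval_ofNat]
      omega
  | hadamard i =>
    obtain ⟨W, hW⟩ := i.exists_bound
    refine ⟨0, W + 1, fun B s _ hm s' hs' => ?_⟩
    rw [Program.eval, PMF.mem_support_pure_iff] at hs'
    obtain ⟨h1, h2⟩ := hW s.mem B hm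
    rw [hs']
    refine ⟨rfl, by simpa using hm, ?_⟩
    simp only [Polynomial.eval_add, Polynomial.eval_one]
    omega
  | cnot i j =>
    obtain ⟨W, hW⟩ := i.exists_bound
    obtain ⟨W', hW'⟩ := j.exists_bound
    refine ⟨0, W + W' + 1, fun B s _ hm s' hs' => ?_⟩
    rw [Program.eval, PMF.mem_support_pure_iff] at hs'
    obtain ⟨h1, h2⟩ := hW s.mem B hm
    obtain ⟨h3, h4⟩ := hW' s.mem B hm
    rw [hs']
    refine ⟨rfl, by simpa using hm, ?_⟩
    simp only [Polynomial.eval_add, Polynomial.eval_one]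
    omega
  | phase k i =>
    obtain ⟨W, hW⟩ := k.exists_bound
    obtain ⟨W', hW'⟩ := i.exists_bound
    refine ⟨0, 2 * W + W' + 1, fun B s _ hm s' hs' => ?_⟩
    rw [Program.eval, PMF.mem_support_pure_iff] at hs'
    obtain ⟨h1, h2⟩ := hW s.mem B hm
    obtain ⟨h3, h4⟩ := hW' s.mem B hm
    rw [hs']
    refine ⟨rfl, by simpa using hm, ?_⟩
    simp only [Polynomial.eval_add, Polynomial.eval_mul, Polynomial.eval_one,
      Polynomial.eval_ofNat]
    omega
  | run t =>
    obtain ⟨W, hW⟩ := t.exists_bound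
    refine ⟨0, 2 * W + 1, fun B s hB hm s' hs' => ?_⟩
    rw [Program.eval, PMF.mem_support_map_iff] at hs'
    obtain ⟨z, -, rfl⟩ := hs'
    obtain ⟨h1, h2⟩ := hW s.mem B hm
    dsimp only
    refine ⟨by rw [Function.update_of_ne (by decide)], fun b j => ?_, ?_⟩
    · rw [Polynomial.eval_zero, add_zero]
      by_cases hb : b = resultArray
      · subst hb
        rw [Function.update_self, bitsToArray]
        split_ifs
        · exact (Bool.toNat_le _).trans hB
        · exact Nat.zero_le _
      · rw [Function.update_of_ne hb]
        exact hm b j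
    · simp only [Polynomial.eval_add, Polynomial.eval_mul, Polynomial.eval_one,
        Polynomial.eval_ofNat]
      omega
  | seq c d hc' hd' =>
    obtain ⟨G, T, h⟩ := hc' hc.1
    obtain ⟨G', T', h'⟩ := hd' hc.2
    refine ⟨G + G', T + T'.comp (Polynomial.X + G), fun B s hB hm s' hs' => ?_⟩
    rw [Program.eval, PMF.mem_support_bind_iff] at hs'
    obtain ⟨s₁, hs₁, hs'⟩ := hs'
    obtain ⟨h1, h2, h3⟩ := h B s hB hm s₁ hs₁
    obtain ⟨h4, h5, h6⟩ := h' _ s₁ (hB.trans (Nat.le_add_right _ _)) h2 s' hs'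
    refine ⟨h4.trans h1, ?_, ?_⟩
    · rw [Polynomial.eval_add, ← add_assoc]
      rwa [h1] at h5
    · have h7 := eval_le_eval G (hm 0 0)
      have h8 := eval_le_eval T' (Nat.add_le_add_left h7 B)
      simp only [Polynomial.eval_add, Polynomial.eval_comp, Polynomial.eval_X]
      omega
  | ite t c d hc' hd' =>
    obtain ⟨G, T, h⟩ := hc' hc.1
    obtain ⟨G', T', h'⟩ := hd' hc.2
    obtain ⟨W, hW⟩ := t.exists_bound
    refine ⟨G + G', T + T' + W + 1, fun B s hB hm s' hs' => ?_⟩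
    obtain ⟨-, h0⟩ := hW s.mem B hm
    rw [Program.eval] at hs'
    simp only [Polynomial.eval_add, Polynomial.eval_one]
    split_ifs at hs'
    · obtain ⟨h1, h2, h3⟩ := h B { s with time := s.time + t.cost s.mem + 1 } hB hm s' hs'
      simp only at h1 h2 h3
      exact ⟨h1, fun a i => (h2 a i).trans (by omega), by omega⟩
    · obtain ⟨h1, h2, h3⟩ := h' B { s with time := s.time + t.cost s.mem + 1 } hB hm s' hs'
      simp only at h1 h2 h3
      exact ⟨h1, fun a i => (h2 a i).trans (by omega), by omega⟩
  | loop t c hc' =>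
    obtain ⟨⟨p, hp⟩, hct⟩ := hc
    obtain ⟨G, T, h⟩ := hc' hct
    obtain ⟨W, hW⟩ := t.exists_bound
    refine ⟨p * G, W + 1 + p * (1 + T.comp (Polynomial.X + p * G)), fun B s hB hm s' hs' => ?_⟩
    obtain ⟨-, h0⟩ := hW s.mem B hm
    set n := s.mem 0 0 with hn
    set S := 1 + T.eval (B + p.eval B * G.eval B) with hS
    have hnB : n ≤ B := hm 0 0
    have hpn := eval_le_eval p hnB
    have hGn := eval_le_eval G hnB
    have key := mem_support_loop (s' := s') (fun i s₁ => s₁.mem 0 0 = n ∧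
      MemBound s₁.mem (B + i * G.eval n) ∧
      s₁.time ≤ s.time + t.cost s.mem + 1 + i * S)
      ⟨rfl, by simpa using hm, by simp⟩ ?_ hs'
    · obtain ⟨h1, h2, h3⟩ := key
      have hk := hp s.mem
      refine ⟨h1, fun a i => (h2 a i).trans ?_, h3.trans ?_⟩
      · rw [Polynomial.eval_mul]
        exact Nat.add_le_add_left (Nat.mul_le_mul_right _ hk) _
      · have h4 : t.val s.mem * S ≤ p.eval B * S := Nat.mul_le_mul_right _ (hk.trans hpn)
        simp only [Polynomial.eval_add, Polynomial.eval_mul, Polynomial.eval_one,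
          Polynomial.eval_comp, Polynomial.eval_X]
        rw [← hS]
        omega
    · rintro i hi s₁ ⟨h1, h2, h3⟩ s₂ hs₂
      obtain ⟨h4, h5, h6⟩ := h (B + i * G.eval n) { s₁ with time := s₁.time + 1 }
        (hB.trans (Nat.le_add_right _ _)) h2 s₂ hs₂
      simp only at h4 h5 h6
      rw [h1] at h4 h5
      refine ⟨h4, ?_, ?_⟩
      · rwa [add_mul, one_mul, ← add_assoc]
      · have h7 : i * G.eval n ≤ p.eval B * G.eval B :=
          Nat.mul_le_mul (hi.le.trans ((hp s.mem).trans hpn)) hGn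
        have h8 := eval_le_eval T (Nat.add_le_add_left h7 B)
        rw [add_mul, one_mul]
        omega

theorem Program.Tame.polyTime {c : Program} (hc : c.Tame) : c.PolyTime := by
  obtain ⟨G, T, h⟩ := hc.exists_bound
  refine ⟨T.comp (Polynomial.X + 1), fun n G₁ G₂ s hs => ?_⟩
  have hm : MemBound (inputConfig G₁ G₂).mem (n + 1) := by
    intro a i
    match a with
    | 0 => simp only [inputConfig]; split_ifs <;> omega
    | 1 => simp only [inputConfig, adjArray]; split_ifs <;> omega
    | 2 => simp only [inputConfig, adjArray]; split_ifs <;> omega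
    | a + 3 => simp [inputConfig]
  obtain ⟨-, -, h3⟩ := h (n + 1) _ (Nat.le_add_left 1 n) hm s hs
  simpa [inputConfig] using h3

end QMachine

/-! ### The program -/

namespace QMachine

/-- The bits of the angles `γ`. -/
abbrev gammaArray : ℕ := 5
/-- The bits of the angles `β`. -/
abbrev betaArray : ℕ := 6
/-- The number of QAOA levels. -/
abbrev depthVar : ℕ := 7
/-- The number of random bits drawn so far. -/
abbrev drawVar : ℕ := 8
/-- The current QAOA level. -/
abbrev levelVar : ℕ := 9
/-- The current bit of an angle. -/
abbrev bitVar : ℕ := 10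
/-- The first vertex of the current pair. -/
abbrev fstVar : ℕ := 11
/-- The second vertex of the current pair. -/
abbrev sndVar : ℕ := 12
/-- The sum of the measured values for the first graph. -/
abbrev sumVar₁ : ℕ := 13
/-- The sum of the measured values for the second graph. -/
abbrev sumVar₂ : ℕ := 14

/-- Does the graph in array `G` have an edge from the first to the second vertex of the current
pair, in this order? -/
def edgeTest (G : ℕ) : Term :=
  .mul (.lt (var fstVar) (var sndVar)) (.get G (.add (.mul (var fstVar) (var 0)) (var sndVar)))

/-- Emit phase gates for the bits of the angle of the current level that is stored in array `x`. -/
def phaseProgram (tb : Term) (x s : ℕ) : Program :=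
  forLoop bitVar tb
    (.ite (.get x (.add (.mul (var levelVar) tb) (var bitVar)))
      (.phase (.sub (.sub tb (var bitVar)) (.const s)) (var sndVar)) skip)

/-- Emit the circuit for a QAOA level. -/
def levelProgram (tb : Term) (G : ℕ) : Program :=
  .seq
    (forLoop fstVar (var 0) (forLoop sndVar (var 0)
      (.ite (edgeTest G)
        (.seq (.cnot (var fstVar) (var sndVar))
          (.seq (phaseProgram tb gammaArray 0) (.cnot (var fstVar) (var sndVar)))) skip)))
    (forLoop sndVar (var 0)
      (.seq (.hadamard (var sndVar))
        (.seq (phaseProgram tb betaArray 1) (.hadamard (var sndVar)))))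

/-- The number of levels, cut off at `tL` so that the bound on the number of executions of a loop is
visible from its syntax. -/
def depthTerm (tL : Term) : Term := .sub (var depthVar) (.sub (var depthVar) tL)

/-- Emit the QAOA circuit. -/
def circuitProgram (tL tb : Term) (G : ℕ) : Program :=
  .seq (forLoop sndVar (var 0) (.hadamard (var sndVar)))
    (forLoop levelVar (depthTerm tL) (levelProgram tb G))

/-- Add to the variable `y` the number of edges that the last measurement result does not cut. -/
def uncutProgram (G y : ℕ) : Program :=
  forLoop fstVar (var 0) (forLoop sndVar (var 0)
    (.ite (edgeTest G)
      (.ite (.add (.lt (.get resultArray (var fstVar)) (.get resultArray (var sndVar)))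
          (.lt (.get resultArray (var sndVar)) (.get resultArray (var fstVar)))) skip (incr y))
      skip))

/-- Prepare and measure the QAOA state, and add the value of the outcome to the variable `y`. -/
def shotProgram (tL tb : Term) (G y : ℕ) : Program :=
  .seq (circuitProgram tL tb G) (.seq (.run (var 0)) (uncutProgram G y))

/-- Sum the values of `tN` shots in the variable `y`. -/
def sumProgram (tL tb tN : Term) (G y : ℕ) : Program :=
  .seq (.assign y (.const 0) (.const 0)) (.loop tN (shotProgram tL tb G y))

/-- Fill array `x` with the random bits of one angle for each level. -/
def drawProgram (tL tb : Term) (x : ℕ) : Program :=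
  forLoop drawVar (.mul (depthTerm tL) tb)
    (.seq (.hadamard (.const 0))
      (.seq (.run (.const 1)) (.assign x (var drawVar) (.get resultArray (.const 0)))))

/-- Are the sums of the measured values further apart than `tN / tD`? -/
def differTest (tN tD : Term) : Term :=
  .add (.lt tN (.mul tD (.sub (var sumVar₁) (var sumVar₂))))
    (.lt tN (.mul tD (.sub (var sumVar₂) (var sumVar₁))))

/-- One round of the energy comparison. -/
def roundProgram (tL tb tN tD : Term) : Program :=
  .seq (drawProgram tL tb gammaArray)
    (.seq (drawProgram tL tb betaArray)
      (.seq (sumProgram tL tb tN 1 sumVar₁)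
        (.seq (sumProgram tL tb tN 2 sumVar₂)
          (.ite (differTest tN tD) (.assign answerArray (.const 0) (.const 0)) skip))))

/-- The energy comparison. -/
def comparisonProgram (tL tM tb tN tD : Term) : Program :=
  .seq (.assign answerArray (.const 0) (.const 1))
    (forLoop depthVar (.add tL (.const 1)) (.loop tM (roundProgram tL tb tN tD)))

/-! ### Emission of the circuit -/

section Correctness

variable {n b L : ℕ} {tb tL : Term}

theorem emits_phaseProgram (hb : ∀ m, m 0 0 = n → tb.val m = b) {m : ℕ → ℕ → ℕ} (hn : m 0 0 = n)
    (x s : ℕ) (hx : x ≠ bitVar) :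
    (phaseProgram tb x s).Emits m
      (phaseGates (fun l => m x (m levelVar 0 * b + l)) b s (m sndVar 0)) := by
  refine Program.Emits.forLoop (by simp [Program.Writes, skip])
    (hb _ (by rw [setVar_of_ne _ _ (by decide), hn])) fun i hi m' hm' => ?_
  have hw : ∀ a, a ≠ bitVar → m' a = m a := fun a ha =>
    hm'.1 a (by simp [Program.Writes, skip]) ha
  have hbm : tb.val m' = b := hb _ (by rw [hw 0 (by decide), hn])
  refine Program.Emits.ite ?_ ?_ (emits_skip m')
  · simp only [Term.val, var, hbm, hw x hx, hw levelVar (by decide), hm'.2]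
  · have := emits_phase m' (.sub (.sub tb (var bitVar)) (.const s)) (var sndVar)
    simp only [Term.val, var, hbm, hw sndVar (by decide), hm'.2] at this
    exact this

theorem emits_levelProgram (hb : ∀ m, m 0 0 = n → tb.val m = b) {m : ℕ → ℕ → ℕ} (hn : m 0 0 = n)
    (G : ℕ) (hG : G = 1 ∨ G = 2) :
    (levelProgram tb G).Emits m (levelGates (m G) n b
      (fun l => m gammaArray (m levelVar 0 * b + l))
      (fun l => m betaArray (m levelVar 0 * b + l))) := by
  refine Program.Emits.seq ?_ fun m₁ hm₁ => ?_
  · refine Program.Emits.forLoop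
      (by simp [Program.Writes, skip, phaseProgram, forLoop, incr])
      (by simp [Term.val, var, setVar_of_ne, hn]) fun u hu m₁ hm₁ => ?_
    have hw₁ : ∀ a, a ≠ bitVar → a ≠ fstVar → a ≠ sndVar → m₁ a = m a := fun a h1 h2 h3 =>
      hm₁.1 a (by simp [Program.Writes, skip, phaseProgram, forLoop, incr, h1, h3]) h2
    refine Program.Emits.forLoop
      (by simp [Program.Writes, skip, phaseProgram, forLoop, incr])
      (by simp [Term.val, var, setVar_of_ne, hw₁, hn]) fun v hv m₂ hm₂ => ?_
    have hw₂ : ∀ a, a ≠ bitVar → a ≠ sndVar → m₂ a = m₁ a := fun a h1 h2 =>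
      hm₂.1 a (by simp [Program.Writes, skip, phaseProgram, forLoop, incr, h1]) h2
    have hn₂ : m₂ 0 0 = n := by
      rw [hw₂ 0 (by decide) (by decide), hw₁ 0 (by decide) (by decide) (by decide), hn]
    have hu₂ : m₂ fstVar 0 = u := by rw [hw₂ fstVar (by decide) (by decide), hm₁.2]
    have hG₂ : m₂ G = m G := by
      rcases hG with rfl | rfl <;>
      rw [hw₂ _ (by decide) (by decide), hw₁ _ (by decide) (by decide) (by decide)]
    have hγ₂ : m₂ gammaArray = m gammaArray := by
      rw [hw₂ _ (by decide) (by decide), hw₁ _ (by decide) (by decide) (by decide)]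
    have hq₂ : m₂ levelVar = m levelVar := by
      rw [hw₂ _ (by decide) (by decide), hw₁ _ (by decide) (by decide) (by decide)]
    have hcnot : ∀ m', m' fstVar 0 = u → m' sndVar 0 = v →
        (Program.cnot (var fstVar) (var sndVar)).Emits m' [Gate.cnot u v] := by
      intro m' h1 h2
      have := emits_cnot m' (var fstVar) (var sndVar)
      simp only [Term.val, var, h1, h2] at this
      exact this
    refine Program.Emits.ite ?_ ?_ (emits_skip m₂)
    · simp [Term.val, var, edgeTest, hn₂, hu₂, hm₂.2, hG₂]
    · refine (hcnot m₂ hu₂ hm₂.2).seq fun m₃ hm₃ => ?_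
      have hw₃ : ∀ a, m₃ a = m₂ a := fun a => hm₃ a (by simp [Program.Writes])
      have hph := emits_phaseProgram hb (m := m₃) (by rw [hw₃, hn₂]) gammaArray 0 (by decide)
      rw [hw₃ gammaArray, hw₃ levelVar, hw₃ sndVar, hγ₂, hq₂, hm₂.2] at hph
      refine hph.seq fun m₄ hm₄ => ?_
      have hw₄ : ∀ a, a ≠ bitVar → m₄ a = m₃ a := fun a ha =>
        hm₄ a (by simp [Program.Writes, skip, phaseProgram, forLoop, incr, ha])
      exact hcnot m₄ (by rw [hw₄ _ (by decide), hw₃, hu₂]) (by rw [hw₄ _ (by decide), hw₃, hm₂.2])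
  · have hw₁ : ∀ a, a ≠ bitVar → a ≠ fstVar → a ≠ sndVar → m₁ a = m a := fun a h1 h2 h3 =>
      hm₁ a (by simp [Program.Writes, skip, phaseProgram, forLoop, incr, h1, h2, h3])
    refine Program.Emits.forLoop
      (by simp [Program.Writes, skip, phaseProgram, forLoop, incr])
      (by simp [Term.val, var, setVar_of_ne, hw₁, hn]) fun v hv m₂ hm₂ => ?_
    have hw₂ : ∀ a, a ≠ bitVar → a ≠ sndVar → m₂ a = m₁ a := fun a h1 h2 =>
      hm₂.1 a (by simp [Program.Writes, skip, phaseProgram, forLoop, incr, h1]) h2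
    have hn₂ : m₂ 0 0 = n := by
      rw [hw₂ 0 (by decide) (by decide), hw₁ 0 (by decide) (by decide) (by decide), hn]
    have hβ₂ : m₂ betaArray = m betaArray := by
      rw [hw₂ _ (by decide) (by decide), hw₁ _ (by decide) (by decide) (by decide)]
    have hq₂ : m₂ levelVar = m levelVar := by
      rw [hw₂ _ (by decide) (by decide), hw₁ _ (by decide) (by decide) (by decide)]
    have hhad : ∀ m', m' sndVar 0 = v →
        (Program.hadamard (var sndVar)).Emits m' [Gate.hadamard v] := by
      intro m' h
      have := emits_hadamard m' (var sndVar)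
      simp only [Term.val, var, h] at this
      exact this
    refine (hhad m₂ hm₂.2).seq fun m₃ hm₃ => ?_
    have hw₃ : ∀ a, m₃ a = m₂ a := fun a => hm₃ a (by simp [Program.Writes])
    have hph := emits_phaseProgram hb (m := m₃) (by rw [hw₃, hn₂]) betaArray 1 (by decide)
    rw [hw₃ betaArray, hw₃ levelVar, hw₃ sndVar, hβ₂, hq₂, hm₂.2] at hph
    refine hph.seq fun m₄ hm₄ => ?_
    have hw₄ : ∀ a, a ≠ bitVar → m₄ a = m₃ a := fun a ha =>
      hm₄ a (by simp [Program.Writes, skip, phaseProgram, forLoop, incr, ha])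
    exact hhad m₄ (by rw [hw₄ _ (by decide), hw₃, hm₂.2])

theorem depthTerm_val (hL : ∀ m, m 0 0 = n → tL.val m = L) {m : ℕ → ℕ → ℕ} (hn : m 0 0 = n)
    (hp : m depthVar 0 ≤ L) : (depthTerm tL).val m = m depthVar 0 := by
  simp only [depthTerm, Term.val, var, hL m hn]
  omega

theorem emits_circuitProgram (hb : ∀ m, m 0 0 = n → tb.val m = b)
    (hL : ∀ m, m 0 0 = n → tL.val m = L) {m : ℕ → ℕ → ℕ} (hn : m 0 0 = n)
    (hp : m depthVar 0 ≤ L) (G : ℕ) (hG : G = 1 ∨ G = 2) :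
    (circuitProgram tL tb G).Emits m
      (qaoaGates (m G) n b (m depthVar 0) (m gammaArray) (m betaArray)) := by
  refine Program.Emits.seq ?_ fun m₁ hm₁ => ?_
  · refine Program.Emits.forLoop (by simp [Program.Writes])
      (by simp [Term.val, var, setVar_of_ne, hn]) fun v hv m₁ hm₁ => ?_
    have := emits_hadamard m₁ (var sndVar)
    simp only [Term.val, var, hm₁.2] at this
    exact this
  · have hw₁ : ∀ a, a ≠ sndVar → m₁ a = m a := fun a h1 =>
      hm₁ a (by simp [Program.Writes, forLoop, incr, h1])
    have hp₁ : m₁ depthVar 0 = m depthVar 0 := by rw [hw₁ _ (by decide)]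
    refine Program.Emits.forLoop
      (by simp [Program.Writes, skip, levelProgram, phaseProgram, forLoop, incr])
      ?_ fun q hq m₂ hm₂ => ?_
    · rw [depthTerm_val hL (by rw [setVar_of_ne _ _ (by decide), hw₁ _ (by decide), hn])
        (by rw [setVar_of_ne _ _ (by decide), hp₁]; exact hp),
        setVar_of_ne _ _ (by decide), hp₁]
    · have hw₂ : ∀ a, a ≠ bitVar → a ≠ fstVar → a ≠ sndVar → a ≠ levelVar → m₂ a = m a := by
        intro a h1 h2 h3 h4
        rw [hm₂.1 a (by simp [Program.Writes, skip, levelProgram, phaseProgram, forLoop, incr,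
          h1, h2, h3]) h4, hw₁ a h3]
      have := emits_levelProgram hb (m := m₂)
        (by rw [hw₂ _ (by decide) (by decide) (by decide) (by decide), hn]) G hG
      rw [hm₂.2, hw₂ gammaArray (by decide) (by decide) (by decide) (by decide),
        hw₂ betaArray (by decide) (by decide) (by decide) (by decide),
        hw₂ G (by rcases hG with rfl | rfl <;> decide) (by rcases hG with rfl | rfl <;> decide)
          (by rcases hG with rfl | rfl <;> decide) (by rcases hG with rfl | rfl <;> decide)] at this
      exact this

/-! ### Evaluation of the measurement results -/

theorem sum_range_eq_uncut {n : ℕ} (G : SimpleGraph (Fin n)) (z : QAOA.Bits n) :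
    (∑ u ∈ Finset.range n, ∑ v ∈ Finset.range n,
      if u < v ∧ adjArray G (u * n + v) ≠ 0 then
        (if bitsToArray z u ≠ bitsToArray z v then 0 else 1) else 0) = QAOA.uncut G z := by
  have h := congrArg List.length (flatMap_edgeList G fun u v =>
    if bitsToArray z u ≠ bitsToArray z v then [] else [()])
  have hr : ∀ f : ℕ → ℕ, ((List.range n).map f).sum = ∑ i ∈ Finset.range n, f i := fun f => by
    rw [← List.sum_toFinset _ List.nodup_range, List.toFinset_range]
  have hc : ∀ l : List (Fin n × Fin n), (l.flatMap fun e =>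
      if bitsToArray z e.1 ≠ bitsToArray z e.2 then [] else [()]).length =
      l.countP fun e => z e.1 = z e.2 := by
    intro l
    induction l with
    | nil => rfl
    | cons e l ih =>
      rw [List.flatMap_cons, List.length_append, ih, List.countP_cons, add_comm]
      congr 1
      simp only [bitsToArray, Fin.is_lt, dif_pos, Fin.eta]
      cases z e.1 <;> cases z e.2 <;> simp
  rw [hc, List.length_flatMap, hr] at h
  rw [QAOA.uncut, ← h]
  refine Finset.sum_congr rfl fun u _ => ?_
  rw [List.length_flatMap, hr]
  refine Finset.sum_congr rfl fun v _ => ?_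
  split_ifs <;> rfl

theorem adds_uncutProgram {n : ℕ} (G : SimpleGraph (Fin n)) (z : QAOA.Bits n) {m : ℕ → ℕ → ℕ}
    (hn : m 0 0 = n) (g y : ℕ) (hg : g = 1 ∨ g = 2) (hy : y = sumVar₁ ∨ y = sumVar₂)
    (hG : m g = adjArray G) (hz : m resultArray = bitsToArray z) :
    (uncutProgram g y).Adds y m (QAOA.uncut G z) := by
  have hy0 : y ≠ 0 := by rcases hy with rfl | rfl <;> decide
  have hy1 : y ≠ fstVar := by rcases hy with rfl | rfl <;> decide
  have hy2 : y ≠ sndVar := by rcases hy with rfl | rfl <;> decide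
  have hy3 : y ≠ resultArray := by rcases hy with rfl | rfl <;> decide
  have hgy : g ≠ y := by rcases hg with rfl | rfl <;> rcases hy with rfl | rfl <;> decide
  have hg1 : g ≠ fstVar := by rcases hg with rfl | rfl <;> decide
  have hg2 : g ≠ sndVar := by rcases hg with rfl | rfl <;> decide
  rw [← sum_range_eq_uncut]
  refine Program.Adds.forLoop hy1
    (by simp [Program.Writes, skip, forLoop, incr, hy1.symm])
    (by simp [Term.val, var, setVar_of_ne, hn]) fun u hu m₁ hm₁ => ?_
  have hw₁ : ∀ a, a ≠ y → a ≠ fstVar → a ≠ sndVar → m₁ a = m a := fun a h1 h2 h3 =>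
    hm₁.1 a (by simp [Program.Writes, skip, forLoop, incr, h1, h3]) h2
  refine Program.Adds.forLoop hy2
    (by simp [Program.Writes, skip, incr, hy2.symm])
    (by simp [Term.val, var, setVar_of_ne, hw₁, hn, hy0.symm]) fun v hv m₂ hm₂ => ?_
  have hw₂ : ∀ a, a ≠ y → a ≠ sndVar → m₂ a = m₁ a := fun a h1 h2 =>
    hm₂.1 a (by simp [Program.Writes, skip, incr, h1]) h2
  have hn₂ : m₂ 0 0 = n := by
    rw [hw₂ 0 hy0.symm (by decide), hw₁ 0 hy0.symm (by decide) (by decide), hn]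
  have hu₂ : m₂ fstVar 0 = u := by rw [hw₂ fstVar hy1.symm (by decide), hm₁.2]
  have hG₂ : m₂ g = adjArray G := by rw [hw₂ g hgy hg2, hw₁ g hgy hg1 hg2, hG]
  have hz₂ : m₂ resultArray = bitsToArray z := by
    rw [hw₂ _ hy3.symm (by decide), hw₁ _ hy3.symm (by decide) (by decide), hz]
  refine Program.Adds.ite ?_ (Program.Adds.ite ?_ (adds_skip y m₂) (adds_incr y m₂))
    (adds_skip y m₂)
  · simp [Term.val, var, edgeTest, hn₂, hu₂, hm₂.2, hG₂]
  · simp only [Term.val, var, hu₂, hm₂.2, hz₂]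
    split_ifs <;> omega

/-! ### Random bits and shots -/

theorem realizes_run {m : ℕ → ℕ → ℕ} {g : List Gate} {t : Term} {w : ℕ} (hw : t.val m = w) :
    (Program.run t).Realizes m g (bornRule (circuitOutput w g) (circuitOutput_norm _ _))
      fun z m' g' => m' = Function.update m resultArray (bitsToArray z) ∧ g' = [] := by
  subst hw
  intro τ
  exact (PMF.Coupled.map_right _ _).mono fun z s' _ h => by rw [h]; exact ⟨rfl, rfl⟩

/-- Measuring `H|0⟩` gives a uniform bit. -/
theorem bornRule_hadamard :
    bornRule (circuitOutput 1 [Gate.hadamard 0]) (circuitOutput_norm _ _) =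
      PMF.uniformOfFintype (Fin 1 → Bool) := by
  have h := runGates_hadamards 1
  ext z
  have h' : circuitOutput 1 [Gate.hadamard 0] = QAOA.plusState 1 := h
  rw [bornRule, PMF.ofFintype_apply, h', PMF.uniformOfFintype_apply, QAOA.plusState, norm_div,
    norm_one, Complex.norm_real, Real.norm_of_nonneg (Real.sqrt_nonneg _), div_pow, one_pow,
    Real.sq_sqrt (by norm_num), one_div, ENNReal.ofReal_inv_of_pos (by norm_num)]
  simp

theorem realizes_randomBit (m : ℕ → ℕ → ℕ) :
    (Program.run (.const 1)).Realizes m [Gate.hadamard 0] (PMF.uniformOfFintype (Fin 1 → Bool))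
      fun z m' g' => m' = Function.update m resultArray (bitsToArray z) ∧ g' = [] := by
  rw [← bornRule_hadamard]
  exact realizes_run rfl

theorem uniformOfFintype_snoc (k : ℕ) :
    PMF.uniformOfFintype (Fin (k + 1) → Fin 2) =
      (PMF.uniformOfFintype (Fin k → Fin 2)).bind fun f =>
        (PMF.uniformOfFintype (Fin 1 → Bool)).map fun z =>
          Fin.snoc f (if z 0 then 1 else 0) := by
  ext f
  rw [PMF.bind_apply, tsum_fintype, Finset.sum_eq_single (Fin.init f)]
  · rw [PMF.map_apply, tsum_fintype, Finset.sum_eq_single fun _ => decide (f (Fin.last k) = 1)]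
    · rw [if_pos]
      · simp only [PMF.uniformOfFintype_apply, Fintype.card_fun, Fintype.card_fin, Fintype.card_bool]
        rw [← ENNReal.mul_inv (by simp) (by simp), pow_succ]
        push_cast
        simp
      · have : (if decide (f (Fin.last k) = 1) then 1 else 0 : Fin 2) = f (Fin.last k) := by
          generalize f (Fin.last k) = x
          revert x
          decide
        rw [this, Fin.snoc_init_self]
    · intro z _ hz
      rw [if_neg]
      intro h
      refine hz (funext fun i => ?_)
      have h' := congrFun h (Fin.last k)
      rw [Fin.snoc_last] at h'
      rw [Subsingleton.elim i 0, h']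
      cases z 0 <;> simp
    · intro h
      exact absurd (Finset.mem_univ _) h
  · intro g _ hg
    rw [PMF.map_apply, tsum_fintype, Finset.sum_eq_zero, mul_zero]
    intro z _
    rw [if_neg]
    rintro rfl
    exact hg (Fin.init_snoc (α := fun _ => Fin 2) _ _).symm
  · intro h
    exact absurd (Finset.mem_univ _) h

/-- Angles with uniform bits are uniform on the grid. -/
theorem randomAngles_eq_map (p b : ℕ) :
    QAOA.randomAngles p b = (PMF.uniformOfFintype (Fin (p * b) → Fin 2)).map fun f (q : Fin p) =>
      bitsAngle (fun l => if h : q * b + l < p * b then (f ⟨q * b + l, h⟩ : ℕ) else 0) b := by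
  let e : (Fin (p * b) → Fin 2) ≃ (Fin p → Fin (2 ^ b)) :=
    ((Equiv.arrowCongr finProdFinEquiv.symm (Equiv.refl _)).trans
      (Equiv.curry _ _ _)).trans (Equiv.piCongrRight fun _ => finFunctionFinEquiv)
  rw [QAOA.randomAngles, ← PMF.uniformOfFintype_map_equiv e, PMF.map_comp]
  congr 1
  ext f q
  have he : (e f q : ℕ) = ∑ l : Fin b, (f (finProdFinEquiv (q, l)) : ℕ) * 2 ^ (l : ℕ) := by
    simp [e, Function.curry]
  simp only [Function.comp_apply, bitsAngle]
  rw [he, Finset.sum_range]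
  congr 3
  refine Finset.sum_congr rfl fun l _ => ?_
  have hlt : (q : ℕ) * b + l < p * b := by
    have := (finProdFinEquiv (q, l)).isLt
    rw [finProdFinEquiv_apply_val] at this
    nlinarith
  have hf : finProdFinEquiv (q, l) = ⟨q * b + l, hlt⟩ := by
    ext
    rw [finProdFinEquiv_apply_val]
    simp only
    ring
  simp only [dif_pos hlt, hf]
  generalize f _ = x
  fin_cases x <;> simp

/-- Measured bits fill the array with the bits of independent angles, uniform on the grid. -/
theorem realizes_drawProgram (hb : ∀ m, m 0 0 = n → tb.val m = b)
    (hL : ∀ m, m 0 0 = n → tL.val m = L) {m : ℕ → ℕ → ℕ} (hn : m 0 0 = n) {p : ℕ}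
    (hpm : m depthVar 0 = p) (hp : p ≤ L) (x : ℕ) (hx : x = gammaArray ∨ x = betaArray) :
    (drawProgram tL tb x).Realizes m [] (QAOA.randomAngles p b) fun γ m' g' =>
      g' = [] ∧ γ = fun q : Fin p => bitsAngle (fun l => m' x (q * b + l)) b := by
  have hxd : x ≠ drawVar := by rcases hx with rfl | rfl <;> decide
  have hxr : x ≠ resultArray := by rcases hx with rfl | rfl <;> decide
  have hloop : (drawProgram tL tb x).Realizes m [] (PMF.uniformOfFintype (Fin (p * b) → Fin 2))
      fun f m' g' => g' = [] ∧ m' drawVar 0 = p * b ∧ ∀ j : Fin (p * b), m' x j = f j := by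
    refine realizes_forLoop (fun i => PMF.uniformOfFintype (Fin i → Fin 2)) _
      uniformOfFintype_snoc
      (fun i f m' g' => g' = [] ∧ m' drawVar 0 = i ∧ ∀ j : Fin i, m' x j = f j) ?_
      (fun i => i.elim0) ?_ ⟨rfl, setVar_self _ _ _, fun i => i.elim0⟩ ?_
    · have hn' : (setVar m drawVar 0) 0 0 = n := by rw [setVar_of_ne _ _ (by decide), hn]
      have hp' : (setVar m drawVar 0) depthVar 0 = p := by
        rw [setVar_of_ne _ _ (by decide), hpm]
      rw [Term.val, hb _ hn', depthTerm_val hL hn' (by rw [hp']; exact hp), hp']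
    · ext f
      rw [PMF.uniformOfFintype_apply, PMF.pure_apply, if_pos (Subsingleton.elim _ _)]
      simp
    · rintro i hi f m' _ ⟨rfl, hd, hf⟩
      refine Program.Ensures.seq_realizes (Q := fun m'' g'' => m'' = m' ∧ g'' = [Gate.hadamard 0])
        ?_ ?_
      · refine (emits_hadamard m' (.const 0) []).mono fun m'' g'' hfr h => ?_
        exact ⟨funext fun a => hfr a (by simp [Program.Writes]), h⟩
      · rintro m' _ ⟨rfl, rfl⟩
        refine Program.Realizes.seq_ensures (R := fun f' m'' g'' =>
          g'' = [] ∧ m'' drawVar 0 = i ∧ m'' x = m' x ∧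
            ∃ c : Fin 2, f' = Fin.snoc f c ∧ m'' resultArray 0 = c) ?_ ?_
        · intro τ
          refine PMF.Coupled.map_left ((realizes_randomBit m' τ).mono ?_)
          rintro z ⟨m'', g'', τ'⟩ - ⟨h1, h2⟩
          simp only at h1 h2
          subst h1 h2
          dsimp only
          refine ⟨rfl, ?_, ?_, _, rfl, ?_⟩
          · rw [Function.update_of_ne (by decide), hd]
          · rw [Function.update_of_ne hxr]
          · rw [Function.update_self]
            simp only [bitsToArray]
            cases hz : z 0 <;> simp [hz]
        · rintro f' m'' _ ⟨rfl, hd'', hx'', c, rfl, hc⟩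
          refine Program.Ensures.assign ?_
          have hval : (var drawVar).val m'' = i := hd''
          have hval' : (Term.get resultArray (.const 0)).val m'' = m'' resultArray 0 := rfl
          rw [hval, hval']
          refine ⟨rfl, ?_, fun j => ?_⟩
          · rw [setVar_self, Function.update_of_ne hxd.symm, hd'']
          · rw [setVar_of_ne _ _ hxd, Function.update_self]
            refine Fin.lastCases ?_ (fun j => ?_) j
            · simp [hc]
            · rw [Fin.snoc_castSucc, Function.update_of_ne (by simpa using j.isLt.ne), hx'']
              exact hf j
  rw [randomAngles_eq_map]
  intro τ
  refine PMF.Coupled.map_left ((hloop τ).mono fun f s' _ h => ⟨h.1, ?_⟩)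
  ext q
  unfold bitsAngle
  congr 3
  refine Finset.sum_congr rfl fun l hl => ?_
  have hlt : (q : ℕ) * b + l < p * b := by
    have h1 : (q : ℕ) + 1 ≤ p := q.isLt
    have h2 := Finset.mem_range.1 hl
    nlinarith [Nat.mul_le_mul_right b h1]
  have hl' := h.2.2 ⟨q * b + l, hlt⟩
  simp only [dif_pos hlt, ← hl']

/-- A shot samples the Born distribution of the QAOA state whose angles are stored in memory, and adds
the number of uncut edges of the sample to the variable `y`. -/
theorem realizes_shotProgram (hb : ∀ m, m 0 0 = n → tb.val m = b)
    (hL : ∀ m, m 0 0 = n → tL.val m = L) {m : ℕ → ℕ → ℕ} (hn : m 0 0 = n) {p : ℕ}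
    (hpm : m depthVar 0 = p) (hp : p ≤ L) (G : SimpleGraph (Fin n)) (g y : ℕ)
    (hg : g = 1 ∨ g = 2) (hy : y = sumVar₁ ∨ y = sumVar₂) (hG : m g = adjArray G) :
    (shotProgram tL tb g y).Realizes m []
      (bornRule (QAOA.state G (fun q : Fin p => bitsAngle (fun l => m gammaArray (q * b + l)) b)
        (fun q : Fin p => bitsAngle (fun l => m betaArray (q * b + l)) b)) (QAOA.state_norm _ _ _))
      fun z m' g' => g' = [] ∧ m' y 0 = m y 0 + QAOA.uncut G z := by
  have hem := emits_circuitProgram hb hL hn (by rw [hpm]; exact hp) g hg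
  have hyc : ¬ (circuitProgram tL tb g).Writes y := by
    rcases hy with rfl | rfl <;>
    simp [circuitProgram, levelProgram, phaseProgram, Program.Writes, skip, forLoop, incr]
  have hgc : ¬ (circuitProgram tL tb g).Writes g := by
    rcases hg with rfl | rfl <;>
    simp [circuitProgram, levelProgram, phaseProgram, Program.Writes, skip, forLoop, incr]
  have hnc : ¬ (circuitProgram tL tb g).Writes 0 := by
    simp [circuitProgram, levelProgram, phaseProgram, Program.Writes, skip, forLoop, incr]
  have hyr : y ≠ resultArray := by rcases hy with rfl | rfl <;> decide
  have hgr : g ≠ resultArray := by rcases hg with rfl | rfl <;> decide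
  refine Program.Ensures.seq_realizes ((hem []).mono (Q' := fun m' g' =>
    (circuitProgram tL tb g).Frame m m' ∧ g' = _) fun m' g' hf h => ⟨hf, h⟩) ?_
  rintro m₁ _ ⟨hf, rfl⟩
  have hn₁ : m₁ 0 0 = n := by rw [hf 0 hnc, hn]
  refine Program.Realizes.seq_ensures (R := fun z m' g' => m' 0 0 = n ∧ m' g = adjArray G ∧
    m' resultArray = bitsToArray z ∧ m' y 0 = m y 0 ∧ g' = []) ?_ ?_
  · rw [← bornRule_circuitOutput_qaoaGates, hG, hpm, List.nil_append]
    refine (realizes_run (t := var 0) hn₁).mono ?_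
    rintro z _ _ - ⟨rfl, rfl⟩
    refine ⟨?_, ?_, ?_, ?_, rfl⟩
    · rw [Function.update_of_ne (by decide), hn₁]
    · rw [Function.update_of_ne hgr, hf g hgc, hG]
    · rw [Function.update_self]
    · rw [Function.update_of_ne hyr, hf y hyc]
  · rintro z m₂ _ ⟨h1, h2, h3, h4, rfl⟩
    refine (adds_uncutProgram G z h1 g y hg hy h2 h3 []).mono ?_
    rintro m₃ _ - ⟨rfl, h5⟩
    exact ⟨rfl, by rw [h5, h4]⟩

end Correctness

end QMachine

/-! ### Rounds of the comparison -/

/-- A loop adds its last sample at the end, while `iidSamples` puts the first one in front; for the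
distribution of the sum this makes no difference. -/
theorem iidSamples_succ_map_sum {α : Type} (μ : PMF α) (f : α → ℕ) (k : ℕ) :
    ((iidSamples μ (k + 1)).map fun l => (l.map f).sum) =
      ((iidSamples μ k).map fun l => (l.map f).sum).bind fun s => μ.map fun a => s + f a := by
  rw [iidSamples, PMF.bind_map, PMF.map_bind]
  simp only [PMF.map_bind, PMF.pure_map, Function.comp_def]
  rw [PMF.bind_comm]
  congr 1
  ext l : 1
  simp only [List.map_cons, List.sum_cons, add_comm]
  rfl

namespace QAOA

theorem compareLevels_append {n : ℕ} (G₁ G₂ : SimpleGraph (Fin n)) (b N D : ℕ) (l l' : List ℕ) :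
    compareLevels G₁ G₂ b N D (l ++ l') =
      (compareLevels G₁ G₂ b N D l).bind fun a =>
        (compareLevels G₁ G₂ b N D l').map fun a' => a && a' := by
  induction l with
  | nil =>
    rw [List.nil_append, compareLevels, PMF.pure_bind]
    exact (PMF.map_id _).symm
  | cons p l ih =>
    simp only [List.cons_append, compareLevels, ih, PMF.bind_bind, PMF.pure_bind, PMF.map,
      Function.comp_def, Bool.and_assoc]

/-- One more round at the same level, with the answer `a₀` of earlier rounds carried along. -/
theorem compareLevels_replicate_succ {n : ℕ} (G₁ G₂ : SimpleGraph (Fin n)) (b N D p k : ℕ)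
    (a₀ : Bool) :
    ((compareLevels G₁ G₂ b N D (List.replicate (k + 1) p)).map fun a => a₀ && a) =
      ((compareLevels G₁ G₂ b N D (List.replicate k p)).map fun a => a₀ && a).bind fun a =>
        (compareRound G₁ G₂ p b N D).map fun a' => a && a' := by
  rw [List.replicate_succ', compareLevels_append, PMF.map_bind, PMF.bind_map]
  congr 1
  ext a : 1
  simp only [compareLevels, PMF.map_bind, PMF.pure_bind, PMF.pure_map, Bool.and_true,
    Function.comp_def, Bool.and_assoc]
  rfl

end QAOA

namespace QMachine

section Correctness

variable {n b L N D M : ℕ} {tb tL tN tD tM : Term}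

/-- The sum of the shots represents the energy estimate. -/
theorem realizes_sumProgram (hb : ∀ m, m 0 0 = n → tb.val m = b)
    (hL : ∀ m, m 0 0 = n → tL.val m = L) (hN : ∀ m, m 0 0 = n → tN.val m = N)
    {m : ℕ → ℕ → ℕ} (hn : m 0 0 = n) {p : ℕ}
    (hpm : m depthVar 0 = p) (hp : p ≤ L) (G : SimpleGraph (Fin n)) (g y : ℕ)
    (hg : g = 1 ∨ g = 2) (hy : y = sumVar₁ ∨ y = sumVar₂) (hG : m g = adjArray G)
    {γ β : Fin p → ℝ} (hγ : γ = fun q : Fin p => bitsAngle (fun l => m gammaArray (q * b + l)) b)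
    (hβ : β = fun q : Fin p => bitsAngle (fun l => m betaArray (q * b + l)) b) :
    (sumProgram tL tb tN g y).Realizes m [] (QAOA.estimate G γ β N)
      fun e m' g' => g' = [] ∧ e = (m' y 0 : ℚ) / N := by
  have hy0 : 0 ≠ y := by rcases hy with rfl | rfl <;> decide
  have hyd : depthVar ≠ y := by rcases hy with rfl | rfl <;> decide
  have hyγ : gammaArray ≠ y := by rcases hy with rfl | rfl <;> decide
  have hyβ : betaArray ≠ y := by rcases hy with rfl | rfl <;> decide
  have hgy : g ≠ y := by rcases hg with rfl | rfl <;> rcases hy with rfl | rfl <;> decide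
  have hw : ∀ a, a ≠ y → a ≠ resultArray → a ≠ levelVar → a ≠ bitVar → a ≠ fstVar → a ≠ sndVar →
      ¬ (shotProgram tL tb g y).Writes a := by
    intro a h1 h2 h3 h4 h5 h6
    simp [shotProgram, uncutProgram, circuitProgram, levelProgram, phaseProgram, Program.Writes,
      skip, forLoop, incr, h1, h2, h3, h4, h5, h6]
  have hwg := hw g hgy (by rcases hg with rfl | rfl <;> decide)
    (by rcases hg with rfl | rfl <;> decide) (by rcases hg with rfl | rfl <;> decide)
    (by rcases hg with rfl | rfl <;> decide) (by rcases hg with rfl | rfl <;> decide)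
  have hw0 := hw 0 hy0 (by decide) (by decide) (by decide) (by decide) (by decide)
  have hwd := hw depthVar hyd (by decide) (by decide) (by decide) (by decide) (by decide)
  have hwγ := hw gammaArray hyγ (by decide) (by decide) (by decide) (by decide) (by decide)
  have hwβ := hw betaArray hyβ (by decide) (by decide) (by decide) (by decide) (by decide)
  set ν := bornRule (QAOA.state G γ β) (QAOA.state_norm G γ β) with hν
  let J : ℕ → ℕ → (ℕ → ℕ → ℕ) → List Gate → Prop := fun _ S m' g' =>
    g' = [] ∧ m' y 0 = S ∧ m' 0 = m 0 ∧ m' g = m g ∧ m' depthVar = m depthVar ∧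
      m' gammaArray = m gammaArray ∧ m' betaArray = m betaArray
  have hloop : (sumProgram tL tb tN g y).Realizes m []
      ((iidSamples ν N).map fun l => (l.map (QAOA.uncut G)).sum) (J N) := by
    refine Program.Ensures.seq_realizes (Q := J 0 0) (Program.Ensures.assign ?_) ?_
    · refine ⟨rfl, ?_, ?_, ?_, ?_, ?_, ?_⟩
      · rw [Function.update_self]
        exact Function.update_self _ _ _
      all_goals rw [Function.update_of_ne ‹_›]
    · rintro m₁ g₁ hJ
      have hN₁ : tN.val m₁ = N := hN m₁ (by rw [hJ.2.2.1, hn])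
      have := Program.Realizes.loop (c := shotProgram tL tb g y) (m := m₁) (g := g₁) (t := tN)
        (fun i => (iidSamples ν i).map fun l => (l.map (QAOA.uncut G)).sum)
        (fun _ S => ν.map fun z => S + QAOA.uncut G z) (iidSamples_succ_map_sum ν _) J 0
        (by simp [iidSamples, PMF.pure_map]) hJ ?_
      · rwa [hN₁] at this
      · rintro i hi S m₂ _ ⟨rfl, hS, h0, h1, h2, h3, h4⟩ τ
        have hshot := realizes_shotProgram hb hL (m := m₂) (by rw [h0, hn]) (by rw [h2, hpm]) hp G
          g y hg hy (h1.trans hG)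
        rw [h3, h4, ← hγ, ← hβ] at hshot
        refine PMF.Coupled.map_left ((hshot.mono (R' := fun z m' g' => J (i + 1)
          (S + QAOA.uncut G z) m' g') ?_) τ)
        rintro z m₃ _ hf ⟨rfl, hz⟩
        exact ⟨rfl, by rw [hz, hS], (hf _ hw0).trans h0, (hf _ hwg).trans h1,
          (hf _ hwd).trans h2, (hf _ hwγ).trans h3, (hf _ hwβ).trans h4⟩
  have hest : QAOA.estimate G γ β N =
      ((iidSamples ν N).map fun l => (l.map (QAOA.uncut G)).sum).map fun S : ℕ => (S : ℚ) / N := by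
    rw [PMF.map_comp]
    rfl
  rw [hest]
  intro τ
  refine PMF.Coupled.map_left ((hloop τ).mono ?_)
  rintro S s' - ⟨h1, h2, -⟩
  exact ⟨h1, by rw [h2]⟩

/-- The integer test of the program compares the averages with the precision. -/
theorem differTest_iff (hN : N ≠ 0) (hD : D ≠ 0) (S T : ℕ) :
    ((if N < D * (S - T) then 1 else 0) + (if N < D * (T - S) then 1 else 0) ≠ 0) ↔
      ¬ |(S : ℚ) / N - (T : ℚ) / N| ≤ 1 / (D : ℚ) := by
  have hN' : (0 : ℚ) < N := by exact_mod_cast Nat.pos_of_ne_zero hN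
  have hD' : (0 : ℚ) < D := by exact_mod_cast Nat.pos_of_ne_zero hD
  have key : ∀ a c : ℕ, c ≤ a → (|(a : ℚ) / N - (c : ℚ) / N| ≤ 1 / (D : ℚ) ↔ D * (a - c) ≤ N) := by
    intro a c hca
    rw [← sub_div, ← Nat.cast_sub hca, abs_div, Nat.abs_cast, Nat.abs_cast,
      div_le_div_iff₀ hN' hD', one_mul, mul_comm]
    exact_mod_cast Iff.rfl
  rcases le_total S T with h | h
  · rw [abs_sub_comm, key T S h, Nat.sub_eq_zero_of_le h]
    split_ifs <;> omega
  · rw [key S T h, Nat.sub_eq_zero_of_le h]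
    split_ifs <;> omega

/-- A round updates the answer by the outcome of the comparison: the answer drops to `0` if a difference
is seen, and stays as it is otherwise. -/
theorem realizes_roundProgram (hb : ∀ m, m 0 0 = n → tb.val m = b)
    (hL : ∀ m, m 0 0 = n → tL.val m = L) (hN : ∀ m, m 0 0 = n → tN.val m = N)
    (hD : ∀ m, m 0 0 = n → tD.val m = D) (hN0 : N ≠ 0) (hD0 : D ≠ 0)
    (G₁ G₂ : SimpleGraph (Fin n)) {m : ℕ → ℕ → ℕ} (hn : m 0 0 = n) {p : ℕ}
    (hpm : m depthVar 0 = p) (hp : p ≤ L) (hG₁ : m 1 = adjArray G₁) (hG₂ : m 2 = adjArray G₂)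
    (a : Bool) (ha : m answerArray 0 = a.toNat) :
    (roundProgram tL tb tN tD).Realizes m []
      ((QAOA.compareRound G₁ G₂ p b N D).map fun a' => a && a')
      fun a' m' g' => g' = [] ∧ m' answerArray 0 = a'.toNat := by
  have hdraw : ∀ x a, a ≠ x → a ≠ drawVar → a ≠ resultArray →
      ¬ (drawProgram tL tb x).Writes a := by
    intro x a h1 h2 h3
    simp [drawProgram, Program.Writes, forLoop, incr, h1, h2, h3]
  have hsum : ∀ g y a, a ≠ y → a ≠ resultArray → a ≠ levelVar → a ≠ bitVar → a ≠ fstVar →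
      a ≠ sndVar → ¬ (sumProgram tL tb tN g y).Writes a := by
    intro g y a h1 h2 h3 h4 h5 h6
    simp [sumProgram, shotProgram, uncutProgram, circuitProgram, levelProgram, phaseProgram,
      Program.Writes, skip, forLoop, incr, h1, h2, h3, h4, h5, h6]
  suffices h : (roundProgram tL tb tN tD).Realizes m [] (QAOA.compareRound G₁ G₂ p b N D)
      fun a' m' g' => g' = [] ∧ m' answerArray 0 = (a && a').toNat from
    fun τ => PMF.Coupled.map_left (h τ)
  refine Program.Realizes.seq (R := fun γ m₁ g₁ => (drawProgram tL tb gammaArray).Frame m m₁ ∧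
    g₁ = [] ∧ γ = fun q : Fin p => bitsAngle (fun l => m₁ gammaArray (q * b + l)) b)
    ((realizes_drawProgram hb hL hn hpm hp gammaArray (Or.inl rfl)).mono
      fun γ m₁ g₁ hf h => ⟨hf, h⟩) ?_
  rintro γ m₁ _ ⟨hf₁, rfl, hγ⟩
  have hw₁ : ∀ x ∈ [0, 1, 2, answerArray, depthVar], m₁ x = m x := fun x hx => hf₁ x (hdraw _ _
    (by rintro rfl; revert hx; decide) (by rintro rfl; revert hx; decide)
    (by rintro rfl; revert hx; decide))
  refine Program.Realizes.seq (R := fun β m₂ g₂ => (drawProgram tL tb betaArray).Frame m₁ m₂ ∧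
    g₂ = [] ∧ β = fun q : Fin p => bitsAngle (fun l => m₂ betaArray (q * b + l)) b)
    ((realizes_drawProgram hb hL (by rw [hw₁ 0 (by decide), hn])
      (by rw [hw₁ depthVar (by decide), hpm]) hp betaArray (Or.inr rfl)).mono
      fun β m₂ g₂ hf h => ⟨hf, h⟩) ?_
  rintro β m₂ _ ⟨hf₂, rfl, hβ⟩
  have hw₂' : ∀ x ∈ [0, 1, 2, answerArray, depthVar, gammaArray], m₂ x = m₁ x :=
    fun x hx => hf₂ x (hdraw _ _
      (by rintro rfl; revert hx; decide) (by rintro rfl; revert hx; decide)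
      (by rintro rfl; revert hx; decide))
  have hw₂ : ∀ x ∈ [0, 1, 2, answerArray, depthVar], m₂ x = m x := fun x hx =>
    (hw₂' x (List.mem_append_left [gammaArray] hx)).trans (hw₁ x hx)
  rw [← hw₂' gammaArray (by decide)] at hγ
  refine Program.Realizes.seq (R := fun e₁ m₃ g₃ => (sumProgram tL tb tN 1 sumVar₁).Frame m₂ m₃ ∧
    g₃ = [] ∧ e₁ = (m₃ sumVar₁ 0 : ℚ) / N)
    ((realizes_sumProgram hb hL hN (by rw [hw₂ 0 (by decide), hn])
      (by rw [hw₂ depthVar (by decide), hpm]) hp G₁ 1 sumVar₁ (Or.inl rfl) (Or.inl rfl)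
      ((hw₂ 1 (by decide)).trans hG₁) hγ hβ).mono fun e₁ m₃ g₃ hf h => ⟨hf, h⟩) ?_
  rintro e₁ m₃ _ ⟨hf₃, rfl, he₁⟩
  have hw₃' : ∀ x ∈ [0, 1, 2, answerArray, depthVar, gammaArray, betaArray], m₃ x = m₂ x :=
    fun x hx => hf₃ x (hsum _ _ _
      (by rintro rfl; revert hx; decide) (by rintro rfl; revert hx; decide)
      (by rintro rfl; revert hx; decide) (by rintro rfl; revert hx; decide)
      (by rintro rfl; revert hx; decide) (by rintro rfl; revert hx; decide))
  have hw₃ : ∀ x ∈ [0, 1, 2, answerArray, depthVar], m₃ x = m x := fun x hx =>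
    (hw₃' x (List.mem_append_left [gammaArray, betaArray] hx)).trans (hw₂ x hx)
  rw [← hw₃' gammaArray (by decide)] at hγ
  rw [← hw₃' betaArray (by decide)] at hβ
  refine Program.Realizes.seq (R := fun e₂ m₄ g₄ => (sumProgram tL tb tN 2 sumVar₂).Frame m₃ m₄ ∧
    g₄ = [] ∧ e₂ = (m₄ sumVar₂ 0 : ℚ) / N)
    ((realizes_sumProgram hb hL hN (by rw [hw₃ 0 (by decide), hn])
      (by rw [hw₃ depthVar (by decide), hpm]) hp G₂ 2 sumVar₂ (Or.inr rfl) (Or.inr rfl)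
      ((hw₃ 2 (by decide)).trans hG₂) hγ hβ).mono fun e₂ m₄ g₄ hf h => ⟨hf, h⟩) ?_
  rintro e₂ m₄ _ ⟨hf₄, rfl, he₂⟩
  have hw₄' : ∀ x ∈ [0, answerArray, sumVar₁], m₄ x = m₃ x :=
    fun x hx => hf₄ x (hsum _ _ _
      (by rintro rfl; revert hx; decide) (by rintro rfl; revert hx; decide)
      (by rintro rfl; revert hx; decide) (by rintro rfl; revert hx; decide)
      (by rintro rfl; revert hx; decide) (by rintro rfl; revert hx; decide))
  have hn₄ : m₄ 0 0 = n := by rw [hw₄' 0 (by decide), hw₃ 0 (by decide), hn]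
  rw [← hw₄' sumVar₁ (by decide)] at he₁
  have ha₄ : m₄ answerArray 0 = a.toNat := by
    rw [hw₄' _ (by decide), hw₃ _ (by decide), ha]
  have htest : (differTest tN tD).val m₄ ≠ 0 ↔ ¬ |e₁ - e₂| ≤ 1 / (D : ℚ) := by
    rw [he₁, he₂, ← differTest_iff hN0 hD0]
    simp only [differTest, Term.val, var, hN m₄ hn₄, hD m₄ hn₄]
  have hite : (Program.ite (differTest tN tD) (.assign answerArray (.const 0) (.const 0))
      skip).Ensures m₄ [] fun m' g' => g' = [] ∧
        m' answerArray 0 = (a && decide (|e₁ - e₂| ≤ 1 / (D : ℚ))).toNat := by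
    refine Program.Ensures.ite (fun h => ?_) fun h => ?_
    · refine Program.Ensures.assign ⟨rfl, ?_⟩
      rw [decide_eq_false (htest.1 h), Bool.and_false]
      exact setVar_self m₄ answerArray 0
    · refine ensures_skip ⟨rfl, ?_⟩
      rw [decide_eq_true (not_not.1 fun h' => htest.2 h' h), Bool.and_true, ha₄]
  refine (hite.realizes _).mono ?_
  rintro _ m₅ g₅ - ⟨h, rfl⟩
  exact h

/-! ### All rounds -/

/-- The rounds at one level. -/
theorem realizes_loop_roundProgram (hb : ∀ m, m 0 0 = n → tb.val m = b)
    (hL : ∀ m, m 0 0 = n → tL.val m = L) (hN : ∀ m, m 0 0 = n → tN.val m = N)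
    (hD : ∀ m, m 0 0 = n → tD.val m = D) (hM : ∀ m, m 0 0 = n → tM.val m = M)
    (hN0 : N ≠ 0) (hD0 : D ≠ 0)
    (G₁ G₂ : SimpleGraph (Fin n)) {m : ℕ → ℕ → ℕ} (hn : m 0 0 = n) {p : ℕ}
    (hpm : m depthVar 0 = p) (hp : p ≤ L) (hG₁ : m 1 = adjArray G₁) (hG₂ : m 2 = adjArray G₂)
    (a : Bool) (ha : m answerArray 0 = a.toNat) :
    (Program.loop tM (roundProgram tL tb tN tD)).Realizes m []
      ((QAOA.compareLevels G₁ G₂ b N D (List.replicate M p)).map fun a' => a && a')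
      fun a' m' g' => g' = [] ∧ m' answerArray 0 = a'.toNat := by
  have hw : ∀ x ∈ [0, 1, 2, depthVar], ¬ (roundProgram tL tb tN tD).Writes x := by
    intro x hx
    simp only [List.mem_cons, List.not_mem_nil, or_false] at hx
    rcases hx with rfl | rfl | rfl | rfl <;>
    simp [roundProgram, drawProgram, sumProgram, shotProgram, uncutProgram, circuitProgram,
      levelProgram, phaseProgram, Program.Writes, skip, forLoop, incr]
  have := Program.Realizes.loop (c := roundProgram tL tb tN tD) (m := m) (g := []) (t := tM)
    (fun i => (QAOA.compareLevels G₁ G₂ b N D (List.replicate i p)).map fun a' => a && a')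
    (fun _ a => (QAOA.compareRound G₁ G₂ p b N D).map fun a' => a && a')
    (fun i => QAOA.compareLevels_replicate_succ G₁ G₂ b N D p i a)
    (fun _ a' m' g' => g' = [] ∧ m' answerArray 0 = a'.toNat ∧
      ∀ x ∈ [0, 1, 2, depthVar], m' x = m x) a
    (by simp [QAOA.compareLevels, PMF.pure_map]) ⟨rfl, ha, fun _ _ => rfl⟩ ?_
  · rw [hM m hn] at this
    exact this.mono fun a' m' g' _ h => ⟨h.1, h.2.1⟩
  · rintro i - a' m' _ ⟨rfl, ha', hm'⟩
    refine (realizes_roundProgram hb hL hN hD hN0 hD0 G₁ G₂ (by rw [hm' 0 (by decide), hn])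
      (by rw [hm' depthVar (by decide), hpm]) hp ((hm' 1 (by decide)).trans hG₁)
      ((hm' 2 (by decide)).trans hG₂) a' ha').mono ?_
    rintro a'' m'' _ hf ⟨rfl, h⟩
    exact ⟨rfl, h, fun x hx => (hf x (hw x hx)).trans (hm' x hx)⟩

/-- If the expressions for the parameters evaluate to the parameters, then the answer of the program
has exactly the distribution of the energy comparison. -/
theorem answer_comparisonProgram (hb : ∀ m, m 0 0 = n → tb.val m = b)
    (hL : ∀ m, m 0 0 = n → tL.val m = L) (hN : ∀ m, m 0 0 = n → tN.val m = N)
    (hD : ∀ m, m 0 0 = n → tD.val m = D) (hM : ∀ m, m 0 0 = n → tM.val m = M)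
    (hN0 : N ≠ 0) (hD0 : D ≠ 0) (G₁ G₂ : SimpleGraph (Fin n)) :
    (comparisonProgram tL tM tb tN tD).answer G₁ G₂ = QAOA.energyComparison G₁ G₂ L M b N D := by
  have hw : ∀ x ∈ [0, 1, 2, depthVar],
      ¬ (Program.loop tM (roundProgram tL tb tN tD)).Writes x := by
    intro x hx
    simp only [List.mem_cons, List.not_mem_nil, or_false] at hx
    rcases hx with rfl | rfl | rfl | rfl <;>
    simp [roundProgram, drawProgram, sumProgram, shotProgram, uncutProgram, circuitProgram,
      levelProgram, phaseProgram, Program.Writes, skip, forLoop, incr]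
  have hreal : (comparisonProgram tL tM tb tN tD).Realizes (inputConfig G₁ G₂).mem []
      (QAOA.energyComparison G₁ G₂ L M b N D)
      fun a m' _ => m' answerArray 0 = a.toNat := by
    refine Program.Ensures.seq_realizes (Q := fun m' g' => g' = [] ∧ m' answerArray 0 = 1 ∧
      m' 0 0 = n ∧ m' 1 = adjArray G₁ ∧ m' 2 = adjArray G₂)
      (Program.Ensures.assign ⟨rfl, setVar_self _ answerArray 1, rfl, rfl, rfl⟩) ?_
    rintro m₁ _ ⟨rfl, h1, hn, hG₁, hG₂⟩
    refine Program.Realizes.mono (realizes_forLoop (k := L + 1)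
      (fun i => QAOA.compareLevels G₁ G₂ b N D
        ((List.range i).flatMap fun p => List.replicate M p))
      (fun i a => (QAOA.compareLevels G₁ G₂ b N D (List.replicate M i)).map fun a' => a && a')
      (fun i => ?_)
      (fun i a m' g' => g' = [] ∧ m' answerArray 0 = a.toNat ∧ m' depthVar 0 = i ∧
        m' 0 0 = n ∧ m' 1 = adjArray G₁ ∧ m' 2 = adjArray G₂)
      ?_ true rfl ?_ ?_) fun a m' g' _ h => h.2.1
    · rw [List.range_succ, List.flatMap_append, QAOA.compareLevels_append]
      simp
    · rw [Term.val, hL _ (by rw [setVar_of_ne _ _ (by decide), hn])]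
      rfl
    · refine ⟨rfl, ?_, setVar_self _ _ _, ?_, ?_, ?_⟩
      · rw [setVar_of_ne _ _ (by decide), h1]
        rfl
      all_goals rw [setVar_of_ne _ _ (by decide)]; assumption
    · rintro p hp a m₂ _ ⟨rfl, ha, hpm, hn₂, hG₁', hG₂'⟩
      refine (realizes_loop_roundProgram hb hL hN hD hM hN0 hD0 G₁ G₂ hn₂ hpm
        (Nat.lt_succ_iff.1 hp) hG₁' hG₂' a ha).mono ?_
      rintro a' m₃ _ hf ⟨rfl, ha'⟩
      refine ⟨rfl, ?_, ?_, ?_, ?_, ?_⟩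
      · rw [setVar_of_ne _ _ (by decide), ha']
      · rw [setVar_self, hf _ (hw depthVar (by decide)), hpm]
      · rw [setVar_of_ne _ _ (by decide), hf _ (hw 0 (by decide)), hn₂]
      · rw [setVar_of_ne _ _ (by decide), hf _ (hw 1 (by decide)), hG₁']
      · rw [setVar_of_ne _ _ (by decide), hf _ (hw 2 (by decide)), hG₂']
  refine PMF.Coupled.map_eq (hreal 0) _ fun a s h => ?_
  rw [h]
  cases a <;> rfl

end Correctness

end QMachine

/-! ### The running time of the program -/

namespace QMachine

theorem tame_skip : skip.Tame := ⟨⟨0, fun m => by simp [Term.val]⟩, trivial⟩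

theorem tame_assign_const {a k : ℕ} {i : Term} (ha : a ≠ 0) :
    (Program.assign a i (.const k)).Tame := ⟨ha, k, fun _ B _ => Nat.le_add_left k B⟩

theorem tame_incr {x : ℕ} (hx : x ≠ 0) : (incr x).Tame :=
  ⟨hx, 1, fun _ _ hm => Nat.add_le_add_right (hm _ _) 1⟩

theorem tame_forLoop {x : ℕ} {t : Term} {c : Program} (hx : x ≠ 0) (p : Polynomial ℕ)
    (hp : ∀ m, t.val m ≤ p.eval (m 0 0)) (hc : c.Tame) : (forLoop x t c).Tame :=
  ⟨tame_assign_const hx, ⟨p, hp⟩, hc, tame_incr hx⟩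

theorem tame_forVertices {x : ℕ} {c : Program} (hx : x ≠ 0) (hc : c.Tame) :
    (forLoop x (var 0) c).Tame :=
  tame_forLoop hx Polynomial.X (fun m => by simp [Term.val, var]) hc

section

variable {tL tM tb tN tD : Term} {L M b N : Polynomial ℕ}

theorem tame_phaseProgram (hb : ∀ m, tb.val m = b.eval (m 0 0)) (x s : ℕ) :
    (phaseProgram tb x s).Tame :=
  tame_forLoop (by decide) b (fun m => (hb m).le) ⟨trivial, tame_skip⟩

theorem tame_shotProgram (hb : ∀ m, tb.val m = b.eval (m 0 0))
    (hL : ∀ m, tL.val m = L.eval (m 0 0)) (G : ℕ) {y : ℕ} (hy : y ≠ 0) :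
    (shotProgram tL tb G y).Tame := by
  have hlevel : (levelProgram tb G).Tame :=
    ⟨tame_forVertices (by decide) (tame_forVertices (by decide)
      ⟨⟨trivial, tame_phaseProgram hb _ _, trivial⟩, tame_skip⟩),
    tame_forVertices (by decide) ⟨trivial, tame_phaseProgram hb _ _, trivial⟩⟩
  have hdepth : ∀ m, (depthTerm tL).val m ≤ L.eval (m 0 0) := fun m => by
    simp only [depthTerm, Term.val, hL]
    omega
  exact ⟨⟨tame_forVertices (by decide) trivial, tame_forLoop (by decide) L hdepth hlevel⟩, trivial,
    tame_forVertices (by decide) (tame_forVertices (by decide)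
      ⟨⟨tame_skip, tame_incr hy⟩, tame_skip⟩)⟩

theorem tame_drawProgram (hb : ∀ m, tb.val m = b.eval (m 0 0))
    (hL : ∀ m, tL.val m = L.eval (m 0 0)) {x : ℕ} (hx : x ≠ 0) : (drawProgram tL tb x).Tame := by
  refine tame_forLoop (by decide) (L * b) (fun m => ?_)
    ⟨trivial, trivial, hx, 0, fun m B hm => hm _ _⟩
  rw [Term.val, hb, Polynomial.eval_mul]
  refine Nat.mul_le_mul_right _ ?_
  simp only [depthTerm, Term.val, hL]
  omega

theorem tame_comparisonProgram (hb : ∀ m, tb.val m = b.eval (m 0 0))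
    (hL : ∀ m, tL.val m = L.eval (m 0 0)) (hN : ∀ m, tN.val m = N.eval (m 0 0))
    (hM : ∀ m, tM.val m = M.eval (m 0 0)) : (comparisonProgram tL tM tb tN tD).Tame := by
  have hsum : ∀ g y, y ≠ 0 → (sumProgram tL tb tN g y).Tame := fun g y hy =>
    ⟨tame_assign_const hy, ⟨N, fun m => (hN m).le⟩, tame_shotProgram hb hL g hy⟩
  refine ⟨tame_assign_const (by decide), tame_forLoop (by decide) (L + 1) (fun m => ?_)
    ⟨⟨M, fun m => (hM m).le⟩, tame_drawProgram hb hL (by decide),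
      tame_drawProgram hb hL (by decide), hsum _ _ (by decide), hsum _ _ (by decide),
      tame_assign_const (by decide), tame_skip⟩⟩
  simp [Term.val, hL]

end

/-! ### Polynomial parameters -/

/-- Polynomials in the input size can be evaluated by arithmetic expressions. -/
theorem exists_term_eval (p : Polynomial ℕ) : ∃ t : Term, ∀ m, t.val m = p.eval (m 0 0) := by
  induction p using Polynomial.induction_on with
  | C k => exact ⟨.const k, fun m => by simp [Term.val]⟩
  | add p q hp hq =>
    obtain ⟨s, hs⟩ := hp
    obtain ⟨t, ht⟩ := hq
    exact ⟨.add s t, fun m => by simp [Term.val, hs, ht]⟩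
  | monomial k c h =>
    obtain ⟨t, ht⟩ := h
    refine ⟨.mul t (var 0), fun m => ?_⟩
    rw [Term.val, ht, pow_succ, ← mul_assoc]
    simp [Term.val, var]

end QMachine

/-- Real polynomials are dominated on the natural numbers by polynomials with natural
coefficients. -/
theorem exists_nat_polynomial_ge (P : Polynomial ℝ) :
    ∃ p : Polynomial ℕ, ∀ n : ℕ, P.eval (n : ℝ) ≤ (p.eval n : ℕ) := by
  induction P using Polynomial.induction_on' with
  | add P Q hP hQ =>
    obtain ⟨p, hp⟩ := hP
    obtain ⟨q, hq⟩ := hQ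
    refine ⟨p + q, fun n => ?_⟩
    rw [Polynomial.eval_add, Polynomial.eval_add, Nat.cast_add]
    exact add_le_add (hp n) (hq n)
  | monomial k c =>
    refine ⟨Polynomial.monomial k ⌈c⌉₊, fun n => ?_⟩
    rw [Polynomial.eval_monomial, Polynomial.eval_monomial, Nat.cast_mul, Nat.cast_pow]
    exact mul_le_mul_of_nonneg_right (Nat.le_ceil c) (by positivity)

theorem mainTheorem4 (P Q : Polynomial ℝ)
    (hgap : ∀ (n : ℕ) (G₁ G₂ : SimpleGraph (Fin n)), ¬ Nonempty (G₁ ≃g G₂) →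
      0 < Q.eval (n : ℝ) ∧
      ∃ p : ℕ, (p : ℝ) ≤ P.eval (n : ℝ) ∧ 1 / Q.eval (n : ℝ) ≤ QAOA.gap G₁ G₂ p) :
    ∃ (maxLevel rounds bits shots precision : Polynomial ℕ) (c : QMachine.Program),
      (∀ (n : ℕ) (G₁ G₂ : SimpleGraph (Fin n)),
        c.answer G₁ G₂ = QAOA.energyComparison G₁ G₂ (maxLevel.eval n) (rounds.eval n)
          (bits.eval n) (shots.eval n) (precision.eval n)) ∧
      c.PolyTime ∧
      c.DecidesIsomorphism := by
  obtain ⟨L, hL⟩ := exists_nat_polynomial_ge P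
  obtain ⟨q', hq'⟩ := exists_nat_polynomial_ge Q
  set X : Polynomial ℕ := Polynomial.X
  -- adding one makes `q` positive at every `n`, also where the hypothesis says nothing about `Q`
  set q := q' + 1 with hq
  set M := 16 * q * X ^ 2 + 1 with hM
  set b := 64 * q * L * X ^ 2 * (X ^ 2 + 2 * X) + 1 with hb
  set D := 8 * q with hD
  set N := 24 * D ^ 2 * X ^ 4 * ((L + 1) * M) + 1 with hN
  obtain ⟨tL, htL⟩ := QMachine.exists_term_eval L
  obtain ⟨tM, htM⟩ := QMachine.exists_term_eval M
  obtain ⟨tb, htb⟩ := QMachine.exists_term_eval b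
  obtain ⟨tN, htN⟩ := QMachine.exists_term_eval N
  obtain ⟨tD, htD⟩ := QMachine.exists_term_eval D
  have hq0 : ∀ n, 0 < q.eval n := fun n => by simp [hq]
  have hanswer : ∀ (n : ℕ) (G₁ G₂ : SimpleGraph (Fin n)),
      (QMachine.comparisonProgram tL tM tb tN tD).answer G₁ G₂ =
        QAOA.energyComparison G₁ G₂ (L.eval n) (M.eval n) (b.eval n) (N.eval n) (D.eval n) := by
    intro n G₁ G₂
    refine QMachine.answer_comparisonProgram ?_ ?_ ?_ ?_ ?_ ?_ ?_ G₁ G₂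
    · intro m hm
      rw [htb, hm]
    · intro m hm
      rw [htL, hm]
    · intro m hm
      rw [htN, hm]
    · intro m hm
      rw [htD, hm]
    · intro m hm
      rw [htM, hm]
    · simp [hN]
    · have := hq0 n
      simp only [hD, Polynomial.eval_mul, Polynomial.eval_ofNat]
      omega
  refine ⟨L, M, b, N, D, QMachine.comparisonProgram tL tM tb tN tD, hanswer,
    (QMachine.tame_comparisonProgram htb htL htN htM).polyTime, fun n G₁ G₂ => ?_⟩
  rw [hanswer]
  refine QAOA.energyComparison_decides (L.eval n) (q.eval n) (hq0 n) G₁ G₂ (fun h => ?_) _ _ _ _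
    (by simp [hM, X]) (by simp [hb, X]) (by simp [hD]) (by simp [hN, X])
  obtain ⟨hQ, p, hp, hgap⟩ := hgap n G₁ G₂ h
  refine ⟨p, by exact_mod_cast hp.trans (hL n), (one_div_le_one_div_of_le hQ ?_).trans hgap⟩
  refine (hq' n).trans ?_
  rw [hq, Polynomial.eval_add, Polynomial.eval_one]
  push_cast
  linarith
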